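/- For $n\ge 1$ let $\Omega_2$ be the set of real symmetric positive definite $n\times n$ matrices $Q$ with $Q_{ii}=1$ for all $i$ and $vQv^t\ge 1$ for all $v\in\mathbb Z^n\setminus\{0\}$. Its vertices are its extreme points. A matrix $Q\in\Omega_2$ determines, up to isometry, a flat torus $\mathbb R^n/\Lambda$ (with the metric $|du|^2$ up to a constant factor), where the dual lattice $\Lambda^*$ is generated by vectors $\eta_1,\dots,\eta_n$ with Gram matrix $Q$. A $\lambda_1$-minimal immersion of a flat torus is a minimal immersion into a unit sphere, isometric for a metric $c\,|du|^2$ with $c>0$, whose coordinate functions are eigenfunctions of the Laplacian for the first (least positive) eigenvalue. Two such immersions are congruent if, after including the target spheres as great spheres in a common sphere, an isometry of that sphere carries one to the other up to an isometry $u\mapsto g(u)+b$ of the tori. For an integer $N\times n$ matrix $Y$ with rows $A_1,\dots,A_N$, the matrix data $\{Y,Q,(c_1^2,\dots,c_N^2)\}$ denote the map $u\mapsto (c_j e^{2\pi i\langle \xi_j,u\rangle})_{1\le j\le N}\in\mathbb C^N$ on $\mathbb R^n/\Lambda$, where $\xi_j=\sum_k (A_j)_k\eta_k$. Let $Q_n$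 be the $n\times n$ matrix with diagonal entries $1$, entries $-\frac12$ directly above and below the diagonal, and $0$ elsewhere, and let $Y_n$ be the matrix whose rows are the $\frac{n(n+1)}2$ vectors $e_i+e_{i+1}+\dots+e_j$, $1\le i\le j\le n$. Then for $1\le n\le 4$ the flat torus determined by any vertex of $\Omega_2$ admits a $\lambda_1$-minimal immersion into some sphere. Up to congruence, the $\lambda_1$-minimal immersions of the flat tori determined by the vertices of $\Omega_2$ are exactly the following: (1) for $n=2$: the equilateral torus in $\mathbb S^5$, with matrix data $\{Y_2,Q_2,\frac13(1,1,1)\}$; (2) for $n=3$: the torus in $\mathbb S^{11}$ with matrix data $\{Y_3,Q_3,\frac16(1,\dots,1)\}$; (3) for $n=4$: the torus in $\mathbb S^{19}$ with matrix data $\{Y_4,Q_4,\frac1{10}(1,\dots,1)\}$, and the immersions of $\mathbb R^4/\mathrm{Span}_{\mathbb Z}\{e_1-e_4,e_2-e_4,e_3-e_4,2e_4\}$ in $\mathbb S^{23}$ given by $$\begin{aligned}\big(&a_1e^{i\pi(u_1+u_2+u_3+u_4)},a_1e^{i\pi(u_1+u_2-u_3-u_4)},a_1e^{i\pi(u_1-u_2+u_3-u_4)},a_1e^{i\pi(-u_1+u_2+u_3-u_4)},\\&a_2e^{i\pi(u_1+u_2+u_3-u_4)},a_2e^{i\pi(u_1+u_2-u_3+u_4)},a_2e^{i\pi(u_1-u_2+u_3+u_4)},a_2e^{i\pi(u_1-u_2-u_3-u_4)},\\&a_3e^{2i\pi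 u_1},a_3e^{2i\pi u_2},a_3e^{2i\pi u_3},a_3e^{2i\pi u_4}\big)\end{aligned}$$ with $0\le a_1\le a_2\le a_3$ and $a_1^2+a_2^2+a_3^2=\frac14$. For each vertex, all $\lambda_1$-minimal immersions of its torus are congruent to the first, or all are congruent to members of this family. In particular $Q_2,Q_3,Q_4$ are vertices, the torus carrying the family is determined by a vertex, and all the maps listed are $\lambda_1$-minimal immersions. -/

import Mathlib

open scoped ContDiff InnerProductSpace

namespace FlatTori

noncomputable section

/-- Euclidean `n`-space. -/
abbrev E (n : ℕ) := EuclideanSpace ℝ (Fin n)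

/-- The set of positive definite symmetric `n × n` matrices with unit diagonal whose
quadratic form is at least `1` on every nonzero integer vector. -/
def Omega2 (n : ℕ) : Set (Matrix (Fin n) (Fin n) ℝ) :=
  {Q | Q.PosDef ∧ (∀ i, Q i i = 1) ∧
    ∀ v : Fin n → ℤ, v ≠ 0 →
      1 ≤ (fun i => (v i : ℝ)) ⬝ᵥ (Q.mulVec (fun i => (v i : ℝ)))}

/-- The vertices of `Omega2 n`. -/
def vertices (n : ℕ) : Set (Matrix (Fin n) (Fin n) ℝ) :=
  (Omega2 n).extremePoints ℝ

/-- The dual lattice: all vectors having integral inner product with every element of `L`. -/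
def dualLattice {n : ℕ} (L : Submodule ℤ (E n)) : Submodule ℤ (E n) :=
  LinearMap.BilinForm.dualSubmodule (innerₗ (E n)) L

/-- The lattice `Λ` whose dual lattice `Λ*` is generated by `η₁, …, ηₙ`. The flat torus
"determined by a Gram matrix `Q`" is `ℝⁿ / torusLattice η`, for any `η` with Gram matrix `Q`. -/
def torusLattice {n : ℕ} (η : Fin n → E n) : Submodule ℤ (E n) :=
  dualLattice (Submodule.span ℤ (Set.range η))

/-! ### Spectrum of the flat torus `(ℝⁿ / Λ, c |du|²)`

Functions and maps on `ℝⁿ / Λ` are identified with the `Λ`-periodic ones on `ℝⁿ`. -/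

/-- `f` is constant on the cosets of `Λ`, i.e. it is a map defined on `ℝⁿ / Λ`. -/
def Periodic {n : ℕ} {F : Type*} (Λ : Submodule ℤ (E n)) (f : E n → F) : Prop :=
  ∀ l ∈ Λ, ∀ u, f (u + l) = f u

/-- `f` is a smooth function on `ℝⁿ / Λ` with `-Δ_g f = μ f`, where `g = c |du|²`, so that
`Δ_g = c⁻¹ Δ`. The zero function is allowed here. -/
def SatisfiesEigen {n : ℕ} (Λ : Submodule ℤ (E n)) (c μ : ℝ) (f : E n → ℝ) : Prop :=
  ContDiff ℝ ∞ f ∧ Periodic Λ f ∧ ∀ u, -(c⁻¹ * Laplacian.laplacian f u) = μ * f u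

/-- `μ` is an eigenvalue of the Laplacian of `(ℝⁿ / Λ, c |du|²)`. -/
def IsEigenvalue {n : ℕ} (Λ : Submodule ℤ (E n)) (c μ : ℝ) : Prop :=
  ∃ f : E n → ℝ, f ≠ 0 ∧ SatisfiesEigen Λ c μ f

/-- `μ` is the first eigenvalue `λ₁` of `(ℝⁿ / Λ, c |du|²)`: the least positive one. -/
def IsFirstEigenvalue {n : ℕ} (Λ : Submodule ℤ (E n)) (c μ : ℝ) : Prop :=
  IsLeast {ν : ℝ | 0 < ν ∧ IsEigenvalue Λ c ν} μ

/-! ### Immersions into the unit sphere of a Euclidean space `V` -/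

section Immersions

variable {n : ℕ} {V : Type*} [NormedAddCommGroup V] [InnerProductSpace ℝ V]
  [FiniteDimensional ℝ V]

/-- The normal space at `x u`, inside the tangent space of the unit sphere, of a map `x` into
the unit sphere: the orthogonal complement of `x u` and of the image of the differential. -/
def normalSpace (x : E n → V) (u : E n) : Submodule ℝ V :=
  (Submodule.span ℝ {x u} ⊔ LinearMap.range (fderiv ℝ x u).toLinearMap)ᗮ

/-- The second fundamental form of `x` as an immersion into the unit sphere: the normal
component of the second derivative. -/
def secondFundamentalForm (x : E n → V) (u v w : E n) : V :=
  (normalSpace x u).starProjection (fderiv ℝ (fderiv ℝ x) u v w)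

/-- The mean curvature vector of `x` in the unit sphere, for the induced metric `c |du|²`:
`1/n` times the trace of the second fundamental form with respect to that metric. -/
def meanCurvature (c : ℝ) (x : E n → V) (u : E n) : V :=
  ((n : ℝ)⁻¹ * c⁻¹) • ∑ i : Fin n,
    secondFundamentalForm x u (EuclideanSpace.single i 1) (EuclideanSpace.single i 1)

/-- `x` is a `λ₁`-minimal immersion of the flat torus `ℝⁿ / Λ` in the unit sphere of `V`: a
smooth immersion, isometric for a metric `c |du|²` with `c > 0`, with vanishing mean curvature,
all of whose coordinate functions are eigenfunctions for the first eigenvalue. -/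
def IsLambdaOneMinimal (Λ : Submodule ℤ (E n)) (x : E n → V) : Prop :=
  ContDiff ℝ ∞ x ∧ Periodic Λ x ∧ (∀ u, ‖x u‖ = 1) ∧
  ∃ c : ℝ, 0 < c ∧
    (∀ u v w, ⟪fderiv ℝ x u v, fderiv ℝ x u w⟫_ℝ = c * ⟪v, w⟫_ℝ) ∧
    (∀ u, meanCurvature c x u = 0) ∧
    ∃ μ : ℝ, IsFirstEigenvalue Λ c μ ∧
      ∀ a : V, SatisfiesEigen Λ c μ (fun u => ⟪a, x u⟫_ℝ)

/-- Congruence of maps `x` on `ℝⁿ / Λ` and `y` on `ℝⁿ / Λ'` into unit spheres: an isometry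
`u ↦ g u + b` of the tori carries one to the other, up to an isometry of the ambient spheres,
both of which are regarded as great spheres of one common sphere. -/
def Congruent {W : Type*} [NormedAddCommGroup W] [InnerProductSpace ℝ W]
    (Λ Λ' : Submodule ℤ (E n)) (x : E n → V) (y : E n → W) : Prop :=
  ∃ (g : E n ≃ₗᵢ[ℝ] E n) (b : E n),
    (∀ u, u ∈ Λ ↔ g u ∈ Λ') ∧
    ∃ (k : ℕ) (i : V →ₗᵢ[ℝ] E k) (j : W →ₗᵢ[ℝ] E k), ∀ u, i (x u) = j (y (g u + b))

end Immersions

/-! ### The examples -/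

/-- The map with matrix data `{Y, Q, (w₁, …, w_N)}`, where `η` generates the dual lattice and
has Gram matrix `Q`: its components are `√wⱼ exp (2πi ⟨ξⱼ, u⟩)`, with `ξⱼ = ∑ₖ Yⱼₖ ηₖ`. Its values
lie in `ℂᴺ = ℝ²ᴺ`. -/
def dataMap {n N : ℕ} (η : Fin n → E n) (Y : Matrix (Fin N) (Fin n) ℤ) (w : Fin N → ℝ)
    (u : E n) : EuclideanSpace ℂ (Fin N) :=
  WithLp.toLp 2 fun j =>
    (Real.sqrt (w j) : ℂ) *
      Complex.exp (2 * Real.pi * Complex.I * (⟪∑ k, Y j k • η k, u⟫_ℝ : ℝ))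

/-- The matrix data `{Y, Q, w}` give a `λ₁`-minimal flat torus. -/
def DataIsLambdaOneMinimal {n N : ℕ} (Q : Matrix (Fin n) (Fin n) ℝ)
    (Y : Matrix (Fin N) (Fin n) ℤ) (w : Fin N → ℝ) : Prop :=
  (∃ η : Fin n → E n, Matrix.gram ℝ η = Q) ∧
  ∀ η : Fin n → E n, Matrix.gram ℝ η = Q →
    IsLambdaOneMinimal (torusLattice η) (dataMap η Y w)

/-- The map `x` on `ℝⁿ / Λ` is congruent to the one with matrix data `{Y, Q, w}`. -/
def CongruentToData {n N : ℕ} {V : Type*} [NormedAddCommGroup V] [InnerProductSpace ℝ V]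
    [FiniteDimensional ℝ V] (Λ : Submodule ℤ (E n)) (x : E n → V)
    (Q : Matrix (Fin n) (Fin n) ℝ) (Y : Matrix (Fin N) (Fin n) ℤ) (w : Fin N → ℝ) : Prop :=
  ∃ η : Fin n → E n, Matrix.gram ℝ η = Q ∧
    Congruent Λ (torusLattice η) x (dataMap η Y w)

/-- The equilateral 2-torus in `S⁵`. -/
def Q2 : Matrix (Fin 2) (Fin 2) ℝ :=
  !![1, -1/2; -1/2, 1]

def Y2 : Matrix (Fin 3) (Fin 2) ℤ :=
  !![1, 0; 0, 1; 1, 1]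

/-- The 3-torus in `S¹¹`. -/
def Q3 : Matrix (Fin 3) (Fin 3) ℝ :=
  !![1, -1/2, 0; -1/2, 1, -1/2; 0, -1/2, 1]

def Y3 : Matrix (Fin 6) (Fin 3) ℤ :=
  !![1, 0, 0; 0, 1, 0; 1, 1, 0; 0, 0, 1; 0, 1, 1; 1, 1, 1]

/-- The 4-torus in `S¹⁹`. -/
def Q4 : Matrix (Fin 4) (Fin 4) ℝ :=
  !![1, -1/2, 0, 0; -1/2, 1, -1/2, 0; 0, -1/2, 1, -1/2; 0, 0, -1/2, 1]

def Y4 : Matrix (Fin 10) (Fin 4) ℤ :=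
  !![1, 0, 0, 0; 0, 1, 0, 0; 1, 1, 0, 0; 0, 0, 1, 0; 0, 1, 1, 0; 1, 1, 1, 0;
     0, 0, 0, 1; 0, 0, 1, 1; 0, 1, 1, 1; 1, 1, 1, 1]

/-- The lattice generated by `e₁ - e₄`, `e₂ - e₄`, `e₃ - e₄`, `2 e₄` in `ℝ⁴`. -/
def familyLattice : Submodule ℤ (E 4) :=
  Submodule.span ℤ
    {!₂[1, 0, 0, -1], !₂[0, 1, 0, -1], !₂[0, 0, 1, -1], !₂[0, 0, 0, 2]}

/-- The family of maps of `ℝ⁴ / familyLattice` in `S²³`. -/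
def familyMap (a₁ a₂ a₃ : ℝ) (u : E 4) : EuclideanSpace ℂ (Fin 12) :=
  let e : ℝ → ℂ := fun t => Complex.exp (Complex.I * Real.pi * t)
  !₂[a₁ * e (u 0 + u 1 + u 2 + u 3), a₁ * e (u 0 + u 1 - u 2 - u 3),
     a₁ * e (u 0 - u 1 + u 2 - u 3), a₁ * e (-u 0 + u 1 + u 2 - u 3),
     a₂ * e (u 0 + u 1 + u 2 - u 3), a₂ * e (u 0 + u 1 - u 2 + u 3),
     a₂ * e (u 0 - u 1 + u 2 + u 3), a₂ * e (u 0 - u 1 - u 2 - u 3),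
     a₃ * e (2 * u 0), a₃ * e (2 * u 1), a₃ * e (2 * u 2), a₃ * e (2 * u 3)]

/-- The range of the parameters of the family. -/
def FamilyParams (a₁ a₂ a₃ : ℝ) : Prop :=
  0 ≤ a₁ ∧ a₁ ≤ a₂ ∧ a₂ ≤ a₃ ∧ a₁ ^ 2 + a₂ ^ 2 + a₃ ^ 2 = 1 / 4

end

end FlatTori

/-! ### Lattices, dual coordinates and the projection to the standard torus. -/

namespace FlatTori

open Filter MeasureTheory UnitAddTorus

/-! Classification of the tori. A vertex `Q` is the Gram matrix of a perfect lattice of minimum `1`: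
if a symmetric bilinear form vanishes on all unit vectors of the lattice, a small move of `Q` along
it in either direction stays in `Omega2`, so the form is zero (`eq_zero_of_mem_vertices`). Unit
vectors congruent modulo `2` are equal or opposite, so perfection requires at least `n(n+1)/2`
classes of unit vectors modulo `2` (`card_unitClasses`). In dimensions three and four, so many
classes contain a basis whose consecutive sums are again classes of unit vectors
(`exists_path_three`, `exists_path_four`). Lifts of this basis have odd index, and Watson's
inequality shows that they generate the lattice (`span_eq_of_odd_det`). After changes of sign the
consecutive inner products are `-1/2`. The remaining inner products range over a polytope, and
perfection forces them to be a vertex of it (`cases_of_pinned`). Up to a change of basis this leaves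
the root lattices `A2`, `A3`, and `A4` or `D4`, scaled to minimum `1`.

Classification of the immersions. Each coordinate of a `λ₁`-minimal immersion is a trigonometric
polynomial whose frequencies are the unit vectors of the dual lattice. The conditions `‖x‖ = 1` and
conformality to the flat metric are quadratic relations between its coefficients. In the lattices
above inner products are half-integers, and the relations then force coefficients of non-opposite
frequencies to be orthogonal (`pair_coeff_eq_zero`). Hence `⟪x u, x v⟫ = ∑ wⱼ cos (2π⟨ξⱼ, u - v⟩)`,
with nonnegative weights of sum `1` satisfying `∑ wⱼ ξⱼ ⊗ ξⱼ = (1/n) Id`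
(`exists_weights_of_isLambdaOneMinimal`). Conversely, every such system of weights gives a
`λ₁`-minimal immersion (`isLambdaOneMinimal_waveMap`), and the kernel `⟪x u, x v⟫` determines the
map up to congruence (`congruent_of_inner_eq`).

The equations for the weights are linear. Their only solution is uniform for `A2`, `A3`, `A4`. For
`D4` the solutions are constant on three orthogonal frames of minimal vectors; reflections of the
lattice permute these frames, so the three weights can be sorted. -/

/-- The integral combination `∑ kᵢ vᵢ`. -/
def comb {V : Type*} [AddCommGroup V] {n : ℕ} (v : Fin n → V) (k : Fin n → ℤ) : V :=
  ∑ i, k i • v i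

/-- The character `u ↦ exp (2πi ⟨ξ, u⟩)`. -/
noncomputable def wave {n : ℕ} (ξ u : E n) : ℂ :=
  Complex.exp (2 * Real.pi * Complex.I * (⟪ξ, u⟫_ℝ : ℝ))

section Comb

variable {V : Type*} [AddCommGroup V] {n : ℕ} (v : Fin n → V)

lemma comb_zero : comb v 0 = 0 := by simp [comb]

lemma comb_add (k l : Fin n → ℤ) : comb v (k + l) = comb v k + comb v l := by
  simp [comb, add_smul, Finset.sum_add_distrib]

lemma comb_neg (k : Fin n → ℤ) : comb v (-k) = -comb v k := by
  simp [comb]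

lemma comb_sub (k l : Fin n → ℤ) : comb v (k - l) = comb v k - comb v l := by
  rw [sub_eq_add_neg, comb_add, comb_neg, sub_eq_add_neg]

lemma comb_mem_span (k : Fin n → ℤ) : comb v k ∈ Submodule.span ℤ (Set.range v) :=
  Submodule.sum_mem _ fun i _ => Submodule.smul_mem _ _ (Submodule.subset_span ⟨i, rfl⟩)

lemma mem_span_iff_exists_comb {x : V} :
    x ∈ Submodule.span ℤ (Set.range v) ↔ ∃ k, comb v k = x :=
  Submodule.mem_span_range_iff_exists_fun ℤ

lemma comb_injective [Module ℝ V] (hv : LinearIndependent ℝ v) :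
    Function.Injective (comb v) := by
  intro k l h
  have h2 : ∑ i, ((k i - l i : ℤ) : ℝ) • v i = 0 := by
    have := sub_eq_zero.2 h
    rw [← comb_sub] at this
    simpa [comb, ← Int.cast_smul_eq_zsmul ℝ] using this
  ext i
  have := Fintype.linearIndependent_iff.1 hv _ h2 i
  exact sub_eq_zero.1 (by exact_mod_cast this)

end Comb

section Lattice

variable {n : ℕ} {η : Fin n → E n}

lemma inner_comb_left (η : Fin n → E n) (k : Fin n → ℤ) (u : E n) :
    ⟪comb η k, u⟫_ℝ = ∑ i, (k i : ℝ) * ⟪η i, u⟫_ℝ := by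
  simp [comb, sum_inner, ← Int.cast_smul_eq_zsmul ℝ, inner_smul_left]

lemma mem_dualLattice {L : Submodule ℤ (E n)} {u : E n} :
    u ∈ dualLattice L ↔ ∀ l ∈ L, ∃ m : ℤ, (m : ℝ) = ⟪u, l⟫_ℝ := by
  simp [dualLattice, LinearMap.BilinForm.mem_dualSubmodule, Submodule.mem_one]

lemma mem_torusLattice {u : E n} :
    u ∈ torusLattice η ↔ ∀ i, ∃ m : ℤ, (m : ℝ) = ⟪η i, u⟫_ℝ := by
  rw [torusLattice, mem_dualLattice]
  constructor
  · intro h i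
    obtain ⟨m, hm⟩ := h _ (Submodule.subset_span ⟨i, rfl⟩)
    exact ⟨m, by rw [hm, real_inner_comm]⟩
  · intro h l hl
    obtain ⟨k, rfl⟩ := (mem_span_iff_exists_comb η).1 hl
    choose m hm using h
    refine ⟨∑ i, k i * m i, ?_⟩
    rw [real_inner_comm, inner_comb_left]
    push_cast
    simp [hm]

lemma inner_comb_mem_torusLattice {u : E n} (hu : u ∈ torusLattice η) (k : Fin n → ℤ) :
    ∃ m : ℤ, (m : ℝ) = ⟪comb η k, u⟫_ℝ := by
  obtain ⟨m, hm⟩ := mem_dualLattice.1 hu _ (comb_mem_span η k)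
  exact ⟨m, by rw [hm, real_inner_comm]⟩

/-- The coordinates `u ↦ (⟨ηᵢ, u⟩)ᵢ`. -/
noncomputable def dualCoords (η : Fin n → E n) : E n →ₗ[ℝ] (Fin n → ℝ) :=
  LinearMap.pi fun i => innerₗ (E n) (η i)

lemma span_eq_top_of_linearIndependent (hη : LinearIndependent ℝ η) :
    Submodule.span ℝ (Set.range η) = ⊤ :=
  hη.span_eq_top_of_card_eq_finrank' (by simp)

/-- A linearly independent family of `n` vectors as a basis. -/
noncomputable def basisOf (hη : LinearIndependent ℝ η) : Module.Basis (Fin n) ℝ (E n) :=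
  Module.Basis.mk hη (span_eq_top_of_linearIndependent hη).ge

@[simp] lemma coe_basisOf (hη : LinearIndependent ℝ η) : ⇑(basisOf hη) = η :=
  Module.Basis.coe_mk _ _

lemma eq_zero_of_inner_eq_zero (hη : LinearIndependent ℝ η) {u : E n}
    (h : ∀ i, ⟪η i, u⟫_ℝ = 0) : u = 0 := by
  have hs := span_eq_top_of_linearIndependent hη
  have : u ∈ (Submodule.span ℝ (Set.range η))ᗮ := by
    rw [Submodule.mem_orthogonal]
    intro w hw
    induction hw using Submodule.span_induction with
    | mem x hx => obtain ⟨i, rfl⟩ := hx; exact h i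
    | zero => simp
    | add x y _ _ hx hy => rw [inner_add_left, hx, hy, add_zero]
    | smul a x _ hx => rw [inner_smul_left, hx, mul_zero]
  simpa [hs] using this

/-- The coordinates `u ↦ (⟨ηᵢ, u⟩)ᵢ` as an isomorphism. -/
noncomputable def dualCoordsEquiv (hη : LinearIndependent ℝ η) : E n ≃L[ℝ] (Fin n → ℝ) :=
  (LinearEquiv.ofInjectiveOfFinrankEq (dualCoords η) (by
    rw [← LinearMap.ker_eq_bot, Submodule.eq_bot_iff]
    intro u hu
    exact eq_zero_of_inner_eq_zero hη fun i => congrFun hu i) (by simp)).toContinuousLinearEquiv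

@[simp] lemma dualCoordsEquiv_apply (hη : LinearIndependent ℝ η) (u : E n) (i : Fin n) :
    dualCoordsEquiv hη u i = ⟪η i, u⟫_ℝ := rfl

lemma exists_dual_basis (hη : LinearIndependent ℝ η) :
    ∃ β : Fin n → E n, ∀ i j, ⟪η i, β j⟫_ℝ = if i = j then 1 else 0 := by
  refine ⟨fun j => (dualCoordsEquiv hη).symm (Pi.single j 1), fun i j => ?_⟩
  rw [← dualCoordsEquiv_apply hη, ContinuousLinearEquiv.apply_symm_apply]
  simp [Pi.single_apply]

/-- The projection of `ℝⁿ` to the standard torus given by the coordinates `⟨ηᵢ, u⟩` mod `1`. -/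
noncomputable def torusProj (η : Fin n → E n) (u : E n) : UnitAddTorus (Fin n) :=
  fun i => ((⟪η i, u⟫_ℝ : ℝ) : UnitAddCircle)

lemma torusProj_add (u v : E n) : torusProj η (u + v) = torusProj η u + torusProj η v := by
  ext i
  simp [torusProj, inner_add_right]

lemma isOpenQuotientMap_torusProj (hη : LinearIndependent ℝ η) :
    IsOpenQuotientMap (torusProj η) := by
  have h1 : IsOpenQuotientMap
      (Pi.map fun (_ : Fin n) (t : ℝ) => (t : UnitAddCircle)) :=
    IsOpenQuotientMap.piMap fun _ => QuotientAddGroup.isOpenQuotientMap_mk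
  exact h1.comp (dualCoordsEquiv hη).toHomeomorph.isOpenQuotientMap

lemma continuous_torusProj (hη : LinearIndependent ℝ η) : Continuous (torusProj η) :=
  (isOpenQuotientMap_torusProj hη).continuous

lemma sub_mem_torusLattice_of_torusProj_eq {u v : E n} (h : torusProj η u = torusProj η v) :
    u - v ∈ torusLattice η := by
  rw [mem_torusLattice]
  intro i
  have h2 : ((⟪η i, u⟫_ℝ : ℝ) : UnitAddCircle) = (⟪η i, v⟫_ℝ : ℝ) := congrFun h i
  rw [← sub_eq_zero, ← AddCircle.coe_sub, AddCircle.coe_eq_zero_iff] at h2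
  obtain ⟨m, hm⟩ := h2
  exact ⟨m, by rw [inner_sub_right, ← hm]; simp⟩

lemma mFourier_torusProj (k : Fin n → ℤ) (u : E n) :
    mFourier k (torusProj η u) = wave (comb η k) u := by
  simp only [mFourier, torusProj, ContinuousMap.coe_mk, fourier_coe_apply, wave, inner_comb_left]
  rw [← Complex.exp_sum]
  congr 1
  push_cast
  rw [Finset.mul_sum]
  refine Finset.sum_congr rfl fun i _ => ?_
  ring

/-- Points with the same projection differ by an element of `torusLattice η`, so periodic functions
descend and Fourier analysis takes place on the standard torus. -/
lemma exists_lift_torus (hη : LinearIndependent ℝ η) {f : E n → ℂ} (hf : Continuous f)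
    (hp : Periodic (torusLattice η) f) :
    ∃ G : C(UnitAddTorus (Fin n), ℂ), ∀ u, G (torusProj η u) = f u := by
  let P : C(E n, UnitAddTorus (Fin n)) := ⟨torusProj η, continuous_torusProj hη⟩
  have hP : Topology.IsQuotientMap P := (isOpenQuotientMap_torusProj hη).isQuotientMap
  have hG : ∀ u v, P u = P v → (⟨f, hf⟩ : C(E n, ℂ)) u = (⟨f, hf⟩ : C(E n, ℂ)) v := by
    intro u v h
    have := hp _ (sub_mem_torusLattice_of_torusProj_eq h) v
    simpa using this
  exact ⟨hP.lift ⟨f, hf⟩ hG, fun u => DFunLike.congr_fun (hP.lift_comp ⟨f, hf⟩ hG) u⟩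

end Lattice

end FlatTori

/-! ### Fourier expansion of the eigenfunctions of a flat torus. -/

namespace FlatTori

open Filter MeasureTheory UnitAddTorus

section Fourier

noncomputable local instance : MeasureSpace UnitAddCircle := ⟨AddCircle.haarAddCircle⟩

local instance : Measure.IsAddHaarMeasure (volume : Measure UnitAddCircle) :=
  inferInstanceAs (Measure.IsAddHaarMeasure AddCircle.haarAddCircle)

local instance : IsProbabilityMeasure (volume : Measure UnitAddCircle) :=
  inferInstanceAs (IsProbabilityMeasure AddCircle.haarAddCircle)

lemma mFourierCoeff_translate {n : ℕ} (G : C(UnitAddTorus (Fin n), ℂ)) (k : Fin n → ℤ)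
    (a : UnitAddTorus (Fin n)) :
    mFourierCoeff (fun y => G (y + a)) k = mFourier k a * mFourierCoeff G k := by
  have h1 : mFourierCoeff (fun y => G (y + a)) k
      = ∫ y, mFourier (-k) (y + a - a) • G (y + a) := by
    simp [mFourierCoeff]
  rw [h1, integral_add_right_eq_self (fun y => mFourier (-k) (y - a) • G y) a,
    mFourierCoeff, ← integral_const_mul]
  congr 1
  ext y
  have h2 : mFourier (-k) (y - a) = mFourier (-k) y * mFourier k a := by
    simp only [mFourier, ContinuousMap.coe_mk, ← Finset.prod_mul_distrib]
    refine Finset.prod_congr rfl fun i _ => ?_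
    rw [fourier_apply, fourier_apply, fourier_apply, ← Circle.coe_mul, ← AddCircle.toCircle_add,
      Pi.sub_apply, Pi.neg_apply]
    congr 2
    simp only [smul_sub, neg_smul]
    abel
  rw [h2, smul_eq_mul, smul_eq_mul]
  ring

lemma hasDerivAt_wave_smul {n : ℕ} (ξ v : E n) :
    HasDerivAt (fun s : ℝ => wave ξ (s • v)) (2 * Real.pi * Complex.I * (⟪ξ, v⟫_ℝ : ℝ)) 0 := by
  have h : HasDerivAt (fun s : ℝ => Complex.exp ((s : ℂ) * (2 * Real.pi * Complex.I * (⟪ξ, v⟫_ℝ : ℝ))))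
      (2 * Real.pi * Complex.I * (⟪ξ, v⟫_ℝ : ℝ)) 0 := by
    have := ((Complex.ofRealCLM.hasDerivAt (x := (0 : ℝ))).mul_const
      (2 * Real.pi * Complex.I * (⟪ξ, v⟫_ℝ : ℝ))).cexp
    simpa using this
  refine h.congr_of_eventuallyEq (Eventually.of_forall fun s => ?_)
  simp only [wave, inner_smul_right]
  congr 1
  push_cast
  ring

variable {n : ℕ} {η : Fin n → E n}

/-- The coefficient of the translate of `G` along `s • v` is differentiated at `s = 0` in two ways:
under the integral sign, and through `mFourierCoeff_translate`, which makes it a wave in `s` times a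
constant. No integration by parts is involved. -/
lemma mFourierCoeff_fderiv (hη : LinearIndependent ℝ η) {f : E n → ℂ} (hf : Differentiable ℝ f)
    (v : E n) {G G' : C(UnitAddTorus (Fin n), ℂ)} (hG : ∀ u, G (torusProj η u) = f u)
    (hG' : ∀ u, G' (torusProj η u) = fderiv ℝ f u v) (k : Fin n → ℤ) :
    mFourierCoeff G' k
      = 2 * Real.pi * Complex.I * (⟪comb η k, v⟫_ℝ : ℝ) * mFourierCoeff G k := by
  have hder : ∀ (y : UnitAddTorus (Fin n)) (s : ℝ),
      HasDerivAt (fun s : ℝ => G (y + torusProj η (s • v))) (G' (y + torusProj η (s • v))) s := by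
    intro y s
    obtain ⟨u, rfl⟩ := (isOpenQuotientMap_torusProj hη).surjective y
    simp only [← torusProj_add, hG, hG']
    have h1 : HasDerivAt (fun s : ℝ => u + s • v) v s := by
      simpa using ((hasDerivAt_id s).smul_const v).const_add u
    exact (hf (u + s • v)).hasFDerivAt.comp_hasDerivAt s h1
  have hcont : ∀ (H : C(UnitAddTorus (Fin n), ℂ)) (s : ℝ), Continuous fun y =>
      mFourier (-k) y • H (y + torusProj η (s • v)) := fun H s =>
    ((mFourier (-k)).continuous).smul (H.continuous.comp (continuous_id.add continuous_const))
  have h1 : HasDerivAt (fun s : ℝ => mFourierCoeff (fun y => G (y + torusProj η (s • v))) k)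
      (∫ y, mFourier (-k) y • G' (y + torusProj η ((0 : ℝ) • v))) 0 := by
    refine (hasDerivAt_integral_of_dominated_loc_of_deriv_le (bound := fun _ => ‖G'‖)
      (F := fun s y => mFourier (-k) y • G (y + torusProj η (s • v)))
      (F' := fun s y => mFourier (-k) y • G' (y + torusProj η (s • v)))
      Filter.univ_mem ?_ ?_ ?_ ?_ ?_ ?_).2
    · exact Eventually.of_forall fun s => (hcont G s).aestronglyMeasurable
    · exact (hcont G 0).integrable_of_hasCompactSupport
        (HasCompactSupport.of_compactSpace _)
    · exact (hcont G' 0).aestronglyMeasurable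
    · refine Eventually.of_forall fun y s _ => ?_
      rw [norm_smul]
      have h2 : ‖mFourier (-k) y‖ ≤ 1 := by
        have := (mFourier (-k)).norm_coe_le_norm y
        rwa [mFourier_norm] at this
      calc _ ≤ 1 * ‖G'‖ := by
            gcongr
            exact G'.norm_coe_le_norm _
        _ = _ := one_mul _
    · exact integrable_const _
    · exact Eventually.of_forall fun y s _ => by
        simpa only [smul_eq_mul] using (hder y s).const_mul (mFourier (-k) y)
  have h2 : HasDerivAt (fun s : ℝ => mFourierCoeff (fun y => G (y + torusProj η (s • v))) k)
      (2 * Real.pi * Complex.I * (⟪comb η k, v⟫_ℝ : ℝ) * mFourierCoeff G k) 0 := by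
    simp only [mFourierCoeff_translate, mFourier_torusProj]
    exact (hasDerivAt_wave_smul (comb η k) v).mul_const _
  have h3 := h1.unique h2
  rw [← h3, mFourierCoeff]
  congr 1
  ext y
  congr 2
  ext i
  simp [torusProj]

lemma laplacian_eq_sum_fderiv {F : Type*} [NormedAddCommGroup F] [NormedSpace ℝ F]
    {f : E n → F} (hf : ContDiff ℝ ∞ f) (u : E n) :
    Laplacian.laplacian f u = ∑ i : Fin n, fderiv ℝ
      (fun w => fderiv ℝ f w (EuclideanSpace.single i 1)) u (EuclideanSpace.single i 1) := by
  rw [InnerProductSpace.laplacian_eq_iteratedFDeriv_orthonormalBasis f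
    (EuclideanSpace.basisFun (Fin n) ℝ)]
  refine Finset.sum_congr rfl fun i _ => ?_
  have hd : DifferentiableAt ℝ (fderiv ℝ f) u :=
    ((hf.fderiv_right (m := 1) (by norm_cast)).differentiable (by norm_num)) u
  rw [iteratedFDeriv_two_apply, fderiv_clm_apply hd (differentiableAt_const _)]
  simp

lemma periodic_fderiv {F : Type*} [NormedAddCommGroup F] [NormedSpace ℝ F]
    {Λ : Submodule ℤ (E n)} {f : E n → F} (hp : Periodic Λ f) : Periodic Λ (fderiv ℝ f) := by
  intro l hl u
  have : (fun w => f (w + l)) = f := funext fun w => hp l hl w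
  rw [← fderiv_comp_add_right, this]

lemma norm_sq_comb_eq_sum (η : Fin n → E n) (k : Fin n → ℤ) :
    ‖comb η k‖ ^ 2 = ∑ i, ⟪comb η k, EuclideanSpace.single i (1 : ℝ)⟫_ℝ ^ 2 := by
  rw [EuclideanSpace.norm_sq_eq]
  refine Finset.sum_congr rfl fun i _ => ?_
  simp [EuclideanSpace.inner_single_right]

/-- The frequencies of an eigenfunction have the length prescribed by its eigenvalue. -/
lemma mFourierCoeff_eigen (hη : LinearIndependent ℝ η) {f : E n → ℂ} (hf : ContDiff ℝ ∞ f)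
    (hp : Periodic (torusLattice η) f) {κ : ℝ}
    (he : ∀ u, Laplacian.laplacian f u = -(κ : ℂ) * f u)
    {G : C(UnitAddTorus (Fin n), ℂ)} (hG : ∀ u, G (torusProj η u) = f u) (k : Fin n → ℤ) :
    ((4 * Real.pi ^ 2 * ‖comb η k‖ ^ 2 - κ : ℝ) : ℂ) * mFourierCoeff G k = 0 := by
  have hf1 : ContDiff ℝ ∞ (fderiv ℝ f) := hf.fderiv_right (by norm_cast)
  have hfi : ∀ v : E n, ContDiff ℝ ∞ (fun w => fderiv ℝ f w v) := fun v =>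
    hf1.clm_apply contDiff_const
  have hpi : ∀ v : E n, Periodic (torusLattice η) (fun w => fderiv ℝ f w v) := fun v l hl u =>
    by simp only [periodic_fderiv hp l hl u]
  have hfii : ∀ v : E n, ContDiff ℝ ∞ (fun w => fderiv ℝ (fun w => fderiv ℝ f w v) w v) := fun v =>
    ((hfi v).fderiv_right (by norm_cast)).clm_apply contDiff_const
  have hpii : ∀ v : E n, Periodic (torusLattice η)
      (fun w => fderiv ℝ (fun w => fderiv ℝ f w v) w v) := fun v l hl u => by
    simp only [periodic_fderiv (hpi v) l hl u]
  choose G1 hG1 using fun v : E n => exists_lift_torus hη (hfi v).continuous (hpi v)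
  choose G2 hG2 using fun v : E n => exists_lift_torus hη (hfii v).continuous (hpii v)
  have h1 : ∀ v, mFourierCoeff (G2 v) k = (2 * Real.pi * Complex.I * (⟪comb η k, v⟫_ℝ : ℝ)) *
      (2 * Real.pi * Complex.I * (⟪comb η k, v⟫_ℝ : ℝ) * mFourierCoeff G k) := by
    intro v
    rw [mFourierCoeff_fderiv hη ((hfi v).differentiable (by simp)) v (hG1 v) (hG2 v) k,
      mFourierCoeff_fderiv hη (hf.differentiable (by simp)) v hG (hG1 v) k]
  have h2 : ∀ y, ∑ i : Fin n, G2 (EuclideanSpace.single i 1) y = -(κ : ℂ) * G y := by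
    intro y
    obtain ⟨u, rfl⟩ := (isOpenQuotientMap_torusProj hη).surjective y
    rw [hG, ← he, laplacian_eq_sum_fderiv hf]
    exact Finset.sum_congr rfl fun i _ => hG2 _ u
  have h3 : ∑ i : Fin n, mFourierCoeff (G2 (EuclideanSpace.single i 1)) k
      = -(κ : ℂ) * mFourierCoeff G k := by
    simp only [mFourierCoeff]
    rw [← integral_finsetSum, ← integral_const_mul]
    · congr 1
      ext y
      rw [← Finset.smul_sum, h2]
      simp only [smul_eq_mul]
      ring
    · intro i _
      exact (((mFourier (-k)).continuous).smul
        (G2 _).continuous).integrable_of_hasCompactSupport (HasCompactSupport.of_compactSpace _)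
  simp only [h1] at h3
  have h4 : ((‖comb η k‖ ^ 2 : ℝ) : ℂ)
      = ∑ i, ((⟪comb η k, EuclideanSpace.single i (1 : ℝ)⟫_ℝ : ℝ) : ℂ) ^ 2 := by
    rw [norm_sq_comb_eq_sum]
    push_cast
    rfl
  have h5 : ∑ i : Fin n, (2 * Real.pi * Complex.I *
        (⟪comb η k, EuclideanSpace.single i (1 : ℝ)⟫_ℝ : ℝ)) *
      (2 * Real.pi * Complex.I * (⟪comb η k, EuclideanSpace.single i (1 : ℝ)⟫_ℝ : ℝ) *
        mFourierCoeff G k)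
      = -(4 * Real.pi ^ 2) * mFourierCoeff G k * ((‖comb η k‖ ^ 2 : ℝ) : ℂ) := by
    rw [h4, Finset.mul_sum]
    refine Finset.sum_congr rfl fun i _ => ?_
    linear_combination (4 * Real.pi ^ 2 *
      ((⟪comb η k, EuclideanSpace.single i (1 : ℝ)⟫_ℝ : ℝ) : ℂ) ^ 2 * mFourierCoeff G k)
        * Complex.I_sq
  rw [h5] at h3
  push_cast at h3 ⊢
  linear_combination -h3

lemma finite_setOf_norm_comb_le (hη : LinearIndependent ℝ η) (r : ℝ) :
    {k : Fin n → ℤ | ‖comb η k‖ ≤ r}.Finite := by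
  have h1 := ZSpan.setFinite_inter (basisOf hη)
    (Metric.isBounded_closedBall (x := (0 : E n)) (r := r))
  rw [coe_basisOf] at h1
  refine (h1.preimage (f := comb η) ((comb_injective η hη).injOn)).subset ?_
  intro k hk
  exact ⟨by simpa using hk, comb_mem_span η k⟩

/-- An eigenfunction is a trigonometric polynomial. -/
theorem exists_fourier_expansion (hη : LinearIndependent ℝ η) {f : E n → ℝ} (hf : ContDiff ℝ ∞ f)
    (hp : Periodic (torusLattice η) f) {κ : ℝ}
    (he : ∀ u, Laplacian.laplacian f u = -κ * f u) :
    ∃ c : (Fin n → ℤ) → ℂ, (∀ k, c (-k) = starRingEnd ℂ (c k)) ∧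
      (∀ k, c k ≠ 0 → 4 * Real.pi ^ 2 * ‖comb η k‖ ^ 2 = κ) ∧
      ∀ T : Finset (Fin n → ℤ), (∀ k, 4 * Real.pi ^ 2 * ‖comb η k‖ ^ 2 = κ → k ∈ T) →
        ∀ u, (f u : ℂ) = ∑ k ∈ T, c k * wave (comb η k) u := by
  have hfC : ContDiff ℝ ∞ (fun u => (f u : ℂ)) := Complex.ofRealCLM.contDiff.comp hf
  have hpC : Periodic (torusLattice η) (fun u => (f u : ℂ)) := fun l hl u => by
    simp only [hp l hl u]
  have heC : ∀ u, Laplacian.laplacian (fun u => (f u : ℂ)) u = -(κ : ℂ) * f u := by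
    intro u
    have h := (hf.contDiffAt (x := u)).of_le (m := 2) (by norm_cast)
    have h2 := h.laplacian_CLM_comp_left (l := Complex.ofRealCLM)
    simp only [Function.comp_def, Complex.ofRealCLM_apply] at h2
    rw [h2, he]
    push_cast
    rfl
  obtain ⟨G, hG⟩ := exists_lift_torus hη hfC.continuous hpC
  have hc := mFourierCoeff_eigen hη hfC hpC heC hG
  have hc' : ∀ k, mFourierCoeff G k ≠ 0 → 4 * Real.pi ^ 2 * ‖comb η k‖ ^ 2 = κ := by
    intro k hk
    have := (mul_eq_zero.1 (hc k)).resolve_right hk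
    exact sub_eq_zero.1 (by exact_mod_cast this)
  -- The set `T` is left free because it is used twice: `T = ∅` excludes eigenvalues that no
  -- frequency realises, and the set of unit vectors gives the expansion of a `λ₁`-eigenfunction.
  -- The coefficients vanish off `T`, so the series is a finite sum.
  refine ⟨mFourierCoeff G, fun k => ?_, hc', fun T hT u => ?_⟩
  · have hreal : ∀ y, starRingEnd ℂ (G y) = G y := by
      intro y
      obtain ⟨u, rfl⟩ := (isOpenQuotientMap_torusProj hη).surjective y
      rw [hG, Complex.conj_ofReal]
    rw [mFourierCoeff, mFourierCoeff, ← integral_conj]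
    congr 1
    ext y
    rw [smul_eq_mul, smul_eq_mul, map_mul, hreal, mFourier_neg]
  · have hz : ∀ k ∉ T, mFourierCoeff G k = 0 := fun k hk => by
      by_contra h
      exact hk (hT k (hc' k h))
    have hs : Summable (mFourierCoeff G) := summable_of_ne_finset_zero hz
    have h1 := hasSum_mFourier_series_apply_of_summable hs (torusProj η u)
    have h2 : HasSum (fun k => mFourierCoeff G k • mFourier k (torusProj η u))
        (∑ k ∈ T, mFourierCoeff G k • mFourier k (torusProj η u)) :=
      hasSum_sum_of_ne_finset_zero fun k hk => by rw [hz k hk, zero_smul]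
    have h3 := h1.unique h2
    rw [hG] at h3
    rw [h3]
    refine Finset.sum_congr rfl fun k _ => ?_
    rw [mFourier_torusProj, smul_eq_mul]

end Fourier

end FlatTori

/-! ### Derivatives and linear independence of waves. -/

namespace FlatTori

section Waves

variable {n : ℕ}

lemma wave_add (ξ u v : E n) : wave ξ (u + v) = wave ξ u * wave ξ v := by
  rw [wave, wave, wave, ← Complex.exp_add, inner_add_right]
  congr 1
  push_cast
  ring

lemma wave_add_left (ξ ζ u : E n) : wave (ξ + ζ) u = wave ξ u * wave ζ u := by
  rw [wave, wave, wave, ← Complex.exp_add, inner_add_left]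
  congr 1
  push_cast
  ring

@[simp] lemma wave_zero_right (ξ : E n) : wave ξ 0 = 1 := by simp [wave]

@[simp] lemma wave_zero_left (u : E n) : wave 0 u = 1 := by simp [wave]

lemma wave_neg_left (ξ u : E n) : wave (-ξ) u = starRingEnd ℂ (wave ξ u) := by
  rw [wave, wave, ← Complex.exp_conj]
  congr 1
  simp only [inner_neg_left, map_mul, Complex.conj_ofReal, Complex.conj_I, map_ofNat]
  push_cast
  ring

lemma wave_neg_right (ξ u : E n) : wave ξ (-u) = starRingEnd ℂ (wave ξ u) := by
  rw [← wave_neg_left, wave, wave, inner_neg_left, inner_neg_right]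

lemma wave_conj_mul_self (ξ u : E n) : starRingEnd ℂ (wave ξ u) * wave ξ u = 1 := by
  rw [← wave_neg_left, ← wave_add_left, neg_add_cancel, wave_zero_left]

lemma re_wave (ξ u : E n) : (wave ξ u).re = Real.cos (2 * Real.pi * ⟪ξ, u⟫_ℝ) := by
  have : (2 * Real.pi * Complex.I * (⟪ξ, u⟫_ℝ : ℝ) : ℂ)
      = ((2 * Real.pi * ⟪ξ, u⟫_ℝ : ℝ) : ℂ) * Complex.I := by
    push_cast; ring
  rw [wave, this, Complex.exp_ofReal_mul_I_re]

lemma wave_eq_one_of_int {ξ u : E n} (h : ∃ m : ℤ, (m : ℝ) = ⟪ξ, u⟫_ℝ) : wave ξ u = 1 := by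
  obtain ⟨m, hm⟩ := h
  rw [wave, ← hm, Complex.exp_eq_one_iff]
  exact ⟨m, by push_cast; ring⟩

/-- The differential of a multiple of a wave. -/
lemma hasFDerivAt_mul_wave (z : ℂ) (ξ u : E n) :
    HasFDerivAt (fun u => z * wave ξ u)
      (((2 * Real.pi * Complex.I) * (z * wave ξ u)) •
        (Complex.ofRealCLM.comp (innerSL ℝ ξ) : E n →L[ℝ] ℂ)) u := by
  have h1 : HasFDerivAt (fun u : E n => ((⟪ξ, u⟫_ℝ : ℝ) : ℂ))
      (Complex.ofRealCLM.comp (innerSL ℝ ξ) : E n →L[ℝ] ℂ) u :=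
    (Complex.ofRealCLM.comp (innerSL ℝ ξ) : E n →L[ℝ] ℂ).hasFDerivAt
  have h2 := ((h1.const_mul (2 * Real.pi * Complex.I)).cexp).const_mul z
  refine h2.congr_fderiv ?_
  ext v
  simp [wave]
  ring

lemma fderiv_mul_wave (z : ℂ) (ξ u v : E n) :
    fderiv ℝ (fun u => z * wave ξ u) u v
      = (2 * Real.pi * Complex.I * (⟪ξ, v⟫_ℝ : ℝ) * z) * wave ξ u := by
  rw [(hasFDerivAt_mul_wave z ξ u).fderiv]
  simp
  ring

lemma contDiff_wave (ξ : E n) : ContDiff ℝ ∞ (wave ξ) := by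
  have h1 : ContDiff ℝ ∞ fun u : E n => ((⟪ξ, u⟫_ℝ : ℝ) : ℂ) :=
    (Complex.ofRealCLM.comp (innerSL ℝ ξ) : E n →L[ℝ] ℂ).contDiff
  exact (contDiff_const.mul h1).cexp

lemma sum_inner_single_sq (ξ : E n) :
    ∑ i, ⟪ξ, EuclideanSpace.single i (1 : ℝ)⟫_ℝ ^ 2 = ‖ξ‖ ^ 2 := by
  rw [EuclideanSpace.norm_sq_eq]
  refine Finset.sum_congr rfl fun i _ => ?_
  simp [EuclideanSpace.inner_single_right]

lemma laplacian_mul_wave (z : ℂ) (ξ u : E n) :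
    Laplacian.laplacian (fun u => z * wave ξ u) u
      = ((-(4 * Real.pi ^ 2 * ‖ξ‖ ^ 2) : ℝ) : ℂ) * (z * wave ξ u) := by
  rw [laplacian_eq_sum_fderiv (contDiff_const.mul (contDiff_wave ξ))]
  simp only [fderiv_mul_wave]
  rw [← sum_inner_single_sq]
  push_cast
  rw [Finset.mul_sum, ← Finset.sum_neg_distrib, Finset.sum_mul]
  refine Finset.sum_congr rfl fun i _ => ?_
  linear_combination (4 * Real.pi ^ 2 *
      ((⟪ξ, EuclideanSpace.single i (1 : ℝ)⟫_ℝ : ℝ) : ℂ) ^ 2 * z * wave ξ u) * Complex.I_sq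

lemma contDiff_re_mul_wave (z : ℂ) (ξ : E n) : ContDiff ℝ ∞ fun u => (z * wave ξ u).re :=
  Complex.reCLM.contDiff.comp (contDiff_const.mul (contDiff_wave ξ))

lemma laplacian_re_mul_wave (z : ℂ) (ξ u : E n) :
    Laplacian.laplacian (fun u => (z * wave ξ u).re) u
      = -(4 * Real.pi ^ 2 * ‖ξ‖ ^ 2) * (z * wave ξ u).re := by
  have h := (((contDiff_const (c := z)).mul (contDiff_wave ξ)).contDiffAt (x := u)).of_le
    (m := 2) (by norm_cast)
  have h2 := h.laplacian_CLM_comp_left (l := Complex.reCLM)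
  simp only [Function.comp_def, Complex.reCLM_apply] at h2
  rw [h2, laplacian_mul_wave, Complex.re_ofReal_mul]

lemma periodic_wave {η : Fin n → E n} {ξ : E n} (hξ : ξ ∈ Submodule.span ℤ (Set.range η)) :
    Periodic (torusLattice η) (wave ξ) := by
  intro l hl u
  obtain ⟨k, rfl⟩ := (mem_span_iff_exists_comb η).1 hξ
  rw [wave_add, wave_eq_one_of_int (inner_comb_mem_torusLattice hl k), mul_one]

/-- Distinct integral frequencies give linearly independent waves. -/
lemma coeff_eq_zero_of_sum_wave_eq_const {η : Fin n → E n} (hη : LinearIndependent ℝ η)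
    (T : Finset (Fin n → ℤ)) (a : (Fin n → ℤ) → ℂ) (C : ℂ)
    (h : ∀ u, ∑ k ∈ T, a k * wave (comb η k) u = C) :
    ∀ k ∈ T, k ≠ 0 → a k = 0 := by
  -- Waves are characters of the additive group of `E n`, so their independence is Dedekind's
  -- theorem once distinct integer vectors are known to give distinct characters.
  let χ : (Fin n → ℤ) → (Multiplicative (E n) →* ℂ) := fun k =>
    { toFun := fun u => wave (comb η k) u.toAdd
      map_one' := by simp
      map_mul' := fun u v => by rw [toAdd_mul, wave_add] }
  have hχ : Function.Injective χ := by
    intro k l hkl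
    obtain ⟨β, hβ⟩ := exists_dual_basis hη
    have h1 : ∀ i (t : ℝ), wave (comb η k) (t • β i) = wave (comb η l) (t • β i) := fun i t =>
      DFunLike.congr_fun hkl (Multiplicative.ofAdd (t • β i))
    have h2 : ∀ (m : Fin n → ℤ) i (t : ℝ), ⟪comb η m, t • β i⟫_ℝ = t * m i := by
      intro m i t
      rw [inner_smul_right, inner_comb_left]
      simp [hβ]
    ext i
    -- The derivative at `0` along the dual basis vector `β i` reads off the coordinate `k i`.
    have h3 : HasDerivAt (fun t : ℝ => wave (comb η k) (t • β i))
        (2 * Real.pi * Complex.I * (⟪comb η k, β i⟫_ℝ : ℝ)) 0 := hasDerivAt_wave_smul _ _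
    simp only [h1] at h3
    have h4 := h3.unique (hasDerivAt_wave_smul (comb η l) (β i))
    have h5 : (2 * Real.pi * Complex.I : ℂ) ≠ 0 := Complex.two_pi_I_ne_zero
    have h6 : ⟪comb η k, β i⟫_ℝ = ⟪comb η l, β i⟫_ℝ := by
      exact_mod_cast mul_left_cancel₀ h5 h4
    have h7 := h2 k i 1
    have h8 := h2 l i 1
    rw [one_smul, one_mul] at h7 h8
    exact_mod_cast (h7.symm.trans (h6.trans h8))
  have hli := (linearIndependent_monoidHom (Multiplicative (E n)) ℂ).comp χ hχ
  classical
  -- The constant `C` is a multiple of the wave of frequency `0`, which need not belong to `T`.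
  have key : ∑ k ∈ insert 0 T, ((if k ∈ T then a k else 0) - if k = 0 then C else 0) •
      ((fun f => ⇑f : (Multiplicative (E n) →* ℂ) → Multiplicative (E n) → ℂ) ∘ χ) k = 0 := by
    ext u
    have e1 : ∑ k ∈ insert 0 T, (if k ∈ T then a k else 0) * wave (comb η k) u.toAdd = C := by
      rw [← h u.toAdd, ← Finset.sum_subset (Finset.subset_insert 0 T)]
      · exact Finset.sum_congr rfl fun k hk => by rw [if_pos hk]
      · intro k _ hk
        rw [if_neg hk, zero_mul]
    have e2 : ∑ k ∈ insert 0 T, (if k = 0 then C else 0) * wave (comb η k) u.toAdd = C := by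
      rw [Finset.sum_eq_single 0]
      · simp [comb_zero]
      · intro k _ hk
        rw [if_neg hk, zero_mul]
      · intro h0
        exact absurd (Finset.mem_insert_self 0 T) h0
    simp only [Finset.sum_apply, Pi.smul_apply, smul_eq_mul, sub_mul, Finset.sum_sub_distrib,
      Function.comp_apply, Pi.zero_apply]
    exact sub_eq_zero.2 (e1.trans e2.symm)
  intro k hk hk0
  have := linearIndependent_iff'.1 hli _ _ key k (Finset.mem_insert_of_mem hk)
  simpa [hk, hk0] using this

end Waves

/-! ### The first eigenvalue of a flat torus. -/

section Spectrum

variable {n : ℕ} {η : Fin n → E n}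

lemma laplacian_of_satisfiesEigen {Λ : Submodule ℤ (E n)} {c μ : ℝ} (hc : 0 < c) {f : E n → ℝ}
    (hf : SatisfiesEigen Λ c μ f) (u : E n) : Laplacian.laplacian f u = -(c * μ) * f u := by
  have := hf.2.2 u
  field_simp at this
  linarith

/-- A frequency of an eigenfunction for `ν` has squared length `cν / 4π²`. For `0 < ν < 4π²/c` this
lies strictly between `0` and `1`, where the lattice has no vector, so the expansion is empty and
the function vanishes. -/
theorem isFirstEigenvalue_of_min (hη : LinearIndependent ℝ η)
    (hmin : ∀ k : Fin n → ℤ, k ≠ 0 → 1 ≤ ‖comb η k‖) {k₀ : Fin n → ℤ} (hk₀ : ‖comb η k₀‖ = 1)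
    {c : ℝ} (hc : 0 < c) : IsFirstEigenvalue (torusLattice η) c (4 * Real.pi ^ 2 / c) := by
  have hpi := Real.pi_pos
  refine ⟨⟨by positivity, ?_⟩, ?_⟩
  · refine ⟨fun u => (1 * wave (comb η k₀) u).re, ?_, contDiff_re_mul_wave _ _, ?_, ?_⟩
    · intro h
      have := congrFun h 0
      simp at this
    · intro l hl u
      simp only [periodic_wave (comb_mem_span η k₀) l hl u]
    · intro u
      rw [laplacian_re_mul_wave, hk₀]
      field_simp
  · rintro ν ⟨hν, f, hf0, hf⟩
    obtain ⟨a, -, ha, hexp⟩ := exists_fourier_expansion hη hf.1 hf.2.1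
      (laplacian_of_satisfiesEigen hc hf)
    by_contra hlt
    apply hf0
    have hcν : c * ν < 4 * Real.pi ^ 2 := by
      rw [not_le, lt_div_iff₀ hc] at hlt
      linarith
    have hno : ∀ k, 4 * Real.pi ^ 2 * ‖comb η k‖ ^ 2 ≠ c * ν := by
      intro k hk
      by_cases hk0 : k = 0
      · have : 0 < c * ν := by positivity
        simp [hk0, comb_zero] at hk
        rcases hk with h | h <;> linarith
      · have h1 := hmin k hk0
        nlinarith [sq_nonneg Real.pi, one_le_pow₀ (n := 2) h1]
    ext u
    have := hexp ∅ (fun k hk => absurd hk (hno k)) u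
    simpa using this

end Spectrum

/-! ### Minimality of eigenmaps. -/

section Minimal

variable {n : ℕ} {V : Type*} [NormedAddCommGroup V] [InnerProductSpace ℝ V]
  [FiniteDimensional ℝ V]

omit [FiniteDimensional ℝ V] in
lemma laplacian_vector_of_coordinates {x : E n → V} (hx : ContDiff ℝ ∞ x) {κ : ℝ}
    (h : ∀ (a : V) (u : E n), Laplacian.laplacian (fun u => ⟪a, x u⟫_ℝ) u = κ * ⟪a, x u⟫_ℝ)
    (u : E n) : Laplacian.laplacian x u = κ • x u := by
  refine ext_inner_left ℝ fun a => ?_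
  have h1 := (hx.contDiffAt (x := u)).of_le (m := 2) (by norm_cast)
  have h2 := h1.laplacian_CLM_comp_left (l := innerSL ℝ a)
  simp only [Function.comp_def, innerSL_apply_apply] at h2
  rw [← h2, h, inner_smul_right]

/-- The mean curvature vanishes where the Laplacian is radial. -/
lemma meanCurvature_eq_zero {x : E n → V} (hx : ContDiff ℝ ∞ x) {κ : ℝ} {u : E n}
    (h : Laplacian.laplacian x u = κ • x u) (c : ℝ) : meanCurvature c x u = 0 := by
  have hd : DifferentiableAt ℝ (fderiv ℝ x) u :=
    ((hx.fderiv_right (m := 1) (by norm_cast)).differentiable (by norm_num)) u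
  have h1 : Laplacian.laplacian x u = ∑ i : Fin n, fderiv ℝ (fderiv ℝ x) u
      (EuclideanSpace.single i 1) (EuclideanSpace.single i 1) := by
    rw [laplacian_eq_sum_fderiv hx]
    refine Finset.sum_congr rfl fun i _ => ?_
    rw [fderiv_clm_apply hd (differentiableAt_const _)]
    simp
  rw [meanCurvature]
  simp only [secondFundamentalForm]
  rw [← map_sum, ← h1, h, map_smul]
  -- The mean curvature is now a multiple of the normal part of `x u`, and the normal space is by
  -- definition orthogonal to `x u`.
  have h2 : (normalSpace x u).starProjection (x u) = 0 := by
    rw [Submodule.starProjection_apply_eq_zero_iff, normalSpace]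
    exact Submodule.le_orthogonal_orthogonal _
      (Submodule.mem_sup_left (Submodule.mem_span_singleton_self _))
  rw [h2, smul_zero, smul_zero]

/-- One direction of Takahashi's theorem: when the coordinates are eigenfunctions for one eigenvalue
the Laplacian is radial, so minimality comes for free. -/
theorem isLambdaOneMinimal_of_eigenmap {Λ : Submodule ℤ (E n)} {x : E n → V}
    (hx : ContDiff ℝ ∞ x) (hp : Periodic Λ x) (h1 : ∀ u, ‖x u‖ = 1) {c : ℝ} (hc : 0 < c)
    (hiso : ∀ u v w, ⟪fderiv ℝ x u v, fderiv ℝ x u w⟫_ℝ = c * ⟪v, w⟫_ℝ) {μ : ℝ}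
    (hμ : IsFirstEigenvalue Λ c μ)
    (hlap : ∀ (a : V) (u : E n),
      Laplacian.laplacian (fun u => ⟪a, x u⟫_ℝ) u = -(c * μ) * ⟪a, x u⟫_ℝ) :
    IsLambdaOneMinimal Λ x := by
  refine ⟨hx, hp, h1, c, hc, hiso, fun u =>
    meanCurvature_eq_zero hx (laplacian_vector_of_coordinates hx hlap u) c, μ, hμ, fun a => ?_⟩
  refine ⟨contDiff_const.inner ℝ hx, fun l hl u => by simp only [hp l hl u], fun u => ?_⟩
  rw [hlap]
  field_simp

theorem IsLambdaOneMinimal.comp_isometry {W : Type*} [NormedAddCommGroup W]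
    [InnerProductSpace ℝ W] [FiniteDimensional ℝ W] {Λ : Submodule ℤ (E n)} {x : E n → V}
    (hx : IsLambdaOneMinimal Λ x) (T : V ≃ₗᵢ[ℝ] W) :
    IsLambdaOneMinimal Λ (fun u => T (x u)) := by
  obtain ⟨hx, hp, h1, c, hc, hiso, -, μ, hμ, heig⟩ := hx
  have hT : ∀ u, fderiv ℝ (fun u => T (x u)) u
      = (T.toContinuousLinearEquiv : V →L[ℝ] W).comp (fderiv ℝ x u) := fun u =>
    ((T.toContinuousLinearEquiv : V →L[ℝ] W).hasFDerivAt.comp u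
      ((hx.differentiable (by simp)) u).hasFDerivAt).fderiv
  refine isLambdaOneMinimal_of_eigenmap
    ((T.toContinuousLinearEquiv : V →L[ℝ] W).contDiff.comp hx)
    (fun l hl u => by simp only [hp l hl u]) (fun u => by rw [T.norm_map, h1]) hc
    (fun u v w => ?_) hμ fun a u => ?_
  · rw [hT]
    simpa using hiso u v w
  · have h2 : ∀ u, ⟪a, T (x u)⟫_ℝ = ⟪T.symm a, x u⟫_ℝ := fun u => by
      rw [← T.inner_map_map (T.symm a), T.apply_symm_apply]
    simp only [h2]
    exact laplacian_of_satisfiesEigen hc (heig _) u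

end Minimal

end FlatTori

/-! ### Maps whose components are weighted waves. -/

namespace FlatTori

section WaveMap

variable {n N : ℕ}

/-- The map with components `√wⱼ exp (2πi ⟨ξⱼ, u⟩)`. -/
noncomputable def waveMap (w : Fin N → ℝ) (ξ : Fin N → E n) (u : E n) :
    EuclideanSpace ℂ (Fin N) :=
  WithLp.toLp 2 fun j => (Real.sqrt (w j) : ℂ) * wave (ξ j) u

lemma dataMap_eq_waveMap (η : Fin n → E n) (Y : Matrix (Fin N) (Fin n) ℤ) (w : Fin N → ℝ) :
    dataMap η Y w = waveMap w fun j => comb η (Y j) := rfl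

lemma contDiff_waveMap (w : Fin N → ℝ) (ξ : Fin N → E n) : ContDiff ℝ ∞ (waveMap w ξ) := by
  rw [contDiff_piLp]
  exact fun j => contDiff_const.mul (contDiff_wave (ξ j))

/-- This kernel is the invariant by which congruence is tested. It depends only on `u - v`, and on
the frequencies only up to sign. -/
lemma inner_waveMap {w : Fin N → ℝ} (hw : ∀ j, 0 ≤ w j) (ξ : Fin N → E n) (u v : E n) :
    ⟪waveMap w ξ u, waveMap w ξ v⟫_ℝ = ∑ j, w j * (wave (ξ j) (u - v)).re := by
  rw [PiLp.inner_apply]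
  refine Finset.sum_congr rfl fun j => fun _ => ?_
  have h : ((Real.sqrt (w j) : ℝ) : ℂ) * (Real.sqrt (w j) : ℝ) = (w j : ℝ) := by
    rw [← Complex.ofReal_mul, Real.mul_self_sqrt (hw j)]
  have h2 : (starRingEnd ℂ) ((Real.sqrt (w j) : ℂ) * wave (ξ j) u) *
      ((Real.sqrt (w j) : ℂ) * wave (ξ j) v) = (w j : ℂ) * starRingEnd ℂ (wave (ξ j) (u - v)) := by
    rw [← h, sub_eq_add_neg, wave_add, wave_neg_right, map_mul, map_mul, Complex.conj_ofReal,
      Complex.conj_conj]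
    ring
  rw [Complex.inner, mul_comm]
  simp only [waveMap]
  rw [h2, Complex.re_ofReal_mul, Complex.conj_re]

lemma fderiv_waveMap_apply (w : Fin N → ℝ) (ξ : Fin N → E n) (u v : E n) (j : Fin N) :
    fderiv ℝ (waveMap w ξ) u v j
      = (2 * Real.pi * ⟪ξ j, v⟫_ℝ : ℝ) * Complex.I * waveMap w ξ u j := by
  have hd := (contDiff_waveMap w ξ).differentiable (by simp) u
  have h1 := ((PiLp.proj (𝕜 := ℝ) 2 (fun _ : Fin N => ℂ) j).hasFDerivAt.comp u
    hd.hasFDerivAt).fderiv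
  have h2 : fderiv ℝ (fun u => (Real.sqrt (w j) : ℂ) * wave (ξ j) u) u v
      = fderiv ℝ (waveMap w ξ) u v j := by
    change fderiv ℝ (⇑(PiLp.proj (𝕜 := ℝ) 2 (fun _ : Fin N => ℂ) j) ∘
      waveMap w ξ) u v = _
    rw [h1]
    rfl
  rw [← h2, fderiv_mul_wave]
  simp only [waveMap]
  push_cast
  ring

/-- The phases cancel, so the induced metric does not depend on `u`. -/
lemma inner_fderiv_waveMap {w : Fin N → ℝ} (hw : ∀ j, 0 ≤ w j) (ξ : Fin N → E n) (u v v' : E n) :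
    ⟪fderiv ℝ (waveMap w ξ) u v, fderiv ℝ (waveMap w ξ) u v'⟫_ℝ
      = 4 * Real.pi ^ 2 * ∑ j, w j * ⟪ξ j, v⟫_ℝ * ⟪ξ j, v'⟫_ℝ := by
  rw [PiLp.inner_apply, Finset.mul_sum]
  refine Finset.sum_congr rfl fun j _ => ?_
  rw [Complex.inner, mul_comm, fderiv_waveMap_apply, fderiv_waveMap_apply]
  have h : ((Real.sqrt (w j) : ℝ) : ℂ) * (Real.sqrt (w j) : ℝ) = (w j : ℝ) := by
    rw [← Complex.ofReal_mul, Real.mul_self_sqrt (hw j)]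
  have h2 : (starRingEnd ℂ) (((2 * Real.pi * ⟪ξ j, v⟫_ℝ : ℝ) : ℂ) * Complex.I * waveMap w ξ u j) *
      (((2 * Real.pi * ⟪ξ j, v'⟫_ℝ : ℝ) : ℂ) * Complex.I * waveMap w ξ u j)
      = ((4 * Real.pi ^ 2 * (w j * ⟪ξ j, v⟫_ℝ * ⟪ξ j, v'⟫_ℝ) : ℝ) : ℂ) := by
    simp only [waveMap, map_mul, Complex.conj_ofReal, Complex.conj_I]
    push_cast
    rw [← h]
    linear_combination (-(2 * Real.pi * (⟪ξ j, v⟫_ℝ : ℝ)) * (2 * Real.pi * (⟪ξ j, v'⟫_ℝ : ℝ)) *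
      Real.sqrt (w j) * Real.sqrt (w j) * (starRingEnd ℂ (wave (ξ j) u) * wave (ξ j) u) : ℂ)
      * Complex.I_sq + ((2 * Real.pi * (⟪ξ j, v⟫_ℝ : ℝ)) * (2 * Real.pi * (⟪ξ j, v'⟫_ℝ : ℝ)) *
      Real.sqrt (w j) * Real.sqrt (w j) : ℂ) * wave_conj_mul_self (ξ j) u
  rw [h2, Complex.ofReal_re]

/-- A weighted system of shortest dual vectors forming a tight frame gives a `λ₁`-minimal
immersion. -/
theorem isLambdaOneMinimal_waveMap (hn : 0 < n) {η : Fin n → E n} (hη : LinearIndependent ℝ η)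
    (hmin : ∀ k : Fin n → ℤ, k ≠ 0 → 1 ≤ ‖comb η k‖) {w : Fin N → ℝ} (hw : ∀ j, 0 ≤ w j)
    (hw1 : ∑ j, w j = 1) (Y : Fin N → Fin n → ℤ) (hY : ∀ j, ‖comb η (Y j)‖ = 1)
    (hframe : ∀ a b, ∑ j, w j * ⟪comb η (Y j), η a⟫_ℝ * ⟪comb η (Y j), η b⟫_ℝ
      = (n : ℝ)⁻¹ * ⟪η a, η b⟫_ℝ) :
    IsLambdaOneMinimal (torusLattice η) (waveMap w fun j => comb η (Y j)) := by
  have hn' : (0 : ℝ) < n := by exact_mod_cast hn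
  have hpi := Real.pi_pos
  have hN : 0 < N := by
    rcases Nat.eq_zero_or_pos N with rfl | h
    · simp at hw1
    · exact h
  have hframe' : ∀ v v', ∑ j, w j * ⟪comb η (Y j), v⟫_ℝ * ⟪comb η (Y j), v'⟫_ℝ
      = (n : ℝ)⁻¹ * ⟪v, v'⟫_ℝ := by
    let B1 : E n →ₗ[ℝ] E n →ₗ[ℝ] ℝ := ∑ j, w j •
      (LinearMap.mul ℝ ℝ).compl₁₂ (innerₗ (E n) (comb η (Y j))) (innerₗ (E n) (comb η (Y j)))
    let B2 : E n →ₗ[ℝ] E n →ₗ[ℝ] ℝ := (n : ℝ)⁻¹ • innerₗ (E n)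
    have : B1 = B2 := by
      refine (basisOf hη).ext fun a => (basisOf hη).ext fun b => ?_
      simpa [B1, B2, LinearMap.sum_apply, mul_assoc] using hframe a b
    intro v v'
    have h2 := LinearMap.congr_fun (LinearMap.congr_fun this v) v'
    simpa [B1, B2, LinearMap.sum_apply, mul_assoc] using h2
  -- The conformal factor is `4π²` times the frame constant `1/n`. The first eigenvalue `4π² / c` is
  -- then `n`, as it must be for an `n`-dimensional minimal submanifold of the unit sphere.
  have hc : 0 < 4 * Real.pi ^ 2 / n := by positivity
  refine isLambdaOneMinimal_of_eigenmap (contDiff_waveMap _ _) ?_ ?_ hc ?_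
    (isFirstEigenvalue_of_min hη hmin (hY ⟨0, hN⟩) hc) ?_
  · intro l hl u
    simp only [waveMap]
    congr 1
    ext j
    rw [periodic_wave (comb_mem_span η (Y j)) l hl u]
  · intro u
    have h := inner_waveMap hw (fun j => comb η (Y j)) u u
    rw [real_inner_self_eq_norm_sq] at h
    simp only [sub_self, wave_zero_right, Complex.one_re, mul_one, hw1] at h
    exact (pow_eq_one_iff_of_nonneg (norm_nonneg _) two_ne_zero).1 h
  · intro u v v'
    rw [inner_fderiv_waveMap hw, hframe']
    ring
  · intro a u
    have h1 : ∀ u, ⟪a, waveMap w (fun j => comb η (Y j)) u⟫_ℝ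
        = ∑ j, ((starRingEnd ℂ (a j) * Real.sqrt (w j)) * wave (comb η (Y j)) u).re := by
      intro u
      rw [PiLp.inner_apply]
      refine Finset.sum_congr rfl fun j _ => ?_
      rw [Complex.inner, mul_comm]
      simp only [waveMap, mul_assoc]
    simp only [h1]
    have h2 : Laplacian.laplacian (fun u => ∑ j, ((starRingEnd ℂ (a j) * Real.sqrt (w j)) *
          wave (comb η (Y j)) u).re) u
        = ∑ j, Laplacian.laplacian (fun u => ((starRingEnd ℂ (a j) * Real.sqrt (w j)) *
          wave (comb η (Y j)) u).re) u := by
      have hd : ∀ j, ContDiff ℝ ∞ (fun u => ((starRingEnd ℂ (a j) * Real.sqrt (w j)) *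
          wave (comb η (Y j)) u).re) := fun j => contDiff_re_mul_wave _ _
      rw [laplacian_eq_sum_fderiv (ContDiff.sum fun j _ => hd j)]
      simp only [fun j => laplacian_eq_sum_fderiv (hd j) u]
      rw [Finset.sum_comm]
      refine Finset.sum_congr rfl fun i _ => ?_
      have h3 : (fun u => fderiv ℝ (fun u => ∑ j, ((starRingEnd ℂ (a j) * Real.sqrt (w j)) *
          wave (comb η (Y j)) u).re) u (EuclideanSpace.single i 1))
          = fun u => ∑ j, fderiv ℝ (fun u => ((starRingEnd ℂ (a j) * Real.sqrt (w j)) *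
          wave (comb η (Y j)) u).re) u (EuclideanSpace.single i 1) := by
        ext u
        rw [fderiv_fun_sum fun j _ => (hd j).differentiable (by simp) u, sum_apply]
      rw [h3, fderiv_fun_sum, sum_apply]
      exact fun j _ => (((hd j).fderiv_right (m := ∞) (by norm_cast)).clm_apply
        contDiff_const).differentiable (by simp) u
    rw [h2, Finset.mul_sum]
    refine Finset.sum_congr rfl fun j _ => ?_
    rw [laplacian_re_mul_wave, hY]
    field_simp

end WaveMap

/-! ### Congruence of maps with the same Gram kernel. -/

section Congruence

variable {n : ℕ} {V W : Type*} [NormedAddCommGroup V] [InnerProductSpace ℝ V]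
  [FiniteDimensional ℝ V] [NormedAddCommGroup W] [InnerProductSpace ℝ W] [FiniteDimensional ℝ W]

/-- Two families with the same Gram kernel differ by an isometry of a common ambient space. -/
theorem exists_isometries_of_inner_eq {ι : Type*} {x : ι → V} {y : ι → W}
    (h : ∀ s t, ⟪x s, x t⟫_ℝ = ⟪y s, y t⟫_ℝ) :
    ∃ (k : ℕ) (i : V →ₗᵢ[ℝ] E k) (j : W →ₗᵢ[ℝ] E k), ∀ s, i (x s) = j (y s) := by
  let R := (stdOrthonormalBasis ℝ (WithLp 2 (V × W))).repr
  let iV : V →ₗᵢ[ℝ] WithLp 2 (V × W) :=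
    { toLinearMap := (WithLp.linearEquiv 2 ℝ (V × W)).symm.toLinearMap ∘ₗ LinearMap.inl ℝ V W
      norm_map' := fun v => by simp }
  let iW : W →ₗᵢ[ℝ] WithLp 2 (V × W) :=
    { toLinearMap := (WithLp.linearEquiv 2 ℝ (V × W)).symm.toLinearMap ∘ₗ LinearMap.inr ℝ V W
      norm_map' := fun v => by simp }
  let i₀ := R.toLinearIsometry.comp iV
  let j₀ := R.toLinearIsometry.comp iW
  let X := Finsupp.linearCombination ℝ fun s => i₀ (x s)
  let Z := Finsupp.linearCombination ℝ fun s => j₀ (y s)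
  -- Equality of the Gram kernels makes `X f ↦ Z f` well defined and isometric on the range of `X`.
  -- Both families live in one finite-dimensional space, so this isometry extends to the whole
  -- space.
  have hinner : ∀ f : ι →₀ ℝ, ‖X f‖ = ‖Z f‖ := by
    intro f
    rw [← sq_eq_sq₀ (norm_nonneg _) (norm_nonneg _), ← real_inner_self_eq_norm_sq,
      ← real_inner_self_eq_norm_sq]
    simp only [X, Z, Finsupp.linearCombination_apply, Finsupp.sum, sum_inner, inner_sum,
      inner_smul_left, inner_smul_right, LinearIsometry.inner_map_map, h]
  have hker : LinearMap.ker X ≤ LinearMap.ker Z := by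
    intro f hf
    rw [LinearMap.mem_ker] at hf ⊢
    rw [← norm_eq_zero, ← hinner, hf, norm_zero]
  let L₀ := (LinearMap.ker X).liftQ Z hker ∘ₗ X.quotKerEquivRange.symm.toLinearMap
  have hL₀ : ∀ f, L₀ ⟨X f, LinearMap.mem_range_self X f⟩ = Z f := by
    intro f
    have : X.quotKerEquivRange.symm ⟨X f, LinearMap.mem_range_self X f⟩
        = (LinearMap.ker X).mkQ f := X.quotKerEquivRange_symm_apply_image f _
    simp [L₀, this]
  let L : LinearMap.range X →ₗᵢ[ℝ] _ :=
    { toLinearMap := L₀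
      norm_map' := by
        rintro ⟨_, f, rfl⟩
        rw [hL₀, ← hinner]
        rfl }
  refine ⟨_, L.extend.comp i₀, j₀, fun s => ?_⟩
  have hX : X (Finsupp.single s 1) = i₀ (x s) := by simp [X]
  have hZ : Z (Finsupp.single s 1) = j₀ (y s) := by simp [Z]
  have h1 := L.extend_apply ⟨X (Finsupp.single s 1), LinearMap.mem_range_self X _⟩
  have h2 : L ⟨X (Finsupp.single s 1), LinearMap.mem_range_self X _⟩ = Z (Finsupp.single s 1) :=
    hL₀ _
  rw [h2, hZ] at h1
  change L.extend (i₀ (x s)) = _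
  rw [← h1, ← hX]

theorem congruent_of_inner_eq {Λ Λ' : Submodule ℤ (E n)} {x : E n → V} {y : E n → W}
    (g : E n ≃ₗᵢ[ℝ] E n) (hg : ∀ u, u ∈ Λ ↔ g u ∈ Λ')
    (h : ∀ u v, ⟪x u, x v⟫_ℝ = ⟪y (g u), y (g v)⟫_ℝ) : Congruent Λ Λ' x y := by
  obtain ⟨k, i, j, hij⟩ := exists_isometries_of_inner_eq (x := x) (y := fun u => y (g u)) h
  exact ⟨g, 0, hg, k, i, j, fun u => by rw [add_zero, hij]⟩

end Congruence

end FlatTori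

/-! ### Rigidity of `λ₁`-minimal immersions of tori with half-integral dual lattice. -/

namespace FlatTori

section Homogeneous

variable {n : ℕ} {η : Fin n → E n}

/-- In a lattice with half-integral inner products, the quadratic relations between the
coefficients of a `λ₁`-eigenmap force the coefficients of non-opposite frequencies to be
orthogonal. -/
lemma pair_coeff_eq_zero (hη : LinearIndependent ℝ η)
    (hhalf : ∀ k l : Fin n → ℤ, ∃ m : ℤ, (m : ℝ) = 2 * ⟪comb η k, comb η l⟫_ℝ)
    {S : Finset (Fin n → ℤ)} (hS : ∀ k ∈ S, ‖comb η k‖ = 1)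
    {b : (Fin n → ℤ) → (Fin n → ℤ) → ℂ} (hb : ∀ k l, b k l = b l k)
    {k₀ l₀ : Fin n → ℤ} (hk₀ : k₀ ∈ S) (hl₀ : l₀ ∈ S) (hne : k₀ + l₀ ≠ 0)
    (h0 : ∑ p ∈ (S ×ˢ S).filter (fun p => p.1 + p.2 = k₀ + l₀), b p.1 p.2 = 0)
    (h2 : ∀ v : E n, ∑ p ∈ (S ×ˢ S).filter (fun p => p.1 + p.2 = k₀ + l₀),
      b p.1 p.2 * ((⟪comb η p.1, v⟫_ℝ * ⟪comb η p.2, v⟫_ℝ : ℝ) : ℂ) = 0) :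
    b k₀ l₀ = 0 := by
  set s := ⟪comb η k₀, comb η l₀⟫_ℝ with hs
  obtain ⟨s2, hs2⟩ := hhalf k₀ l₀
  have hunit : ∀ k ∈ S, ⟪comb η k, comb η k⟫_ℝ = 1 := fun k hk => by
    rw [real_inner_self_eq_norm_sq, hS k hk, one_pow]
  have hle : ∀ k ∈ S, ∀ l ∈ S, ⟪comb η k, comb η l⟫_ℝ ≤ 1 := fun k hk l hl => by
    have := real_inner_le_norm (comb η k) (comb η l)
    rwa [hS k hk, hS l hl, one_mul] at this
  have heq : ∀ k ∈ S, ∀ l ∈ S, ⟪comb η k, comb η l⟫_ℝ = 1 → k = l := fun k hk l hl h =>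
    comb_injective η hη ((inner_eq_one_iff_of_norm_eq_one (hS k hk) (hS l hl)).1 h)
  have hs_ne : -1 < s := by
    have h1 : 0 < ‖comb η (k₀ + l₀)‖ ^ 2 := by
      have : comb η (k₀ + l₀) ≠ 0 := fun h => hne (comb_injective η hη (h.trans (comb_zero η).symm))
      positivity
    rw [comb_add, ← real_inner_self_eq_norm_sq, inner_add_add_self, hunit _ hk₀, hunit _ hl₀,
      real_inner_comm (comb η k₀)] at h1
    rw [hs]
    linarith
  have hs_le : s ≤ 1 := hle _ hk₀ _ hl₀
  -- the inner products of an arbitrary pair with the same sum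
  have hpair : ∀ p ∈ (S ×ˢ S).filter (fun p => p.1 + p.2 = k₀ + l₀),
      ⟪comb η p.1, comb η k₀⟫_ℝ + ⟪comb η p.1, comb η l₀⟫_ℝ = 1 + s ∧
      ⟪comb η p.2, comb η k₀ - comb η l₀⟫_ℝ = -⟪comb η p.1, comb η k₀ - comb η l₀⟫_ℝ := by
    intro p hp
    rw [Finset.mem_filter, Finset.mem_product] at hp
    obtain ⟨⟨hp1, hp2⟩, hsum⟩ := hp
    have hc : comb η p.1 + comb η p.2 = comb η k₀ + comb η l₀ := by
      rw [← comb_add, hsum, comb_add]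
    have hc2 : comb η p.2 = comb η k₀ + comb η l₀ - comb η p.1 := by rw [← hc]; abel
    have e1 := hunit _ hp1
    have e2 := hunit _ hp2
    have e3 := hunit _ hk₀
    have e4 := hunit _ hl₀
    rw [hc2] at e2
    simp only [inner_sub_left, inner_sub_right, inner_add_left, inner_add_right] at e2
    have c1 := real_inner_comm (comb η k₀) (comb η l₀)
    have c2 := real_inner_comm (comb η k₀) (comb η p.1)
    have c3 := real_inner_comm (comb η l₀) (comb η p.1)
    refine ⟨by linarith, ?_⟩
    rw [hc2]
    simp only [inner_sub_left, inner_sub_right, inner_add_left]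
    linarith
  by_cases hkl : k₀ = l₀
  · have hfil : (S ×ˢ S).filter (fun p => p.1 + p.2 = k₀ + l₀) = {(k₀, l₀)} := by
      ext p
      constructor
      · intro hp
        have h3 := (hpair p hp).1
        have hp' := hp
        rw [Finset.mem_filter, Finset.mem_product] at hp'
        have hs1 : s = 1 := by rw [hs, ← hkl]; exact hunit _ hk₀
        have h4 : p.1 = k₀ := by
          refine heq _ hp'.1.1 _ hk₀ ?_
          rw [← hkl] at h3
          linarith
        have h5 : p.2 = l₀ := by
          have := hp'.2
          rw [h4] at this
          exact add_left_cancel this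
        rw [Finset.mem_singleton]
        exact Prod.ext h4 h5
      · intro hp
        rw [Finset.mem_singleton] at hp
        rw [hp]
        simp [hk₀, hl₀]
    rw [hfil, Finset.sum_singleton] at h0
    exact h0
  · set v := comb η k₀ - comb η l₀ with hv
    -- Over the pairs with sum `k₀ + l₀`, the quantity `⟪comb η p.1, v⟫ ^ 2` equals `(1 - s) ^ 2` on
    -- `(k₀, l₀)` and its swap, and takes a single different value `κ` on all other pairs. This is
    -- what makes two relations sufficient.
    obtain ⟨κ, hκ0, hκ⟩ : ∃ κ : ℝ, (1 - s) ^ 2 ≠ κ ∧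
        ∀ p ∈ (S ×ˢ S).filter (fun p => p.1 + p.2 = k₀ + l₀), p ≠ (k₀, l₀) ∧ p ≠ (l₀, k₀) →
        ⟪comb η p.1, v⟫_ℝ ^ 2 = κ := by
      have hs_ne1 : s ≠ 1 := fun h => hkl (heq _ hk₀ _ hl₀ h)
      have hs2' : -2 < s2 ∧ s2 < 2 := by
        constructor
        · have : ((-2 : ℤ) : ℝ) < s2 := by push_cast; linarith
          exact_mod_cast this
        · have : (s2 : ℝ) < (2 : ℤ) := by
            push_cast
            have := lt_of_le_of_ne hs_le hs_ne1
            linarith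
          exact_mod_cast this
      refine ⟨if s2 = -1 then 1 / 4 else 0, ?_, ?_⟩
      · obtain ⟨h1, h2⟩ := hs2'
        have : s = s2 / 2 := by linarith
        rw [this]
        interval_cases s2 <;> norm_num
      · intro p hp hpne
        have h3 := (hpair p hp).1
        rw [Finset.mem_filter, Finset.mem_product] at hp
        obtain ⟨⟨hp1, hp2⟩, hsum⟩ := hp
        obtain ⟨T, hT⟩ := hhalf p.1 k₀
        obtain ⟨T', hT'⟩ := hhalf p.1 l₀
        have hT1 : T < 2 := by
          have : (T : ℝ) < (2 : ℤ) := by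
            push_cast
            have := lt_of_le_of_ne (hle _ hp1 _ hk₀) fun h => hpne.1 (by
              have h4 := heq _ hp1 _ hk₀ h
              refine Prod.ext h4 ?_
              rw [h4] at hsum
              exact add_left_cancel hsum)
            linarith
          exact_mod_cast this
        have hT1' : T' < 2 := by
          have : (T' : ℝ) < (2 : ℤ) := by
            push_cast
            have := lt_of_le_of_ne (hle _ hp1 _ hl₀) fun h => hpne.2 (by
              have h4 := heq _ hp1 _ hl₀ h
              refine Prod.ext h4 ?_
              rw [h4, add_comm] at hsum
              exact add_right_cancel hsum)
            linarith
          exact_mod_cast this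
        have hTT : T + T' = 2 + s2 := by
          have : ((T + T' : ℤ) : ℝ) = (2 + s2 : ℤ) := by push_cast; linarith
          exact_mod_cast this
        have hX : ⟪comb η p.1, v⟫_ℝ = (T - T') / 2 := by
          rw [hv, inner_sub_right]; linarith
        rw [hX]
        obtain ⟨h1, h2⟩ := hs2'
        -- `T` and `T'` are integers at most `1` with sum `2 + s2`. So `s2 = 1` allows no further
        -- pair, `s2 = 0` forces `T = T' = 1`, and `s2 = -1` forces `{T, T'} = {0, 1}`.
        have hcase : (s2 = -1 ∧ ((T = 0 ∧ T' = 1) ∨ (T = 1 ∧ T' = 0))) ∨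
            (s2 = 0 ∧ T = 1 ∧ T' = 1) := by omega
        rcases hcase with ⟨rfl, ⟨rfl, rfl⟩ | ⟨rfl, rfl⟩⟩ | ⟨rfl, rfl, rfl⟩ <;> norm_num
    -- `κ` times the first relation plus the second one, where `⟪comb η p.2, v⟫ = -⟪comb η p.1, v⟫`.
    -- Every term except those of `(k₀, l₀)` and `(l₀, k₀)` drops out.
    have hF : ∑ p ∈ (S ×ˢ S).filter (fun p => p.1 + p.2 = k₀ + l₀),
        b p.1 p.2 * ((κ - ⟪comb η p.1, v⟫_ℝ ^ 2 : ℝ) : ℂ) = 0 := by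
      have e : ∀ p ∈ (S ×ˢ S).filter (fun p => p.1 + p.2 = k₀ + l₀),
          b p.1 p.2 * ((κ - ⟪comb η p.1, v⟫_ℝ ^ 2 : ℝ) : ℂ)
          = b p.1 p.2 * κ +
            b p.1 p.2 * ((⟪comb η p.1, v⟫_ℝ * ⟪comb η p.2, v⟫_ℝ : ℝ) : ℂ) := by
        intro p hp
        rw [(hpair p hp).2]
        push_cast
        ring
      rw [Finset.sum_congr rfl e, Finset.sum_add_distrib, ← Finset.sum_mul, h0, h2, zero_mul,
        add_zero]
    rw [Finset.sum_eq_add_of_mem (k₀, l₀) (l₀, k₀) (by simp [hk₀, hl₀])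
      (by simp [hk₀, hl₀, add_comm]) (fun h => hkl (Prod.ext_iff.1 h).1)] at hF
    · have e1 : ⟪comb η k₀, v⟫_ℝ = 1 - s := by
        rw [hv, inner_sub_right, hunit _ hk₀]
      have e2 : ⟪comb η l₀, v⟫_ℝ = -(1 - s) := by
        rw [hv, inner_sub_right, hunit _ hl₀, real_inner_comm]; ring
      rw [e1, e2, hb l₀ k₀, neg_sq, ← add_mul, ← two_mul] at hF
      have h5 : ((κ - (1 - s) ^ 2 : ℝ) : ℂ) ≠ 0 := by
        rw [Complex.ofReal_ne_zero]
        exact sub_ne_zero.2 (Ne.symm hκ0)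
      have h6 := (mul_eq_zero.1 hF).resolve_right h5
      simpa using h6
    · intro p hp hpne
      rw [hκ p hp hpne]
      simp

/-- Grouping products of waves by their total frequency gives a trigonometric polynomial; if it is
constant, its nonconstant coefficients vanish. -/
lemma sum_fiber_eq_zero (hη : LinearIndependent ℝ η) {S : Finset (Fin n → ℤ)}
    {β : (Fin n → ℤ) × (Fin n → ℤ) → ℂ} {C : ℂ}
    (h : ∀ u, ∑ p ∈ S ×ˢ S, β p * (wave (comb η p.1) u * wave (comb η p.2) u) = C)
    {ζ : Fin n → ℤ} (hζ : ζ ≠ 0) :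
    ∑ p ∈ (S ×ˢ S).filter (fun p => p.1 + p.2 = ζ), β p = 0 := by
  classical
  by_cases hm : ζ ∈ (S ×ˢ S).image fun p => p.1 + p.2
  · refine coeff_eq_zero_of_sum_wave_eq_const hη ((S ×ˢ S).image fun p => p.1 + p.2)
      (fun ζ => ∑ p ∈ (S ×ˢ S).filter (fun p => p.1 + p.2 = ζ), β p) C (fun u => ?_) ζ hm hζ
    rw [← h u, ← Finset.sum_fiberwise_of_maps_to
      (g := fun p : (Fin n → ℤ) × (Fin n → ℤ) => p.1 + p.2) (fun p hp => Finset.mem_image_of_mem _ hp)]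
    refine Finset.sum_congr rfl fun ζ _ => ?_
    rw [Finset.sum_mul]
    refine Finset.sum_congr rfl fun p hp => ?_
    rw [← (Finset.mem_filter.1 hp).2, comb_add, wave_add_left]
  · rw [Finset.filter_eq_empty_iff.2, Finset.sum_empty]
    intro p hp h1
    exact hm (Finset.mem_image.2 ⟨p, hp, h1⟩)

/-- The Gram kernel of a `λ₁`-minimal immersion of a torus with half-integral dual lattice. -/
theorem exists_weights_of_isLambdaOneMinimal (hn : 0 < n) (hη : LinearIndependent ℝ η)
    (hmin : ∀ k : Fin n → ℤ, k ≠ 0 → 1 ≤ ‖comb η k‖) {k₀ : Fin n → ℤ} (hk₀ : ‖comb η k₀‖ = 1)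
    (hhalf : ∀ k l : Fin n → ℤ, ∃ m : ℤ, (m : ℝ) = 2 * ⟪comb η k, comb η l⟫_ℝ)
    {S : Finset (Fin n → ℤ)} (hS : ∀ k, k ∈ S ↔ ‖comb η k‖ = 1)
    {m : ℕ} {x : E n → E m} (hx : IsLambdaOneMinimal (torusLattice η) x) :
    ∃ W : (Fin n → ℤ) → ℝ, (∀ k, 0 ≤ W k) ∧ (∀ k, W (-k) = W k) ∧ ∑ k ∈ S, W k = 1 ∧
      (∀ v w, ∑ k ∈ S, W k * ⟪comb η k, v⟫_ℝ * ⟪comb η k, w⟫_ℝ = (n : ℝ)⁻¹ * ⟪v, w⟫_ℝ) ∧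
      ∀ u v, ⟪x u, x v⟫_ℝ = ∑ k ∈ S, W k * (wave (comb η k) (u - v)).re := by
  obtain ⟨hsm, hp, h1, c, hc, hiso, -, μ, hμ, heig⟩ := hx
  have hpi := Real.pi_pos
  have hμc : c * μ = 4 * Real.pi ^ 2 := by
    rw [hμ.unique (isFirstEigenvalue_of_min hη hmin hk₀ hc)]
    field_simp
  have hcoord : ∀ i (u : E n), ⟪EuclideanSpace.single i (1 : ℝ), x u⟫_ℝ = x u i := fun i u => by
    simp [EuclideanSpace.inner_single_left]
  have hexp : ∀ i, ∃ B : (Fin n → ℤ) → ℂ, (∀ k, B (-k) = starRingEnd ℂ (B k)) ∧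
      ∀ u, (x u i : ℂ) = ∑ k ∈ S, B k * wave (comb η k) u := by
    intro i
    have h2 := heig (EuclideanSpace.single i 1)
    obtain ⟨B, hB1, -, hB⟩ := exists_fourier_expansion hη h2.1 h2.2.1
      (laplacian_of_satisfiesEigen hc h2)
    refine ⟨B, hB1, fun u => ?_⟩
    rw [← hcoord]
    refine hB S (fun k hk => (hS k).2 ?_) u
    rw [hμc] at hk
    have h3 : ‖comb η k‖ ^ 2 = 1 := by
      have : 4 * Real.pi ^ 2 ≠ 0 := by positivity
      exact mul_left_cancel₀ this (by rw [hk, mul_one])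
    exact (pow_eq_one_iff_of_nonneg (norm_nonneg _) two_ne_zero).1 h3
  choose B hBconj hB using hexp
  have hdB : ∀ i u v, ((fderiv ℝ x u v) i : ℂ)
      = ∑ k ∈ S, (2 * Real.pi * Complex.I * (⟪comb η k, v⟫_ℝ : ℝ) * B i k) * wave (comb η k) u := by
    intro i u v
    have hd := (hsm.differentiable (by simp) u).hasFDerivAt
    have e1 := (((Complex.ofRealCLM.comp (PiLp.proj (𝕜 := ℝ) 2 (fun _ : Fin m => ℝ) i)).hasFDerivAt
      (x := x u)).comp u hd).fderiv
    have e2 : (⇑(Complex.ofRealCLM.comp (PiLp.proj (𝕜 := ℝ) 2 (fun _ : Fin m => ℝ) i)) ∘ x)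
        = fun u => ∑ k ∈ S, B i k * wave (comb η k) u := funext fun u => hB i u
    have e3 : fderiv ℝ (fun u => ∑ k ∈ S, B i k * wave (comb η k) u) u v
        = ((fderiv ℝ x u v) i : ℂ) := by
      rw [← e2, e1]
      rfl
    rw [← e3, fderiv_fun_sum, sum_apply]
    · exact Finset.sum_congr rfl fun k _ => fderiv_mul_wave _ _ _ _
    · exact fun k _ => (hasFDerivAt_mul_wave _ _ _).differentiableAt
  -- The pairing is bilinear, without conjugation. Since the coordinates are real, `B i (-k)` is the
  -- conjugate of `B i k`, and the entries `b k (-k)` that survive are sums of squared moduli.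
  let b : (Fin n → ℤ) → (Fin n → ℤ) → ℂ := fun k l => ∑ i, B i k * B i l
  have hb : ∀ k l, b k l = b l k := fun k l =>
    Finset.sum_congr rfl fun i _ => mul_comm _ _
  have hker : ∀ (α : Fin m → (Fin n → ℤ) → ℂ) (α' : Fin m → (Fin n → ℤ) → ℂ) (u v : E n),
      ∑ i, (∑ k ∈ S, α i k * wave (comb η k) u) * (∑ l ∈ S, α' i l * wave (comb η l) v)
      = ∑ p ∈ S ×ˢ S, (∑ i, α i p.1 * α' i p.2) *
        (wave (comb η p.1) u * wave (comb η p.2) v) := by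
    intro α α' u v
    simp only [Finset.sum_mul (s := Finset.univ)]
    rw [Finset.sum_comm]
    refine Finset.sum_congr rfl fun i _ => ?_
    rw [Finset.sum_mul_sum, Finset.sum_product]
    refine Finset.sum_congr rfl fun k _ => Finset.sum_congr rfl fun l _ => ?_
    ring
  have hK : ∀ u v, (⟪x u, x v⟫_ℝ : ℂ)
      = ∑ p ∈ S ×ˢ S, b p.1 p.2 * (wave (comb η p.1) u * wave (comb η p.2) v) := by
    intro u v
    rw [← hker B B, PiLp.inner_apply]
    push_cast
    refine Finset.sum_congr rfl fun i _ => ?_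
    rw [← hB, ← hB]
    simp [mul_comm]
  have hD : ∀ u v v', ∑ p ∈ S ×ˢ S,
      (b p.1 p.2 * ((⟪comb η p.1, v⟫_ℝ * ⟪comb η p.2, v'⟫_ℝ : ℝ) : ℂ)) *
        (wave (comb η p.1) u * wave (comb η p.2) u)
      = ((-(c * ⟪v, v'⟫_ℝ / (4 * Real.pi ^ 2)) : ℝ) : ℂ) := by
    intro u v v'
    have e1 : ((c * ⟪v, v'⟫_ℝ : ℝ) : ℂ) = ∑ p ∈ S ×ˢ S,
        (∑ i, (2 * Real.pi * Complex.I * (⟪comb η p.1, v⟫_ℝ : ℝ) * B i p.1) *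
          (2 * Real.pi * Complex.I * (⟪comb η p.2, v'⟫_ℝ : ℝ) * B i p.2)) *
        (wave (comb η p.1) u * wave (comb η p.2) u) := by
      rw [← hiso u, ← hker (fun i k => 2 * Real.pi * Complex.I * (⟪comb η k, v⟫_ℝ : ℝ) * B i k)
        fun i k => 2 * Real.pi * Complex.I * (⟪comb η k, v'⟫_ℝ : ℝ) * B i k, PiLp.inner_apply]
      push_cast
      refine Finset.sum_congr rfl fun i _ => ?_
      rw [← hdB, ← hdB]
      simp [mul_comm]
    have e2 : ((-(c * ⟪v, v'⟫_ℝ / (4 * Real.pi ^ 2)) : ℝ) : ℂ)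
        = -(4 * (Real.pi : ℂ) ^ 2)⁻¹ * ((c * ⟪v, v'⟫_ℝ : ℝ) : ℂ) := by
      push_cast
      ring
    rw [e2, e1, Finset.mul_sum]
    refine Finset.sum_congr rfl fun p _ => ?_
    have e3 : ∑ i, (2 * Real.pi * Complex.I * (⟪comb η p.1, v⟫_ℝ : ℝ) * B i p.1) *
          (2 * Real.pi * Complex.I * (⟪comb η p.2, v'⟫_ℝ : ℝ) * B i p.2)
        = -(4 * Real.pi ^ 2) * (b p.1 p.2 *
          ((⟪comb η p.1, v⟫_ℝ * ⟪comb η p.2, v'⟫_ℝ : ℝ) : ℂ)) := by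
      simp only [b]
      rw [Finset.sum_mul, Finset.mul_sum]
      refine Finset.sum_congr rfl fun i _ => ?_
      push_cast
      linear_combination (4 * Real.pi ^ 2 * (⟪comb η p.1, v⟫_ℝ : ℝ) * B i p.1 *
        (⟪comb η p.2, v'⟫_ℝ : ℝ) * B i p.2 : ℂ) * Complex.I_sq
    have hpiC : (Real.pi : ℂ) ≠ 0 := by exact_mod_cast hpi.ne'
    rw [e3]
    field_simp
  have hb0 : ∀ k ∈ S, ∀ l ∈ S, l ≠ -k → b k l = 0 := by
    intro k hk l hl hkl
    have hne : k + l ≠ 0 := fun h => hkl (neg_eq_of_add_eq_zero_right h).symm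
    -- The two relations express that `‖x u‖ ^ 2` and the squared norm of the derivative along `v`
    -- do not depend on `u`.
    refine pair_coeff_eq_zero hη hhalf (fun k hk => (hS k).1 hk) hb hk hl hne ?_ fun v => ?_
    · refine sum_fiber_eq_zero hη (β := fun p => b p.1 p.2) (C := 1) (fun u => ?_) hne
      rw [← hK, real_inner_self_eq_norm_sq, h1]
      simp
    · exact sum_fiber_eq_zero hη (hD · v v) hne
  have hSneg : ∀ k ∈ S, -k ∈ S := fun k hk => by
    rw [hS, comb_neg, norm_neg]
    exact (hS k).1 hk
  have hcollapse : ∀ F : (Fin n → ℤ) → (Fin n → ℤ) → ℂ,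
      ∑ p ∈ S ×ˢ S, b p.1 p.2 * F p.1 p.2 = ∑ k ∈ S, b k (-k) * F k (-k) := by
    intro F
    rw [Finset.sum_product]
    refine Finset.sum_congr rfl fun k hk => ?_
    refine Finset.sum_eq_single_of_mem (-k) (hSneg k hk) fun l hl hlk => ?_
    rw [hb0 k hk l hl hlk, zero_mul]
  let W : (Fin n → ℤ) → ℝ := fun k => ∑ i, ‖B i k‖ ^ 2
  have hW : ∀ k, b k (-k) = (W k : ℂ) := by
    intro k
    simp only [b, W]
    push_cast
    refine Finset.sum_congr rfl fun i _ => ?_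
    rw [hBconj, Complex.mul_conj, Complex.normSq_eq_norm_sq]
    push_cast
    rfl
  have hcov : ∀ v w, ∑ k ∈ S, W k * ⟪comb η k, v⟫_ℝ * ⟪comb η k, w⟫_ℝ
      = c * ⟪v, w⟫_ℝ / (4 * Real.pi ^ 2) := by
    intro v w
    have e := hD 0 v w
    simp only [wave_zero_right, mul_one] at e
    rw [hcollapse fun k l => ((⟪comb η k, v⟫_ℝ * ⟪comb η l, w⟫_ℝ : ℝ) : ℂ)] at e
    simp only [hW, comb_neg, inner_neg_left] at e
    rw [← neg_inj, ← Finset.sum_neg_distrib]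
    rw [← Complex.ofReal_inj, ← e]
    push_cast
    refine Finset.sum_congr rfl fun k _ => ?_
    ring
  have hsum : ∑ k ∈ S, W k = 1 := by
    have e := hK 0 0
    rw [real_inner_self_eq_norm_sq, h1] at e
    simp only [wave_zero_right, mul_one, one_pow] at e
    have e' := hcollapse fun _ _ => 1
    simp only [mul_one, hW] at e'
    rw [e'] at e
    exact_mod_cast e.symm
  -- The trace over the standard basis determines `c`, because the frequencies are unit vectors and
  -- the weights sum to `1`.
  have hcn : c / (4 * Real.pi ^ 2) = (n : ℝ)⁻¹ := by
    have e : ∑ i : Fin n, ∑ k ∈ S, W k * ⟪comb η k, EuclideanSpace.single i (1 : ℝ)⟫_ℝ *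
        ⟪comb η k, EuclideanSpace.single i (1 : ℝ)⟫_ℝ = 1 := by
      rw [Finset.sum_comm]
      refine Eq.trans (Finset.sum_congr rfl fun k hk => ?_) hsum
      simp only [mul_assoc, ← sq]
      rw [← Finset.mul_sum, sum_inner_single_sq, (hS k).1 hk]
      ring
    simp only [hcov] at e
    simp at e
    have : (n : ℝ) ≠ 0 := by positivity
    field_simp at e ⊢
    linarith
  refine ⟨W, fun k => Finset.sum_nonneg fun i _ => sq_nonneg _, fun k => ?_, hsum,
    fun v w => ?_, fun u v => ?_⟩
  · simp only [W, hBconj, RCLike.norm_conj]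
  · rw [hcov, ← hcn]
    ring
  · have e := hK u v
    rw [hcollapse fun k l => wave (comb η k) u * wave (comb η l) v] at e
    have e2 := congrArg Complex.re e
    rw [Complex.ofReal_re, Complex.re_sum] at e2
    rw [e2]
    refine Finset.sum_congr rfl fun k _ => ?_
    rw [hW, comb_neg, wave_neg_left, ← wave_neg_right, ← wave_add, ← sub_eq_add_neg,
      Complex.re_ofReal_mul]

end Homogeneous

end FlatTori

/-! ### Unit vectors in a lattice of minimum `1`. -/

namespace FlatTori

section ShortVectors

variable {V : Type*} [NormedAddCommGroup V] [InnerProductSpace ℝ V] {L : Submodule ℤ V}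

/-- By the parallelogram law `‖t + z‖² + ‖z‖² = 1`, so `t + z` and `z` cannot both be nonzero. -/
lemma eq_or_eq_neg_of_congr (hL : ∀ x ∈ L, x ≠ 0 → 1 ≤ ‖x‖) {s t z : V} (ht : t ∈ L)
    (hz : z ∈ L) (hs1 : ‖s‖ = 1) (ht1 : ‖t‖ = 1) (h : s = t + (2 : ℤ) • z) : s = t ∨ s = -t := by
  have h2 : s = t + z + z := by rw [h, two_smul, add_assoc]
  have hp := parallelogram_law_with_norm ℝ (t + z) z
  rw [← h2, add_sub_cancel_right, hs1, ht1] at hp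
  by_cases hz0 : z = 0
  · left; rw [h2, hz0]; simp
  by_cases hz1 : t + z = 0
  · right
    rw [h2, hz1, zero_add, eq_neg_iff_add_eq_zero, add_comm, hz1]
  have e1 := hL z hz hz0
  have e2 := hL (t + z) (L.add_mem ht hz) hz1
  nlinarith

/-- The squared norms of `z`, `z + a`, `z + b`, `z + a + b` add up to `‖c‖² + ‖a‖² + ‖b‖² = 3`, so
one of these four lattice vectors is zero; the four cases are the four conclusions. -/
lemma eq_add_or_sub_of_congr (hL : ∀ x ∈ L, x ≠ 0 → 1 ≤ ‖x‖) {a b c z : V} (ha : a ∈ L)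
    (hb : b ∈ L) (hz : z ∈ L) (ha1 : ‖a‖ = 1) (hb1 : ‖b‖ = 1) (hc1 : ‖c‖ = 1)
    (h : c = a + b + (2 : ℤ) • z) :
    (c = a + b ∨ c = -(a + b)) ∨ (c = a - b ∨ c = -(a - b)) := by
  have h2 : c = a + b + z + z := by rw [h, two_smul]; abel
  by_cases hz0 : z = 0
  · left; left; rw [h2, hz0]; simp
  by_cases hz1 : z + a = 0
  · right; right; rw [h2, eq_neg_of_add_eq_zero_left hz1]; abel
  by_cases hz2 : z + b = 0
  · right; left; rw [h2, eq_neg_of_add_eq_zero_left hz2]; abel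
  by_cases hz3 : z + (a + b) = 0
  · left; right; rw [h2, eq_neg_of_add_eq_zero_left hz3]; abel
  exfalso
  have e0 := one_le_pow₀ (n := 2) (hL _ hz hz0)
  have e1 := one_le_pow₀ (n := 2) (hL _ (L.add_mem hz ha) hz1)
  have e2 := one_le_pow₀ (n := 2) (hL _ (L.add_mem hz hb) hz2)
  have e3 := one_le_pow₀ (n := 2) (hL _ (L.add_mem hz (L.add_mem ha hb)) hz3)
  have e4 : ‖c‖ ^ 2 = 1 := by rw [hc1, one_pow]
  have e5 : ‖a‖ ^ 2 = 1 := by rw [ha1, one_pow]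
  have e6 : ‖b‖ ^ 2 = 1 := by rw [hb1, one_pow]
  rw [h2] at e4
  simp only [← real_inner_self_eq_norm_sq, inner_add_left, inner_add_right] at e0 e1 e2 e3 e4 e5 e6
  have c1 := real_inner_comm a b
  have c2 := real_inner_comm a z
  have c3 := real_inner_comm b z
  linarith

lemma two_mul_inner_eq_of_norm_add {a b : V} (ha1 : ‖a‖ = 1) (hb1 : ‖b‖ = 1)
    (h : ‖a + b‖ = 1) : ⟪a, b⟫_ℝ = -1 / 2 := by
  have e := norm_add_sq_real a b
  rw [h, ha1, hb1] at e
  linarith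

lemma two_mul_inner_eq_of_norm_sub {a b : V} (ha1 : ‖a‖ = 1) (hb1 : ‖b‖ = 1)
    (h : ‖a - b‖ = 1) : ⟪a, b⟫_ℝ = 1 / 2 := by
  have e := norm_sub_sq_real a b
  rw [h, ha1, hb1] at e
  linarith

/-- Watson's inequality. -/
lemma two_mul_le_sum_abs (hL : ∀ x ∈ L, x ≠ 0 → 1 ≤ ‖x‖) {n : ℕ} {b : Fin n → V}
    (hb : ∀ i, b i ∈ L) (hb1 : ∀ i, ‖b i‖ = 1) {x : V} (hx : x ∈ L) (hx0 : x ≠ 0)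
    (hxb : ∀ i, x ≠ b i ∧ x ≠ -b i) {d : ℤ} {r : Fin n → ℤ} (h : d • x = comb b r) :
    2 * d ≤ ∑ i, |r i| := by
  have hN : 0 < ‖x‖ ^ 2 := by positivity
  -- From `1 ≤ ‖x ± b i‖²` and `‖b i‖ = 1` one gets `2 |⟪x, b i⟫| ≤ ‖x‖²`. Pairing `x` with `d • x =
  -- ∑ r i • b i` then gives the bound.
  have h1 : ∀ i, 2 * ((r i : ℝ) * ⟪x, b i⟫_ℝ) ≤ |(r i : ℝ)| * ‖x‖ ^ 2 := by
    intro i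
    have e1 := one_le_pow₀ (n := 2) (hL _ (L.sub_mem hx (hb i)) (sub_ne_zero.2 (hxb i).1))
    have e2 := one_le_pow₀ (n := 2) (hL _ (L.add_mem hx (hb i))
      fun h => (hxb i).2 (eq_neg_of_add_eq_zero_left h))
    rw [norm_sub_sq_real, hb1] at e1
    rw [norm_add_sq_real, hb1] at e2
    rcases abs_cases (r i : ℝ) with ⟨h, h'⟩ | ⟨h, h'⟩ <;> rw [h] <;> nlinarith
  have h2 : 2 * ((d : ℝ) * ‖x‖ ^ 2) ≤ (∑ i, |(r i : ℝ)|) * ‖x‖ ^ 2 := by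
    have e : (d : ℝ) * ‖x‖ ^ 2 = ∑ i, (r i : ℝ) * ⟪x, b i⟫_ℝ := by
      rw [← real_inner_self_eq_norm_sq, ← inner_smul_right, Int.cast_smul_eq_zsmul, h, comb,
        inner_sum]
      simp [← Int.cast_smul_eq_zsmul ℝ, inner_smul_right]
    rw [e, Finset.mul_sum, Finset.sum_mul]
    exact Finset.sum_le_sum fun i _ => h1 i
  rw [← mul_assoc] at h2
  have h3 := le_of_mul_le_mul_right h2 hN
  exact_mod_cast h3

/-- Unit vectors of odd index in a lattice of minimum `1` and dimension at most `4` generate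
the lattice. -/
theorem span_eq_of_odd_det (hL : ∀ x ∈ L, x ≠ 0 → 1 ≤ ‖x‖) {n : ℕ} (hn : n ≤ 4)
    {η : Fin n → V} (hη : L = Submodule.span ℤ (Set.range η)) (A : Matrix (Fin n) (Fin n) ℤ)
    (hA : Odd A.det) (hA1 : ∀ i, ‖comb η (A i)‖ = 1) :
    Submodule.span ℤ (Set.range fun i => comb η (A i)) = L := by
  set b : Fin n → V := fun i => comb η (A i) with hbdef
  have hbL : ∀ i, b i ∈ L := fun i => by rw [hη]; exact comb_mem_span η _
  have hsub : Submodule.span ℤ (Set.range b) ≤ L := by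
    rw [Submodule.span_le]
    rintro _ ⟨i, rfl⟩
    exact hbL i
  refine le_antisymm hsub fun x hx => ?_
  obtain ⟨d, hd, hdodd, a, ha⟩ : ∃ d : ℕ, 0 < d ∧ Odd d ∧ ∃ a : Fin n → ℤ,
      (d : ℤ) • x = comb b a := by
    have hx' := hx
    rw [hη, mem_span_iff_exists_comb] at hx'
    obtain ⟨k, rfl⟩ := hx'
    -- Cramer's rule: the determinant clears the denominators of the coordinates in `b`.
    have key : A.det • comb η k = comb b (Matrix.vecMul k A.adjugate) := by
      have e : comb b (Matrix.vecMul k A.adjugate)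
          = comb η (Matrix.vecMul (Matrix.vecMul k A.adjugate) A) := by
        simp only [comb, hbdef, Finset.smul_sum, smul_smul]
        rw [Finset.sum_comm]
        refine Finset.sum_congr rfl fun j _ => ?_
        rw [← Finset.sum_smul]
        rfl
      rw [e, Matrix.vecMul_vecMul, Matrix.adjugate_mul, Matrix.vecMul_smul, Matrix.vecMul_one]
      simp [comb, Finset.smul_sum, smul_smul]
    refine ⟨A.det.natAbs, ?_, Int.natAbs_odd.2 hA, ?_⟩
    · rw [Int.natAbs_pos]
      rintro h
      rw [h] at hA
      exact absurd hA (by decide)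
    · rcases Int.natAbs_eq A.det with h | h
      · exact ⟨_, by rw [← h]; exact key⟩
      · refine ⟨-Matrix.vecMul k A.adjugate, ?_⟩
        rw [comb_neg, ← key, ← neg_smul]
        congr 1
        omega
  let r : Fin n → ℤ := fun i => (a i).bmod d
  -- Balanced residues; the inequality is strict because `d` is odd.
  have hr : ∀ i, 2 * |r i| < d := by
    intro i
    have h1 := Int.le_bmod (x := a i) hd
    have h2 := Int.bmod_lt (x := a i) hd
    obtain ⟨e, he⟩ := hdodd
    change 2 * |(a i).bmod d| < d
    rcases abs_cases ((a i).bmod d) with ⟨h, -⟩ | ⟨h, -⟩ <;> rw [h] <;> omega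
  have hq : ∃ q : Fin n → ℤ, ∀ i, a i = d * q i + r i :=
    ⟨fun i => (a i).bdiv d, fun i => (Int.bdiv_add_bmod (a i) d).symm⟩
  obtain ⟨q, hq⟩ := hq
  set y := x - comb b q with hy
  have hyL : y ∈ L := L.sub_mem hx (hsub (comb_mem_span b q))
  have hxy : x = y + comb b q := by rw [hy]; abel
  have hdy : (d : ℤ) • y = comb b r := by
    rw [hy, smul_sub, ha]
    have : a = (fun i => (d : ℤ) * q i) + r := funext hq
    rw [this, comb_add]
    simp [comb, Finset.smul_sum, mul_smul]
  have hymem : y ∈ Submodule.span ℤ (Set.range b) := by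
    by_cases hy0 : y = 0
    · rw [hy0]; exact Submodule.zero_mem _
    by_cases hyb : ∀ i, y ≠ b i ∧ y ≠ -b i
    -- Watson gives `2d ≤ ∑ |r i|`, while strict balance gives `∑ |r i| < n d / 2 ≤ 2d`. This is
    -- where `n ≤ 4` enters.
    · exfalso
      have h1 := two_mul_le_sum_abs hL hbL hA1 hyL hy0 hyb hdy
      rcases Nat.eq_zero_or_pos n with rfl | hn0
      · simp at h1
        omega
      have h2 : ∑ i, 2 * |r i| < ∑ _i : Fin n, (d : ℤ) :=
        Finset.sum_lt_sum_of_nonempty ⟨⟨0, hn0⟩, Finset.mem_univ _⟩ fun i _ => hr i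
      rw [← Finset.mul_sum] at h2
      simp at h2
      have h3 : (n : ℤ) ≤ 4 := by exact_mod_cast hn
      nlinarith
    · push Not at hyb
      obtain ⟨i, hi⟩ := hyb
      by_cases h : y = b i
      · rw [h]; exact Submodule.subset_span ⟨i, rfl⟩
      · rw [hi h]; exact Submodule.neg_mem _ (Submodule.subset_span ⟨i, rfl⟩)
  rw [hxy]
  exact Submodule.add_mem _ hymem (comb_mem_span b q)

end ShortVectors

end FlatTori

/-! ### Vertices as perfect lattices. -/

namespace FlatTori

open Filter Topology

section Omega

variable {n : ℕ} {η : Fin n → E n}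

lemma dotProduct_gram_mulVec (η : Fin n → E n) (v : Fin n → ℝ) :
    v ⬝ᵥ (Matrix.gram ℝ η).mulVec v = ‖∑ i, v i • η i‖ ^ 2 := by
  rw [← real_inner_self_eq_norm_sq, ← Matrix.star_dotProduct_gram_mulVec, star_trivial]

lemma sum_intCast_smul (η : Fin n → E n) (v : Fin n → ℤ) :
    ∑ i, (v i : ℝ) • η i = comb η v := by
  simp [comb, Int.cast_smul_eq_zsmul]

lemma gram_mem_Omega2_iff : Matrix.gram ℝ η ∈ Omega2 n ↔ LinearIndependent ℝ η ∧
    (∀ i, ‖η i‖ = 1) ∧ ∀ k : Fin n → ℤ, k ≠ 0 → 1 ≤ ‖comb η k‖ := by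
  rw [Omega2, Set.mem_ofPred_eq, Matrix.posDef_gram_iff_linearIndependent]
  refine and_congr_right fun _ => and_congr (forall_congr' fun i => ?_)
    (forall_congr' fun k => imp_congr_right fun _ => ?_)
  · rw [Matrix.gram_apply, real_inner_self_eq_norm_sq,
      pow_eq_one_iff_of_nonneg (norm_nonneg _) two_ne_zero]
  · rw [dotProduct_gram_mulVec, sum_intCast_smul, one_le_sq_iff₀ (norm_nonneg _)]

open scoped MatrixOrder Matrix.Norms.L2Operator in
lemma exists_gram_eq_of_posDef {Q : Matrix (Fin n) (Fin n) ℝ} (hQ : Q.PosDef) :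
    ∃ η : Fin n → E n, Matrix.gram ℝ η = Q := by
  obtain ⟨B, rfl⟩ := CStarAlgebra.nonneg_iff_eq_star_mul_self.1
    (Matrix.nonneg_iff_posSemidef.2 hQ.posSemidef)
  refine ⟨fun i => WithLp.toLp 2 fun j => B j i, ?_⟩
  ext i j
  simp [Matrix.gram_apply, PiLp.inner_apply, Matrix.mul_apply, mul_comm]

lemma exists_gram_eq_of_mem_vertices {Q : Matrix (Fin n) (Fin n) ℝ} (hQ : Q ∈ vertices n) :
    ∃ η : Fin n → E n, Matrix.gram ℝ η = Q :=
  exists_gram_eq_of_posDef (extremePoints_subset hQ).1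

lemma min_of_forall_comb (hmin : ∀ k : Fin n → ℤ, k ≠ 0 → 1 ≤ ‖comb η k‖) :
    ∀ x ∈ Submodule.span ℤ (Set.range η), x ≠ 0 → 1 ≤ ‖x‖ := by
  intro x hx hx0
  obtain ⟨k, rfl⟩ := (mem_span_iff_exists_comb η).1 hx
  refine hmin k ?_
  rintro rfl
  exact hx0 (comb_zero η)

/-- The dual lattice of a vertex is perfect. -/
theorem eq_zero_of_mem_vertices {Q : Matrix (Fin n) (Fin n) ℝ} (hQ : Q ∈ vertices n)
    (hη : Matrix.gram ℝ η = Q) (F : LinearMap.BilinForm ℝ (E n)) (hF : ∀ x y, F x y = F y x)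
    (h : ∀ s ∈ Submodule.span ℤ (Set.range η), ‖s‖ = 1 → F s s = 0) : F = 0 := by
  obtain ⟨hmem, hext⟩ := mem_extremePoints.1 hQ
  have hmem' := hmem
  rw [← hη, gram_mem_Omega2_iff] at hmem'
  obtain ⟨hli, hunit, hmin⟩ := hmem'
  obtain ⟨C, hC⟩ : ∃ C : ℝ, ∀ x, |F x x| ≤ C * ‖x‖ ^ 2 := by
    refine ⟨‖LinearMap.toContinuousBilinearMap F‖, fun x => ?_⟩
    have := (LinearMap.toContinuousBilinearMap F).le_opNorm₂ x x
    rw [LinearMap.toContinuousBilinearMap_apply, Real.norm_eq_abs] at this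
    linarith [this, sq ‖x‖]
  let H : Matrix (Fin n) (Fin n) ℝ := Matrix.of fun i j => F (η i) (η j)
  have hH : ∀ v : Fin n → ℝ, v ⬝ᵥ H.mulVec v = F (∑ i, v i • η i) (∑ i, v i • η i) := by
    intro v
    simp only [dotProduct, Matrix.mulVec, H, Matrix.of_apply, map_sum, LinearMap.sum_apply,
      map_smul, LinearMap.smul_apply, smul_eq_mul, Finset.mul_sum]
    rw [Finset.sum_comm]
    refine Finset.sum_congr rfl fun i _ => Finset.sum_congr rfl fun j _ => ?_
    ring
  have hT := finite_setOf_norm_comb_le hli 2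
  -- Up to norm `2` only finitely many vectors matter: on unit vectors `F` vanishes, and the others
  -- have room above `1`. Beyond norm `2`, the bound `ε * C < 1 / 2` keeps more than half of the
  -- squared norm.
  have hev : ∀ᶠ ε : ℝ in 𝓝[>] 0, ε * C < 1 / 2 ∧ ∀ k ∈ {k : Fin n → ℤ | ‖comb η k‖ ≤ 2},
      k ≠ 0 → 1 ≤ ‖comb η k‖ ^ 2 - ε * |F (comb η k) (comb η k)| := by
    refine Filter.Eventually.and ?_ ?_
    · have : Tendsto (fun ε : ℝ => ε * C) (𝓝[>] 0) (𝓝 (0 * C)) :=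
        (tendsto_id.mul_const C).mono_left nhdsWithin_le_nhds
      rw [zero_mul] at this
      exact this.eventually (gt_mem_nhds (by norm_num))
    · rw [Filter.eventually_all_finite hT]
      intro k _
      by_cases hk0 : k = 0
      · exact Filter.Eventually.of_forall fun ε h0 => absurd hk0 h0
      have h1 := hmin k hk0
      rcases h1.eq_or_lt with h1 | h1
      · refine Filter.Eventually.of_forall fun ε _ => ?_
        rw [h _ (comb_mem_span η k) h1.symm, ← h1]
        simp
      · have : Tendsto (fun ε : ℝ => ‖comb η k‖ ^ 2 - ε * |F (comb η k) (comb η k)|) (𝓝[>] 0)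
            (𝓝 (‖comb η k‖ ^ 2 - 0 * |F (comb η k) (comb η k)|)) :=
          (tendsto_const_nhds.sub (tendsto_id.mul_const _)).mono_left nhdsWithin_le_nhds
        rw [zero_mul, sub_zero] at this
        have h2 : 1 < ‖comb η k‖ ^ 2 := one_lt_pow₀ h1 two_ne_zero
        filter_upwards [this.eventually (lt_mem_nhds h2)] with ε hε _
        exact hε.le
  obtain ⟨ε, ⟨hε1, hε2⟩, hε0⟩ := (hev.and self_mem_nhdsWithin).exists
  have hε0' : (0 : ℝ) < ε := hε0
  have key : ∀ σ : ℝ, |σ| = ε → Q + σ • H ∈ Omega2 n := by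
    intro σ hσ
    have hquad : ∀ v : Fin n → ℝ, ‖∑ i, v i • η i‖ ^ 2 -
        ε * |F (∑ i, v i • η i) (∑ i, v i • η i)| ≤ v ⬝ᵥ (Q + σ • H).mulVec v := by
      intro v
      rw [Matrix.add_mulVec, Matrix.smul_mulVec, dotProduct_add, dotProduct_smul, hH, ← hη,
        dotProduct_gram_mulVec, smul_eq_mul, sub_eq_add_neg, ← hσ, ← abs_mul]
      gcongr
      exact neg_abs_le _
    refine ⟨Matrix.PosDef.of_dotProduct_mulVec_pos ?_ ?_, ?_, ?_⟩
    · refine hmem.1.isHermitian.add ?_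
      ext i j
      simp [H, hF (η i) (η j)]
    · intro v hv
      rw [star_trivial]
      refine lt_of_lt_of_le ?_ (hquad v)
      have hne : ∑ i, v i • η i ≠ 0 := fun h0 =>
        hv (funext (Fintype.linearIndependent_iff.1 hli v h0))
      have h1 : 0 < ‖∑ i, v i • η i‖ ^ 2 := by positivity
      have h2 := mul_le_mul_of_nonneg_left (hC (∑ i, v i • η i)) hε0'.le
      nlinarith
    · intro i
      have : F (η i) (η i) = 0 := h _ (Submodule.subset_span ⟨i, rfl⟩) (hunit i)
      simp [H, this, hmem.2.1 i]
    · intro k hk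
      refine le_trans ?_ (hquad _)
      rw [sum_intCast_smul]
      by_cases hle : ‖comb η k‖ ≤ 2
      · exact hε2 k hle hk
      · push Not at hle
        have h2 := mul_le_mul_of_nonneg_left (hC (comb η k)) hε0'.le
        nlinarith
  -- `Q` is the midpoint of `Q + ε • H` and `Q - ε • H`, so extremality forces `H = 0`.
  have h1 := hext (Q + ε • H) (key ε (abs_of_pos hε0')) (Q + (-ε) • H)
    (key (-ε) (by rw [abs_neg, abs_of_pos hε0'])) ⟨1 / 2, 1 / 2, by norm_num, by norm_num,
      by norm_num, by
        rw [← smul_add, add_add_add_comm, ← add_smul, add_neg_cancel, zero_smul, add_zero,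
          ← two_smul ℝ Q, smul_smul]
        norm_num⟩
  have h2 : H = 0 := by
    have := h1.1
    rw [add_eq_left, smul_eq_zero] at this
    exact this.resolve_left hε0'.ne'
  refine (basisOf hli).ext fun i => (basisOf hli).ext fun j => ?_
  simpa [H] using congrFun (congrFun h2 i) j

end Omega

end FlatTori

/-! ### Classes of unit vectors modulo `2`. -/

namespace FlatTori

section Classes

variable {n : ℕ} {η : Fin n → E n}

/-- The classes modulo `2` of the unit vectors of the lattice. -/
def unitClasses (η : Fin n → E n) : Set (Fin n → ZMod 2) :=
  {p | ∃ k : Fin n → ℤ, ‖comb η k‖ = 1 ∧ ∀ i, (k i : ZMod 2) = p i}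

lemma exists_eq_add_two_smul {k l : Fin n → ℤ} (h : ∀ i, (k i : ZMod 2) = l i) :
    ∃ z, comb η k = comb η l + (2 : ℤ) • comb η z := by
  have h1 : ∀ i, ∃ z, k i = l i + 2 * z := fun i => by
    have := (ZMod.intCast_eq_intCast_iff_dvd_sub (l i) (k i) 2).1 (h i).symm
    obtain ⟨z, hz⟩ := this
    exact ⟨z, by push_cast at hz; linarith⟩
  choose z hz using h1
  refine ⟨z, ?_⟩
  have : k = l + (z + z) := funext fun i => by rw [hz]; simp [two_mul]
  rw [this, comb_add, comb_add, two_smul]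

lemma zero_notMem_unitClasses (hmin : ∀ k : Fin n → ℤ, k ≠ 0 → 1 ≤ ‖comb η k‖) :
    0 ∉ unitClasses η := by
  rintro ⟨k, hk, h⟩
  obtain ⟨z, hz⟩ := exists_eq_add_two_smul (η := η) (k := k) (l := 0) fun i => by simpa using h i
  rw [comb_zero, zero_add, two_smul, ← two_smul ℝ] at hz
  rw [hz, norm_smul] at hk
  by_cases hz0 : z = 0
  · rw [hz0, comb_zero] at hk
    simp at hk
  · have := hmin z hz0
    rw [Real.norm_ofNat] at hk
    linarith

/-- Symmetric forms are parametrised by `Sym2 (Fin n)`, a space of dimension `n(n+1)/2`. With fewer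
classes, some nonzero form would vanish on one representative of each class, hence on all unit
vectors because a class has only one unit vector up to sign. This contradicts perfection. -/
theorem card_unitClasses {Q : Matrix (Fin n) (Fin n) ℝ} (hQ : Q ∈ vertices n)
    (hη : Matrix.gram ℝ η = Q) : n * (n + 1) / 2 ≤ (unitClasses η).ncard := by
  classical
  have hmem := (extremePoints_subset hQ)
  rw [← hη, gram_mem_Omega2_iff] at hmem
  obtain ⟨hli, -, hmin⟩ := hmem
  choose rep hrep1 hrep2 using fun p : unitClasses η => p.2
  by_contra hlt
  rw [not_le, ← Nat.card_coe_set_eq, Nat.card_eq_fintype_card] at hlt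
  let M : (Sym2 (Fin n) → ℝ) →ₗ[ℝ] Matrix (Fin n) (Fin n) ℝ :=
    { toFun := fun h => Matrix.of fun i j => h s(i, j)
      map_add' := fun _ _ => rfl
      map_smul' := fun _ _ => rfl }
  let F : (Sym2 (Fin n) → ℝ) →ₗ[ℝ] LinearMap.BilinForm ℝ (E n) :=
    (Matrix.toBilin (basisOf hli)).toLinearMap ∘ₗ M
  let Φ : (Sym2 (Fin n) → ℝ) →ₗ[ℝ] (unitClasses η → ℝ) :=
    LinearMap.pi fun p => (LinearMap.applyₗ (comb η (rep p))).comp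
      ((LinearMap.applyₗ (comb η (rep p))).comp F)
  have hker : LinearMap.ker Φ ≠ ⊥ := by
    apply LinearMap.ker_ne_bot_of_finrank_lt
    rw [Module.finrank_fintype_fun_eq_card, Module.finrank_fintype_fun_eq_card, Sym2.card,
      Fintype.card_fin, Nat.choose_two_right, Nat.add_sub_cancel, mul_comm]
    exact hlt
  obtain ⟨h, hh, hh0⟩ := Submodule.exists_mem_ne_zero_of_ne_bot hker
  have hF0 : F h = 0 := by
    refine eq_zero_of_mem_vertices hQ hη (F h) (fun x y => ?_) fun s hs hs1 => ?_
    · have hM : ∀ i j, M h i j = M h j i := fun i j => congrArg h Sym2.eq_swap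
      simp only [F, LinearMap.comp_apply, LinearEquiv.coe_coe, Matrix.toBilin_apply]
      rw [Finset.sum_comm]
      refine Finset.sum_congr rfl fun i _ => Finset.sum_congr rfl fun j _ => ?_
      rw [hM j i]
      ring
    · obtain ⟨k, rfl⟩ := (mem_span_iff_exists_comb η).1 hs
      let p : unitClasses η := ⟨fun i => (k i : ZMod 2), k, hs1, fun i => rfl⟩
      obtain ⟨z, hz⟩ := exists_eq_add_two_smul (η := η) (k := k) (l := rep p)
        fun i => (hrep2 p i).symm
      have hp : F h (comb η (rep p)) (comb η (rep p)) = 0 := congrFun hh p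
      rcases eq_or_eq_neg_of_congr (min_of_forall_comb hmin) (comb_mem_span η _)
        (comb_mem_span η z) hs1 (hrep1 p) hz with h1 | h1
      · rw [h1, hp]
      · rw [h1, map_neg, map_neg, LinearMap.neg_apply, hp, neg_zero, neg_zero]
  have hM : M h = 0 := by simpa [F] using hF0
  apply hh0
  ext q
  induction q using Sym2.ind with
  | _ i j => exact congrFun (congrFun hM i) j

end Classes

/-! ### Path bases in large subsets of a vector space over the field with two elements. -/

section Combinatorics

variable {G : Type*} [AddCommGroup G] [DecidableEq G]

/-- The union of `K` and its translate by `x`. -/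
def adjoin (K : Finset G) (x : G) : Finset G := K ∪ K.image (x + ·)

lemma mem_adjoin {K : Finset G} {x a : G} : a ∈ adjoin K x ↔ a ∈ K ∨ ∃ b ∈ K, x + b = a := by
  simp only [adjoin, Finset.mem_union, Finset.mem_image]

omit [DecidableEq G] in
lemma add_self_eq_zero_of (h2 : ∀ a : G, a + a = 0) (a b : G) : a + (a + b) = b := by
  rw [← add_assoc, h2, zero_add]

lemma adjoin_closed (h2 : ∀ a : G, a + a = 0) {K : Finset G}
    (hK : ∀ a ∈ K, ∀ b ∈ K, a + b ∈ K) (x : G) :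
    ∀ a ∈ adjoin K x, ∀ b ∈ adjoin K x, a + b ∈ adjoin K x := by
  intro a ha b hb
  rw [mem_adjoin] at ha hb ⊢
  rcases ha with ha | ⟨a, ha, rfl⟩ <;> rcases hb with hb | ⟨b, hb, rfl⟩
  · exact Or.inl (hK a ha b hb)
  · exact Or.inr ⟨a + b, hK a ha b hb, by abel⟩
  · exact Or.inr ⟨a + b, hK a ha b hb, by abel⟩
  · refine Or.inl ?_
    have : x + a + (x + b) = a + b := by
      rw [add_add_add_comm, h2, zero_add]
    rw [this]
    exact hK a ha b hb

lemma card_adjoin (h2 : ∀ a : G, a + a = 0) {K : Finset G}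
    (hK : ∀ a ∈ K, ∀ b ∈ K, a + b ∈ K) {x : G} (hx : x ∉ K) : (adjoin K x).card = 2 * K.card := by
  rw [adjoin, Finset.card_union_of_disjoint, Finset.card_image_of_injective _
    (add_right_injective x), two_mul]
  rw [Finset.disjoint_left]
  intro a ha ha'
  obtain ⟨b, hb, rfl⟩ := Finset.mem_image.1 ha'
  apply hx
  have := hK _ ha b hb
  rwa [add_assoc, h2, add_zero] at this

/-- If `N` is the set of nonzero elements missing from `T`, an `x` outside `K` fails only when it
lies in `N` or in `s + N`. The hypothesis says that `K` and these two sets do not fill `G`. -/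
lemma exists_pair [Fintype G] (h2 : ∀ a : G, a + a = 0) {T : Finset G} (h0 : 0 ∉ T)
    {K : Finset G} {s : G} (h0K : 0 ∈ K) (hsK : s ∈ K)
    (hcard : 2 * (Fintype.card G - T.card - 1) + K.card < Fintype.card G) :
    ∃ x, x ∉ K ∧ x ∈ T ∧ s + x ∈ T := by
  by_contra! h
  let N := Tᶜ.erase 0
  have hN : N.card = Fintype.card G - T.card - 1 := by
    rw [Finset.card_erase_of_mem (by simpa using h0), Finset.card_compl]
  have hsub : Kᶜ ⊆ N ∪ N.image (s + ·) := by
    intro x hx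
    rw [Finset.mem_compl] at hx
    rw [Finset.mem_union, Finset.mem_image]
    by_cases hxT : x ∈ T
    · refine Or.inr ⟨s + x, ?_, add_self_eq_zero_of h2 s x⟩
      rw [Finset.mem_erase, Finset.mem_compl]
      refine ⟨fun hsx => hx ?_, h x hx hxT⟩
      rwa [← add_self_eq_zero_of h2 s x, hsx, add_zero]
    · refine Or.inl ?_
      rw [Finset.mem_erase, Finset.mem_compl]
      exact ⟨fun h => hx (h ▸ h0K), hxT⟩
  have h1 := Finset.card_le_card hsub
  have h3 := Finset.card_union_le N (N.image (s + ·))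
  have h4 : (N.image (s + ·)).card ≤ N.card := Finset.card_image_le
  rw [Finset.card_compl] at h1
  omega

lemma smul_add_mem_adjoin {n : ℕ} {K : Finset (Fin n → ZMod 2)} (x : Fin n → ZMod 2) (c : ZMod 2)
    {a : Fin n → ZMod 2} (ha : a ∈ K) : c • x + a ∈ adjoin K x := by
  have h01 : c = 0 ∨ c = 1 := by revert c; decide
  rw [mem_adjoin]
  rcases h01 with rfl | rfl
  · left; rwa [zero_smul, zero_add]
  · right; exact ⟨a, ha, by rw [one_smul]⟩

/-- Iterating `adjoin` from `{0}` produces the spans of the successive vectors, so each vector is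
assumed to lie outside the span of its predecessors. -/
lemma det_ne_zero_of_flag_three {s x y : Fin 3 → ZMod 2} (hs : s ∉ ({0} : Finset _)) (hx : x ∉ adjoin {0} s) (hy : y ∉ adjoin (adjoin {0} s) x) :
    (Matrix.of ![s, x, y]).det ≠ 0 := by
  have h2 : ∀ a : Fin 3 → ZMod 2, a + a = 0 := fun a => by ext i; exact CharTwo.add_self_eq_zero _
  have h01 : ∀ a : ZMod 2, a = 0 ∨ a = 1 := by decide
  rw [← isUnit_iff_ne_zero, ← Matrix.isUnit_iff_isUnit_det,
    ← Matrix.linearIndependent_rows_iff_isUnit, Fintype.linearIndependent_iff]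
  intro g hg
  rw [Fin.sum_univ_three] at hg
  change g 0 • s + g 1 • x + g 2 • y = 0 at hg
  have h0 : (0 : Fin 3 → ZMod 2) ∈ ({0} : Finset _) := Finset.mem_singleton_self 0
  have e2 : g 2 = 0 := (h01 (g 2)).resolve_right fun h => hy <| by
    have e : y = g 1 • x + (g 0 • s + (0)) := by
      rw [← add_self_eq_zero_of h2 (g 0 • s + g 1 • x) y]
      simp only [h, one_smul] at hg
      rw [hg]
      abel
    rw [e]
    exact smul_add_mem_adjoin x (g 1) (smul_add_mem_adjoin s (g 0) h0)
  have e1 : g 1 = 0 := (h01 (g 1)).resolve_right fun h => hx <| by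
    have e : x = g 0 • s + (0) := by
      rw [← add_self_eq_zero_of h2 (g 0 • s) x]
      simp only [h, e2, one_smul, zero_smul, add_zero] at hg
      rw [hg]
    rw [e]
    exact smul_add_mem_adjoin s (g 0) h0
  have e0 : g 0 = 0 := (h01 (g 0)).resolve_right fun h => hs <| by
    simpa [h, e1, e2] using hg
  intro i
  fin_cases i <;> assumption

lemma det_ne_zero_of_flag_four {s x y z : Fin 4 → ZMod 2} (hs : s ∉ ({0} : Finset _)) (hx : x ∉ adjoin {0} s) (hy : y ∉ adjoin (adjoin {0} s) x) (hz : z ∉ adjoin (adjoin (adjoin {0} s) x) y) :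
    (Matrix.of ![s, x, y, z]).det ≠ 0 := by
  have h2 : ∀ a : Fin 4 → ZMod 2, a + a = 0 := fun a => by ext i; exact CharTwo.add_self_eq_zero _
  have h01 : ∀ a : ZMod 2, a = 0 ∨ a = 1 := by decide
  rw [← isUnit_iff_ne_zero, ← Matrix.isUnit_iff_isUnit_det,
    ← Matrix.linearIndependent_rows_iff_isUnit, Fintype.linearIndependent_iff]
  intro g hg
  rw [Fin.sum_univ_four] at hg
  change g 0 • s + g 1 • x + g 2 • y + g 3 • z = 0 at hg
  have h0 : (0 : Fin 4 → ZMod 2) ∈ ({0} : Finset _) := Finset.mem_singleton_self 0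
  have e3 : g 3 = 0 := (h01 (g 3)).resolve_right fun h => hz <| by
    have e : z = g 2 • y + (g 1 • x + (g 0 • s + (0))) := by
      rw [← add_self_eq_zero_of h2 (g 0 • s + g 1 • x + g 2 • y) z]
      simp only [h, one_smul] at hg
      rw [hg]
      abel
    rw [e]
    exact smul_add_mem_adjoin y (g 2) (smul_add_mem_adjoin x (g 1) (smul_add_mem_adjoin s (g 0) h0))
  have e2 : g 2 = 0 := (h01 (g 2)).resolve_right fun h => hy <| by
    have e : y = g 1 • x + (g 0 • s + (0)) := by
      rw [← add_self_eq_zero_of h2 (g 0 • s + g 1 • x) y]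
      simp only [h, e3, one_smul, zero_smul, add_zero] at hg
      rw [hg]
      abel
    rw [e]
    exact smul_add_mem_adjoin x (g 1) (smul_add_mem_adjoin s (g 0) h0)
  have e1 : g 1 = 0 := (h01 (g 1)).resolve_right fun h => hx <| by
    have e : x = g 0 • s + (0) := by
      rw [← add_self_eq_zero_of h2 (g 0 • s) x]
      simp only [h, e2, e3, one_smul, zero_smul, add_zero] at hg
      rw [hg]
    rw [e]
    exact smul_add_mem_adjoin s (g 0) h0
  have e0 : g 0 = 0 := (h01 (g 0)).resolve_right fun h => hs <| by
    simpa [h, e1, e2, e3] using hg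
  intro i
  fin_cases i <;> assumption

/-- A large set of classes in dimension three contains a basis that is a path. -/
lemma exists_path_three {T : Finset (Fin 3 → ZMod 2)} (h0 : 0 ∉ T) (hT : 6 ≤ T.card) :
    ∃ B : Matrix (Fin 3) (Fin 3) (ZMod 2), B.det ≠ 0 ∧ (∀ i, B i ∈ T) ∧
      B 0 + B 1 ∈ T ∧ B 1 + B 2 ∈ T := by
  have h2 : ∀ a : Fin 3 → ZMod 2, a + a = 0 := fun a => by ext i; exact CharTwo.add_self_eq_zero _
  have hG : Fintype.card (Fin 3 → ZMod 2) = 8 := by simp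
  obtain ⟨s, hs⟩ : T.Nonempty := Finset.card_pos.1 (by omega)
  have hs0 : s ∉ ({0} : Finset (Fin 3 → ZMod 2)) := by
    rw [Finset.mem_singleton]; rintro rfl; exact h0 hs
  have hc0 : ∀ a ∈ ({0} : Finset (Fin 3 → ZMod 2)), ∀ b ∈ ({0} : Finset (Fin 3 → ZMod 2)),
      a + b ∈ ({0} : Finset (Fin 3 → ZMod 2)) := by simp
  have hc1 := adjoin_closed h2 hc0 s
  have k1 := card_adjoin h2 hc0 hs0
  rw [Finset.card_singleton] at k1
  -- At most one nonzero class is missing, and `2 + 2 < 8`, then `2 + 4 < 8`. The path is `x`, `s`,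
  -- `y`.
  obtain ⟨x, hxK, hx, hsx⟩ := exists_pair h2 h0 (K := adjoin {0} s) (s := s)
    (by simp [mem_adjoin]) (by simp [mem_adjoin]) (by omega)
  have k2 := card_adjoin h2 hc1 hxK
  obtain ⟨y, hyK, hy, hsy⟩ := exists_pair h2 h0 (K := adjoin (adjoin {0} s) x) (s := s)
    (by simp [mem_adjoin]) (by simp [mem_adjoin]) (by omega)
  have hdet := det_ne_zero_of_flag_three hs0 hxK hyK
  refine ⟨Matrix.of ![x, s, y], ?_, ?_, ?_, ?_⟩
  · have e : (Matrix.of ![x, s, y]) = (!![0, 1, 0; 1, 0, 0; 0, 0, 1] : Matrix _ _ (ZMod 2)) *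
        Matrix.of ![s, x, y] := by
      ext i j
      fin_cases i <;> simp [Matrix.mul_apply, Fin.sum_univ_three]
    rw [e, Matrix.det_mul]
    exact mul_ne_zero (by decide) hdet
  · intro i
    fin_cases i <;> assumption
  · change x + s ∈ T
    rwa [add_comm]
  · exact hsy

/-- A large set of classes in dimension four contains a basis that is a path. -/
lemma exists_path_four {T : Finset (Fin 4 → ZMod 2)} (h0 : 0 ∉ T) (hT : 10 ≤ T.card) :
    ∃ B : Matrix (Fin 4) (Fin 4) (ZMod 2), B.det ≠ 0 ∧ (∀ i, B i ∈ T) ∧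
      B 0 + B 1 ∈ T ∧ B 1 + B 2 ∈ T ∧ B 2 + B 3 ∈ T := by
  have h2 : ∀ a : Fin 4 → ZMod 2, a + a = 0 := fun a => by ext i; exact CharTwo.add_self_eq_zero _
  have h2' := add_self_eq_zero_of h2
  have hG : Fintype.card (Fin 4 → ZMod 2) = 16 := by simp
  obtain ⟨s, hs⟩ : T.Nonempty := Finset.card_pos.1 (by omega)
  have hs0 : s ∉ ({0} : Finset (Fin 4 → ZMod 2)) := by
    rw [Finset.mem_singleton]; rintro rfl; exact h0 hs
  have hc0 : ∀ a ∈ ({0} : Finset (Fin 4 → ZMod 2)), ∀ b ∈ ({0} : Finset (Fin 4 → ZMod 2)),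
      a + b ∈ ({0} : Finset (Fin 4 → ZMod 2)) := by simp
  have hc1 := adjoin_closed h2 hc0 s
  have k1 := card_adjoin h2 hc0 hs0
  rw [Finset.card_singleton] at k1
  obtain ⟨x, hxK, hx, hsx⟩ := exists_pair h2 h0 (K := adjoin {0} s) (s := s)
    (by simp [mem_adjoin]) (by simp [mem_adjoin]) (by omega)
  have k2 := card_adjoin h2 hc1 hxK
  have hc2 := adjoin_closed h2 hc1 x
  -- At most five nonzero classes are missing and `2·5 + 4 < 16`. The next step would need `2·5 + 8
  -- < 16`, so the fourth vector calls for a separate argument.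
  obtain ⟨y, hyK, hy, hsy⟩ := exists_pair h2 h0 (K := adjoin (adjoin {0} s) x) (s := s)
    (by simp [mem_adjoin]) (by simp [mem_adjoin]) (by omega)
  have k3 := card_adjoin h2 hc2 hyK
  have hc3 := adjoin_closed h2 hc2 y
  set P := adjoin (adjoin (adjoin {0} s) x) y with hP
  have hPmem : ∀ a ∈ P, a = 0 ∨ a = s ∨ a = x ∨ a = s + x ∨ a = y ∨ a = s + y ∨ a = x + y ∨
      a = s + (x + y) := by
    intro a ha
    simp only [hP, mem_adjoin, Finset.mem_singleton] at ha
    rcases ha with ((rfl | ⟨_, rfl, rfl⟩) | ⟨_, rfl | ⟨_, rfl, rfl⟩, rfl⟩) |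
      ⟨_, (rfl | ⟨_, rfl, rfl⟩) | ⟨_, rfl | ⟨_, rfl, rfl⟩, rfl⟩, rfl⟩
    · exact Or.inl rfl
    · simp
    · simp
    · simp [add_comm]
    · simp
    · simp [add_comm]
    · simp [add_comm]
    · refine Or.inr <| Or.inr <| Or.inr <| Or.inr <| Or.inr <| Or.inr <| Or.inr ?_
      abel
  -- a path in terms of the flag
  have hpath : ∀ (U : Matrix (Fin 4) (Fin 4) (ZMod 2)) (z b₀ b₁ b₂ : Fin 4 → ZMod 2), U.det ≠ 0 →
      z ∉ P → z ∈ T → b₀ ∈ T → b₁ ∈ T → b₂ ∈ T → b₀ + b₁ ∈ T → b₁ + b₂ ∈ T → b₂ + z ∈ T →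
      Matrix.of ![b₀, b₁, b₂, z] = U * Matrix.of ![s, x, y, z] →
      ∃ B : Matrix (Fin 4) (Fin 4) (ZMod 2), B.det ≠ 0 ∧ (∀ i, B i ∈ T) ∧
        B 0 + B 1 ∈ T ∧ B 1 + B 2 ∈ T ∧ B 2 + B 3 ∈ T := by
    intro U z b₀ b₁ b₂ hU hzP hz h₀ h₁ h₂ h₀₁ h₁₂ h₂z e
    refine ⟨Matrix.of ![b₀, b₁, b₂, z], ?_, ?_, h₀₁, h₁₂, h₂z⟩
    · rw [e, Matrix.det_mul]
      exact mul_ne_zero hU (det_ne_zero_of_flag_four hs0 hxK hyK hzP)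
    · intro i
      fin_cases i <;> assumption
  have hxs : x + s ∈ T := by rwa [add_comm]
  have hys : y + s ∈ T := by rwa [add_comm]
  by_contra hno
  -- the differences that a path can use
  have n1 : ∀ z ∉ P, z ∈ T → x + z ∉ T := fun z hzP hz h => hno <|
    hpath !![0, 0, 1, 0; 1, 0, 0, 0; 0, 1, 0, 0; 0, 0, 0, 1] z y s x (by decide) hzP hz hy hs hx
      hys hsx h (by ext i j; fin_cases i <;> simp [Matrix.mul_apply, Fin.sum_univ_four])
  have n2 : ∀ z ∉ P, z ∈ T → s + x + z ∉ T := fun z hzP hz h => hno <|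
    hpath !![0, 0, 1, 0; 1, 0, 0, 0; 1, 1, 0, 0; 0, 0, 0, 1] z y s (s + x) (by decide) hzP hz hy hs
      hsx hys (by rwa [h2']) h
      (by ext i j; fin_cases i <;> simp [Matrix.mul_apply, Fin.sum_univ_four])
  have n3 : ∀ z ∉ P, z ∈ T → y + z ∉ T := fun z hzP hz h => hno <|
    hpath !![0, 1, 0, 0; 1, 0, 0, 0; 0, 0, 1, 0; 0, 0, 0, 1] z x s y (by decide) hzP hz hx hs hy
      hxs hsy h (by ext i j; fin_cases i <;> simp [Matrix.mul_apply, Fin.sum_univ_four])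
  have n4 : ∀ z ∉ P, z ∈ T → s + y + z ∉ T := fun z hzP hz h => hno <|
    hpath !![0, 1, 0, 0; 1, 0, 0, 0; 1, 0, 1, 0; 0, 0, 0, 1] z x s (s + y) (by decide) hzP hz hx hs
      hsy hxs (by rwa [h2']) h
      (by ext i j; fin_cases i <;> simp [Matrix.mul_apply, Fin.sum_univ_four])
  have n5 : x + y ∈ T → ∀ z ∉ P, z ∈ T → x + y + z ∉ T := fun hxy z hzP hz h => hno <|
    hpath !![1, 0, 0, 0; 0, 1, 0, 0; 0, 1, 1, 0; 0, 0, 0, 1] z s x (x + y) (by decide) hzP hz hs hx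
      hxy hsx (by rwa [h2']) h
      (by ext i j; fin_cases i <;> simp [Matrix.mul_apply, Fin.sum_univ_four])
  have n6 : x + y ∈ T → ∀ z ∉ P, z ∈ T → s + z ∉ T := fun hxy z hzP hz h => hno <|
    hpath !![0, 1, 1, 0; 0, 1, 0, 0; 1, 0, 0, 0; 0, 0, 0, 1] z (x + y) x s (by decide) hzP hz hxy hx
      hs (by rw [add_right_comm, h2, zero_add]; exact hy) hxs h
      (by ext i j; fin_cases i <;> simp [Matrix.mul_apply, Fin.sum_univ_four])
  have e7 : x + (s + (x + y)) = s + y := by rw [add_left_comm, h2']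
  have n7 : s + (x + y) ∈ T → ∀ z ∉ P, z ∈ T → s + (x + y) + z ∉ T := fun hxy z hzP hz h => hno <|
    hpath !![1, 0, 0, 0; 0, 1, 0, 0; 1, 1, 1, 0; 0, 0, 0, 1] z s x (s + (x + y)) (by decide) hzP hz
      hs hx hxy hsx (by rwa [e7]) h
      (by ext i j; fin_cases i <;> simp [Matrix.mul_apply, Fin.sum_univ_four, add_assoc])
  have n8 : s + (x + y) ∈ T → ∀ z ∉ P, z ∈ T → s + z ∉ T := fun hxy z hzP hz h => hno <|
    hpath !![1, 1, 1, 0; 0, 1, 0, 0; 1, 0, 0, 0; 0, 0, 0, 1] z (s + (x + y)) x s (by decide) hzP hz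
      hxy hx hs (by rw [add_comm, e7]; exact hsy) hxs h
      (by ext i j; fin_cases i <;> simp [Matrix.mul_apply, Fin.sum_univ_four, add_assoc])
  -- counting outside `P`
  have hR : T.card = (T ∩ P).card + (T \ P).card := (Finset.card_inter_add_card_sdiff T P).symm
  have hTP : (T ∩ P).card ≤ 7 := by
    have h0P : (0 : Fin 4 → ZMod 2) ∈ P := by simp [hP, mem_adjoin]
    have : T ∩ P ⊆ P.erase 0 := fun a ha => by
      rw [Finset.mem_inter] at ha
      exact Finset.mem_erase.2 ⟨fun h => h0 (h ▸ ha.1), ha.2⟩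
    have h3 := Finset.card_le_card this
    rw [Finset.card_erase_of_mem h0P] at h3
    omega
  obtain ⟨z, hz⟩ : (T \ P).Nonempty := Finset.card_pos.1 (by omega)
  rw [Finset.mem_sdiff] at hz
  have hcoset : ∀ w ∈ T \ P, ∃ p ∈ P, w = p + z := by
    intro w hw
    have hu : adjoin P z = Finset.univ := by
      rw [← Finset.card_eq_iff_eq_univ, card_adjoin h2 hc3 hz.2, hG]
      omega
    have h3 : w ∈ adjoin P z := hu ▸ Finset.mem_univ w
    rw [mem_adjoin] at h3
    obtain ⟨b, hb, rfl⟩ := h3.resolve_left (Finset.mem_sdiff.1 hw).2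
    exact ⟨b, hb, add_comm _ _⟩
  have hsub : T \ P ⊆ {z, s + z, x + y + z, s + (x + y) + z} := by
    intro w hw
    obtain ⟨p, hp, rfl⟩ := hcoset w hw
    have hwT := (Finset.mem_sdiff.1 hw).1
    rcases hPmem p hp with rfl | rfl | rfl | rfl | rfl | rfl | rfl | rfl
    · simp
    · simp
    · exact absurd hwT (n1 z hz.2 hz.1)
    · exact absurd hwT (n2 z hz.2 hz.1)
    · exact absurd hwT (n3 z hz.2 hz.1)
    · exact absurd hwT (n4 z hz.2 hz.1)
    · simp
    · simp
  -- In each of the three cases `T` has at most nine elements, counted inside and outside `P`: `7 +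
  -- 2`, `7 + 2` and `5 + 4`.
  by_cases hxy : x + y ∈ T
  · have : T \ P ⊆ {z, s + (x + y) + z} := by
      intro w hw
      have hwT := (Finset.mem_sdiff.1 hw).1
      have h3 := hsub hw
      simp only [Finset.mem_insert, Finset.mem_singleton] at h3 ⊢
      rcases h3 with rfl | rfl | rfl | rfl
      · simp
      · exact absurd hwT (n6 hxy z hz.2 hz.1)
      · exact absurd hwT (n5 hxy z hz.2 hz.1)
      · simp
    have h3 := (Finset.card_le_card this).trans Finset.card_le_two
    omega
  by_cases hsxy : s + (x + y) ∈ T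
  · have : T \ P ⊆ {z, x + y + z} := by
      intro w hw
      have hwT := (Finset.mem_sdiff.1 hw).1
      have h3 := hsub hw
      simp only [Finset.mem_insert, Finset.mem_singleton] at h3 ⊢
      rcases h3 with rfl | rfl | rfl | rfl
      · simp
      · exact absurd hwT (n8 hsxy z hz.2 hz.1)
      · simp
      · exact absurd hwT (n7 hsxy z hz.2 hz.1)
    have h3 := (Finset.card_le_card this).trans Finset.card_le_two
    omega
  · have : T ∩ P ⊆ {s, x, s + x, y, s + y} := by
      intro w hw
      rw [Finset.mem_inter] at hw
      simp only [Finset.mem_insert, Finset.mem_singleton]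
      rcases hPmem w hw.2 with rfl | rfl | rfl | rfl | rfl | rfl | rfl | rfl
      · exact absurd hw.1 h0
      · simp
      · simp
      · simp
      · simp
      · simp
      · exact absurd hw.1 hxy
      · exact absurd hw.1 hsxy
    have h3 := (Finset.card_le_card this).trans Finset.card_le_five
    have h4 := (Finset.card_le_card hsub).trans Finset.card_le_four
    omega

end Combinatorics

end FlatTori

/-! ### Lattice bases of unit vectors with consecutive inner products `-1/2`. -/

namespace FlatTori

section PathBasis

variable {n : ℕ} {η : Fin n → E n}

lemma span_smul_sign {V : Type*} [AddCommGroup V] (b : Fin n → V) {σ : Fin n → ℤ}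
    (hσ : ∀ i, σ i = 1 ∨ σ i = -1) :
    Submodule.span ℤ (Set.range fun i => σ i • b i) = Submodule.span ℤ (Set.range b) := by
  refine le_antisymm (Submodule.span_le.2 ?_) (Submodule.span_le.2 ?_)
  · rintro _ ⟨i, rfl⟩
    exact Submodule.smul_mem _ _ (Submodule.subset_span ⟨i, rfl⟩)
  · rintro _ ⟨i, rfl⟩
    have h : b i = σ i • (σ i • b i) := by
      rcases hσ i with h | h <;> simp [h]
    rw [h]
    exact Submodule.smul_mem _ _ (Submodule.subset_span ⟨i, rfl⟩)

lemma span_comb_eq {V : Type*} [AddCommGroup V] (b : Fin n → V) {U U' : Matrix (Fin n) (Fin n) ℤ}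
    (h : U' * U = 1) :
    Submodule.span ℤ (Set.range fun i => comb b (U i)) = Submodule.span ℤ (Set.range b) := by
  refine le_antisymm (Submodule.span_le.2 ?_) (Submodule.span_le.2 ?_)
  · rintro _ ⟨i, rfl⟩
    exact comb_mem_span b _
  · rintro _ ⟨i, rfl⟩
    have e : b i = comb (fun i => comb b (U i)) (U' i) := by
      have h1 : comb (fun i => comb b (U i)) (U' i) = comb b ((U' * U) i) := by
        simp only [comb, Finset.smul_sum, smul_smul, Matrix.mul_apply, Finset.sum_smul]
        rw [Finset.sum_comm]
      rw [h1, h]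
      simp [comb, Matrix.one_apply]
    rw [e]
    exact comb_mem_span _ _

/-- A unit vector in the class of `k + l` must be one of `±(comb η k ± comb η l)` by
`eq_add_or_sub_of_congr`, and its norm gives the inner product. -/
lemma inner_eq_of_add_mem_unitClasses (hmin : ∀ k : Fin n → ℤ, k ≠ 0 → 1 ≤ ‖comb η k‖)
    {k l : Fin n → ℤ} (hk : ‖comb η k‖ = 1) (hl : ‖comb η l‖ = 1)
    (h : (fun i => ((k i : ℤ) : ZMod 2)) + (fun i => ((l i : ℤ) : ZMod 2)) ∈ unitClasses η) :
    ⟪comb η k, comb η l⟫_ℝ = -1 / 2 ∨ ⟪comb η k, comb η l⟫_ℝ = 1 / 2 := by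
  obtain ⟨m, hm, hm2⟩ := h
  obtain ⟨z, hz⟩ := exists_eq_add_two_smul (η := η) (k := m) (l := k + l) fun i => by
    simpa using hm2 i
  rw [comb_add] at hz
  rcases eq_add_or_sub_of_congr (min_of_forall_comb hmin) (comb_mem_span η k) (comb_mem_span η l)
    (comb_mem_span η z) hk hl hm hz with (h | h) | (h | h)
  · exact Or.inl (two_mul_inner_eq_of_norm_add hk hl (h ▸ hm))
  · rw [h, norm_neg] at hm
    exact Or.inl (two_mul_inner_eq_of_norm_add hk hl hm)
  · exact Or.inr (two_mul_inner_eq_of_norm_sub hk hl (h ▸ hm))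
  · rw [h, norm_neg] at hm
    exact Or.inr (two_mul_inner_eq_of_norm_sub hk hl hm)

lemma exists_sign {x : ℝ} (h : x = -1 / 2 ∨ x = 1 / 2) :
    ∃ σ : ℤ, (σ = 1 ∨ σ = -1) ∧ (σ : ℝ) * x = -1 / 2 := by
  rcases h with rfl | rfl
  · exact ⟨1, Or.inl rfl, by norm_num⟩
  · exact ⟨-1, Or.inr rfl, by norm_num⟩

/-- Representatives of independent unit classes form a lattice basis. -/
lemma exists_basis_of_unitClasses (hn : n ≤ 4)
    (hmin : ∀ k : Fin n → ℤ, k ≠ 0 → 1 ≤ ‖comb η k‖) {B : Matrix (Fin n) (Fin n) (ZMod 2)}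
    (hB : B.det ≠ 0) (hBT : ∀ i, B i ∈ unitClasses η) :
    ∃ b : Fin n → E n, Submodule.span ℤ (Set.range b) = Submodule.span ℤ (Set.range η) ∧
      (∀ i, ‖b i‖ = 1) ∧ ∀ i j, B i + B j ∈ unitClasses η →
        ⟪b i, b j⟫_ℝ = -1 / 2 ∨ ⟪b i, b j⟫_ℝ = 1 / 2 := by
  choose k hk hkB using hBT
  have hmap : (Matrix.of k).map (Int.castRingHom (ZMod 2)) = B := by
    ext i j
    exact hkB i j
  have hdet : Odd (Matrix.of k).det := by
    rw [← Int.not_even_iff_odd, even_iff_two_dvd]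
    intro h
    apply hB
    have h1 := RingHom.map_det (Int.castRingHom (ZMod 2)) (Matrix.of k)
    rw [RingHom.mapMatrix_apply, hmap] at h1
    rw [← h1]
    exact (ZMod.intCast_zmod_eq_zero_iff_dvd _ 2).2 (by exact_mod_cast h)
  refine ⟨fun i => comb η (k i), span_eq_of_odd_det (min_of_forall_comb hmin) hn rfl
    (Matrix.of k) hdet hk, hk, fun i j hij => ?_⟩
  refine inner_eq_of_add_mem_unitClasses hmin (hk i) (hk j) ?_
  have : ∀ i, (fun j => ((k i j : ℤ) : ZMod 2)) = B i := fun i => funext fun j => hkB i j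
  rwa [this, this]

lemma inner_smul_smul_int (s t : ℤ) (x y : E n) :
    ⟪s • x, t • y⟫_ℝ = s * t * ⟪x, y⟫_ℝ := by
  rw [← Int.cast_smul_eq_zsmul ℝ, ← Int.cast_smul_eq_zsmul ℝ, real_inner_smul_left,
    real_inner_smul_right, mul_assoc]

lemma norm_sign_smul {s : ℤ} (hs : s = 1 ∨ s = -1) (x : E n) : ‖s • x‖ = ‖x‖ := by
  rcases hs with rfl | rfl <;> simp

theorem exists_path_basis_three {η : Fin 3 → E 3} {Q : Matrix (Fin 3) (Fin 3) ℝ}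
    (hQ : Q ∈ vertices 3) (hη : Matrix.gram ℝ η = Q) :
    ∃ b : Fin 3 → E 3, Submodule.span ℤ (Set.range b) = Submodule.span ℤ (Set.range η) ∧
      (∀ i, ‖b i‖ = 1) ∧ ⟪b 0, b 1⟫_ℝ = -1 / 2 ∧ ⟪b 1, b 2⟫_ℝ = -1 / 2 := by
  classical
  have hmem := extremePoints_subset hQ
  rw [← hη, gram_mem_Omega2_iff] at hmem
  obtain ⟨-, -, hmin⟩ := hmem
  have hcard := card_unitClasses hQ hη
  rw [Set.ncard_eq_toFinset_card'] at hcard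
  obtain ⟨B, hB, hBT, h01, h12⟩ := exists_path_three (T := (unitClasses η).toFinset)
    (by simpa using zero_notMem_unitClasses hmin) hcard
  simp only [Set.mem_toFinset] at hBT h01 h12
  obtain ⟨b, hb, hb1, hbb⟩ := exists_basis_of_unitClasses (by norm_num) hmin hB hBT
  obtain ⟨s, hs, hs'⟩ := exists_sign (hbb 0 1 h01)
  obtain ⟨t, ht, ht'⟩ := exists_sign (hbb 1 2 h12)
  -- Cumulative products of the signs: consecutive entries multiply to `s` and then to `t`.
  have hσ : ∀ i, (![1, s, s * t] : Fin 3 → ℤ) i = 1 ∨ (![1, s, s * t] : Fin 3 → ℤ) i = -1 := by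
    intro i
    rcases hs with rfl | rfl <;> rcases ht with rfl | rfl <;> fin_cases i <;> simp
  refine ⟨fun i => (![1, s, s * t] : Fin 3 → ℤ) i • b i, (span_smul_sign b hσ).trans hb,
    fun i => by rw [norm_sign_smul (hσ i), hb1], ?_, ?_⟩
  · rw [inner_smul_smul_int]
    simpa using hs'
  · rw [inner_smul_smul_int, ← ht']
    rcases hs with rfl | rfl <;> simp

theorem exists_path_basis_four {η : Fin 4 → E 4} {Q : Matrix (Fin 4) (Fin 4) ℝ}
    (hQ : Q ∈ vertices 4) (hη : Matrix.gram ℝ η = Q) :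
    ∃ b : Fin 4 → E 4, Submodule.span ℤ (Set.range b) = Submodule.span ℤ (Set.range η) ∧
      (∀ i, ‖b i‖ = 1) ∧ ⟪b 0, b 1⟫_ℝ = -1 / 2 ∧ ⟪b 1, b 2⟫_ℝ = -1 / 2 ∧
      ⟪b 2, b 3⟫_ℝ = -1 / 2 := by
  classical
  have hmem := extremePoints_subset hQ
  rw [← hη, gram_mem_Omega2_iff] at hmem
  obtain ⟨-, -, hmin⟩ := hmem
  have hcard := card_unitClasses hQ hη
  rw [Set.ncard_eq_toFinset_card'] at hcard
  obtain ⟨B, hB, hBT, h01, h12, h23⟩ := exists_path_four (T := (unitClasses η).toFinset)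
    (by simpa using zero_notMem_unitClasses hmin) hcard
  simp only [Set.mem_toFinset] at hBT h01 h12 h23
  obtain ⟨b, hb, hb1, hbb⟩ := exists_basis_of_unitClasses le_rfl hmin hB hBT
  obtain ⟨s, hs, hs'⟩ := exists_sign (hbb 0 1 h01)
  obtain ⟨t, ht, ht'⟩ := exists_sign (hbb 1 2 h12)
  obtain ⟨r, hr, hr'⟩ := exists_sign (hbb 2 3 h23)
  have hσ : ∀ i, (![1, s, s * t, s * t * r] : Fin 4 → ℤ) i = 1 ∨
      (![1, s, s * t, s * t * r] : Fin 4 → ℤ) i = -1 := by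
    intro i
    rcases hs with rfl | rfl <;> rcases ht with rfl | rfl <;> rcases hr with rfl | rfl <;>
      fin_cases i <;> simp
  refine ⟨fun i => (![1, s, s * t, s * t * r] : Fin 4 → ℤ) i • b i,
    (span_smul_sign b hσ).trans hb, fun i => by rw [norm_sign_smul (hσ i), hb1], ?_, ?_, ?_⟩
  · rw [inner_smul_smul_int]
    simpa using hs'
  · rw [inner_smul_smul_int, ← ht']
    rcases hs with rfl | rfl <;> simp
  · rw [inner_smul_smul_int, ← hr']
    rcases hs with rfl | rfl <;> rcases ht with rfl | rfl <;> simp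

end PathBasis

end FlatTori

/-! ### Perfection expressed in a path basis. -/

namespace FlatTori

section Pinned

variable {n : ℕ} {η b : Fin n → E n}

lemma linearIndependent_of_span_eq (hη : LinearIndependent ℝ η)
    (h : Submodule.span ℤ (Set.range b) = Submodule.span ℤ (Set.range η)) :
    LinearIndependent ℝ b := by
  refine linearIndependent_of_top_le_span_of_card_eq_finrank ?_ (by simp)
  rw [← span_eq_top_of_linearIndependent hη, Submodule.span_le]
  rintro _ ⟨i, rfl⟩
  have h1 : η i ∈ Submodule.span ℤ (Set.range b) := h ▸ Submodule.subset_span ⟨i, rfl⟩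
  exact Submodule.span_le_restrictScalars ℤ ℝ _ h1

lemma form_self_eq_zero_of_congr {V : Type*} [NormedAddCommGroup V] [InnerProductSpace ℝ V]
    {L : Submodule ℤ V} (hL : ∀ x ∈ L, x ≠ 0 → 1 ≤ ‖x‖) {F : LinearMap.BilinForm ℝ V}
    {s u z : V} (hs : ‖s‖ = 1) (hu : u ∈ L) (hu1 : ‖u‖ = 1)
    (hz : z ∈ L) (h : s = u + (2 : ℤ) • z) (hFu : F u u = 0) : F s s = 0 := by
  rcases eq_or_eq_neg_of_congr hL hu hz hs hu1 h with rfl | rfl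
  · exact hFu
  · simpa using hFu

/-- The unit vector `s` is one of `±(u ± w)`, so its existence forces `|⟪u, w⟫| = 1 / 2`. The value
of `F u w` therefore matters only in that case. -/
lemma form_self_eq_zero_of_congr_add {V : Type*} [NormedAddCommGroup V] [InnerProductSpace ℝ V]
    {L : Submodule ℤ V} (hL : ∀ x ∈ L, x ≠ 0 → 1 ≤ ‖x‖) {F : LinearMap.BilinForm ℝ V}
    (hF : ∀ x y, F x y = F y x) {s u w z : V} (hs : ‖s‖ = 1) (hu : u ∈ L) (hu1 : ‖u‖ = 1)
    (hw : w ∈ L) (hw1 : ‖w‖ = 1) (hz : z ∈ L) (h : s = u + w + (2 : ℤ) • z) (hFu : F u u = 0)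
    (hFw : F w w = 0) (hFuw : |⟪u, w⟫_ℝ| = 1 / 2 → F u w = 0) : F s s = 0 := by
  have hn : |(-1 / 2 : ℝ)| = 1 / 2 := by norm_num [abs_of_neg]
  have hp : |(1 / 2 : ℝ)| = 1 / 2 := by norm_num
  rcases eq_add_or_sub_of_congr hL hu hw hz hu1 hw1 hs h with (rfl | rfl) | (rfl | rfl)
  · have := hFuw (by rw [two_mul_inner_eq_of_norm_add hu1 hw1 hs, hn])
    simp [hFu, hFw, this, hF w u]
  · rw [norm_neg] at hs
    have := hFuw (by rw [two_mul_inner_eq_of_norm_add hu1 hw1 hs, hn])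
    simp [hFu, hFw, this, hF w u]
  · have := hFuw (by rw [two_mul_inner_eq_of_norm_sub hu1 hw1 hs, hp])
    simp [hFu, hFw, this, hF w u]
  · rw [norm_neg] at hs
    have := hFuw (by rw [two_mul_inner_eq_of_norm_sub hu1 hw1 hs, hp])
    simp [hFu, hFw, this, hF w u]

/-- Perfection of the lattice of a vertex, in coordinates of an arbitrary lattice basis. -/
lemma matrix_eq_zero_of_mem_vertices {Q : Matrix (Fin n) (Fin n) ℝ} (hQ : Q ∈ vertices n)
    (hη : Matrix.gram ℝ η = Q)
    (hspan : Submodule.span ℤ (Set.range b) = Submodule.span ℤ (Set.range η))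
    (M : Matrix (Fin n) (Fin n) ℝ) (hM : M.IsSymm)
    (h : ∀ F : LinearMap.BilinForm ℝ (E n), (∀ x y, F x y = F y x) →
      (∀ i j, F (b i) (b j) = M i j) → ∀ (ρ : Fin n → Bool), ∀ s, ‖s‖ = 1 →
      ∀ z ∈ Submodule.span ℤ (Set.range b), s = ∑ i, (if ρ i then b i else 0) + (2 : ℤ) • z →
      F s s = 0) : M = 0 := by
  have hmem := extremePoints_subset hQ
  rw [← hη, gram_mem_Omega2_iff] at hmem
  have hli := linearIndependent_of_span_eq hmem.1 hspan
  let F := Matrix.toBilin (basisOf hli) M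
  have hFb : ∀ i j, F (b i) (b j) = M i j := by
    intro i j
    have h1 := LinearMap.BilinForm.toMatrix_apply (basisOf hli) F i j
    rw [LinearMap.BilinForm.toMatrix_toBilin, coe_basisOf] at h1
    exact h1.symm
  have hFs : ∀ x y, F x y = F y x := by
    have : F = F.flip := by
      refine (basisOf hli).ext fun i => (basisOf hli).ext fun j => ?_
      rw [coe_basisOf]
      change F (b i) (b j) = F (b j) (b i)
      rw [hFb, hFb]
      exact hM.apply j i
    intro x y
    exact LinearMap.congr_fun (LinearMap.congr_fun this x) y
  have hF0 : F = 0 := by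
    refine eq_zero_of_mem_vertices hQ hη F hFs fun s hs hs1 => ?_
    rw [← hspan, mem_span_iff_exists_comb] at hs
    obtain ⟨k, rfl⟩ := hs
    -- `ρ` records the parities of the coordinates of the unit vector, so checking `F` reduces to
    -- one test per class modulo `2`.
    refine h F hFs hFb (fun i => decide (k i % 2 = 1)) _ hs1 (comb b fun i => k i / 2)
      (comb_mem_span b _) ?_
    simp only [comb, Finset.smul_sum, smul_smul, ← Finset.sum_add_distrib, decide_eq_true_eq]
    refine Finset.sum_congr rfl fun i _ => ?_
    rcases Int.emod_two_eq_zero_or_one (k i) with h | h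
    · rw [if_neg (by omega), zero_add]
      congr 1
      omega
    · rw [if_pos h]
      nth_rewrite 2 [← one_smul ℤ (b i)]
      rw [← add_smul]
      congr 1
      omega
  ext i j
  rw [← hFb, hF0]
  rfl

lemma norm_add_eq_one {V : Type*} [NormedAddCommGroup V] [InnerProductSpace ℝ V] {x y : V}
    (hx : ‖x‖ = 1) (hy : ‖y‖ = 1) (h : ⟪x, y⟫_ℝ = -1 / 2) : ‖x + y‖ = 1 := by
  have e := norm_add_sq_real x y
  rw [hx, hy, h] at e
  rw [← pow_eq_one_iff_of_nonneg (norm_nonneg _) two_ne_zero, e]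
  norm_num

lemma two_smul_ne_unit {V : Type*} [NormedAddCommGroup V] [InnerProductSpace ℝ V]
    {L : Submodule ℤ V} (hL : ∀ x ∈ L, x ≠ 0 → 1 ≤ ‖x‖) {z : V} (hz : z ∈ L) :
    ‖(2 : ℤ) • z‖ ≠ 1 := by
  intro h
  rw [two_smul, ← two_smul ℝ, norm_smul, Real.norm_ofNat] at h
  by_cases hz0 : z = 0
  · simp [hz0] at h
  · have := hL z hz hz0
    linarith

/-- Otherwise the class of `η 0 + η 1` contains no unit vector, and the form with matrix `!![0, 1;
1, 0]` violates perfection. -/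
theorem abs_inner_eq_of_mem_vertices_two {η : Fin 2 → E 2} {Q : Matrix (Fin 2) (Fin 2) ℝ}
    (hQ : Q ∈ vertices 2) (hη : Matrix.gram ℝ η = Q) :
    |⟪η 0, η 1⟫_ℝ| = 1 / 2 := by
  by_contra hne
  have hmem := extremePoints_subset hQ
  rw [← hη, gram_mem_Omega2_iff] at hmem
  obtain ⟨-, hb1, hmin⟩ := hmem
  have hL := min_of_forall_comb hmin
  have hb : ∀ i, η i ∈ Submodule.span ℤ (Set.range η) := fun i => Submodule.subset_span ⟨i, rfl⟩
  have h0 := matrix_eq_zero_of_mem_vertices hQ hη rfl !![0, 1; 1, 0]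
    (by ext i j; fin_cases i <;> fin_cases j <;> rfl) ?_
  · have := congrFun (congrFun h0 0) 1
    simp at this
  intro F hF hFb ρ s hs z hz h
  have f0 : F (η 0) (η 0) = 0 := hFb 0 0
  have f1 : F (η 1) (η 1) = 0 := hFb 1 1
  rw [Fin.sum_univ_two] at h
  rcases h0 : ρ 0 <;> rcases h1 : ρ 1 <;>
    simp only [h0, h1, Bool.false_eq_true, if_true, if_false, zero_add, add_zero] at h
  · exact absurd (h ▸ hs) (two_smul_ne_unit hL hz)
  · exact form_self_eq_zero_of_congr hL hs (hb 1) (hb1 1) hz h f1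
  · exact form_self_eq_zero_of_congr hL hs (hb 0) (hb1 0) hz h f0
  · exact form_self_eq_zero_of_congr_add hL hF hs (hb 0) (hb1 0) (hb 1) (hb1 1) hz h f0 f1
      fun h => absurd h hne

/-- The test form pairs only `b 0` with `b 2`. It vanishes on all classes except those of `b 0 + b
2` and `(b 0 + b 1) + b 2`; the two alternatives are the conditions for one of these to contain a
unit vector. -/
theorem pinned_three {η b : Fin 3 → E 3} {Q : Matrix (Fin 3) (Fin 3) ℝ}
    (hQ : Q ∈ vertices 3) (hη : Matrix.gram ℝ η = Q)
    (hspan : Submodule.span ℤ (Set.range b) = Submodule.span ℤ (Set.range η))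
    (hb1 : ∀ i, ‖b i‖ = 1) (h01 : ⟪b 0, b 1⟫_ℝ = -1 / 2) (h12 : ⟪b 1, b 2⟫_ℝ = -1 / 2) :
    |⟪b 0, b 2⟫_ℝ| = 1 / 2 ∨ |⟪b 0, b 2⟫_ℝ - 1 / 2| = 1 / 2 := by
  by_contra! hne
  have hmem := extremePoints_subset hQ
  rw [← hη, gram_mem_Omega2_iff] at hmem
  have hL := min_of_forall_comb hmem.2.2
  rw [← hspan] at hL
  have hb : ∀ i, b i ∈ Submodule.span ℤ (Set.range b) := fun i => Submodule.subset_span ⟨i, rfl⟩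
  have h0 := matrix_eq_zero_of_mem_vertices hQ hη hspan !![0, 0, 1; 0, 0, 0; 1, 0, 0]
    (by ext i j; fin_cases i <;> fin_cases j <;> rfl) ?_
  · have := congrFun (congrFun h0 0) 2
    simp at this
  intro F hF hFb ρ s hs z hz h
  have f00 : F (b 0) (b 0) = 0 := hFb 0 0
  have f11 : F (b 1) (b 1) = 0 := hFb 1 1
  have f22 : F (b 2) (b 2) = 0 := hFb 2 2
  have f01 : F (b 0) (b 1) = 0 := hFb 0 1
  have f10 : F (b 1) (b 0) = 0 := hFb 1 0
  have f12 : F (b 1) (b 2) = 0 := hFb 1 2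
  have n01 := norm_add_eq_one (hb1 0) (hb1 1) h01
  have f01' : F (b 0 + b 1) (b 0 + b 1) = 0 := by simp [f00, f11, f01, f10]
  rw [Fin.sum_univ_three] at h
  rcases h0 : ρ 0 <;> rcases h1 : ρ 1 <;> rcases h2 : ρ 2 <;>
    simp only [h0, h1, h2, Bool.false_eq_true, if_true, if_false, zero_add, add_zero] at h
  · exact absurd (h ▸ hs) (two_smul_ne_unit hL hz)
  · exact form_self_eq_zero_of_congr hL hs (hb 2) (hb1 2) hz h f22
  · exact form_self_eq_zero_of_congr hL hs (hb 1) (hb1 1) hz h f11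
  · exact form_self_eq_zero_of_congr_add hL hF hs (hb 1) (hb1 1) (hb 2) (hb1 2) hz h f11 f22
      fun _ => f12
  · exact form_self_eq_zero_of_congr hL hs (hb 0) (hb1 0) hz h f00
  · exact form_self_eq_zero_of_congr_add hL hF hs (hb 0) (hb1 0) (hb 2) (hb1 2) hz h f00 f22
      fun h => absurd h hne.1
  · exact form_self_eq_zero_of_congr_add hL hF hs (hb 0) (hb1 0) (hb 1) (hb1 1) hz h f00 f11
      fun _ => f01
  · refine form_self_eq_zero_of_congr_add hL hF hs (Submodule.add_mem _ (hb 0) (hb 1)) n01 (hb 2)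
      (hb1 2) hz h f01' f22 fun h => absurd ?_ hne.2
    rw [inner_add_left, h12] at h
    have e : ⟪b 0, b 2⟫_ℝ - 1 / 2 = ⟪b 0, b 2⟫_ℝ + -1 / 2 := by ring
    rw [e]
    exact h

/-- Read `(α, β, γ)` as a direction of variation of `(p, q, r)`. Each hypothesis says that the
direction is tangent to a constraint that is active because some class contains a unit vector;
perfection says that only the zero direction is tangent to all of them. -/
theorem pinned_four {η b : Fin 4 → E 4} {Q : Matrix (Fin 4) (Fin 4) ℝ}
    (hQ : Q ∈ vertices 4) (hη : Matrix.gram ℝ η = Q)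
    (hspan : Submodule.span ℤ (Set.range b) = Submodule.span ℤ (Set.range η))
    (hb1 : ∀ i, ‖b i‖ = 1) (h01 : ⟪b 0, b 1⟫_ℝ = -1 / 2) (h12 : ⟪b 1, b 2⟫_ℝ = -1 / 2)
    (h23 : ⟪b 2, b 3⟫_ℝ = -1 / 2) {p q r : ℝ} (hp : ⟪b 0, b 2⟫_ℝ = p) (hq : ⟪b 1, b 3⟫_ℝ = q)
    (hr : ⟪b 0, b 3⟫_ℝ = r) (α β γ : ℝ)
    (hα : |p| = 1 / 2 ∨ |p - 1 / 2| = 1 / 2 → α = 0)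
    (hβ : |q| = 1 / 2 ∨ |q - 1 / 2| = 1 / 2 → β = 0) (hγ : |r| = 1 / 2 → γ = 0)
    (hβγ : |q + r| = 1 / 2 → β + γ = 0) (hαγ : |p + r| = 1 / 2 → α + γ = 0)
    (hαβγ : |p + q + r - 1 / 2| = 1 / 2 → α + β + γ = 0) : α = 0 ∧ β = 0 ∧ γ = 0 := by
  have hmem := extremePoints_subset hQ
  rw [← hη, gram_mem_Omega2_iff] at hmem
  have hL := min_of_forall_comb hmem.2.2
  rw [← hspan] at hL
  have hb : ∀ i, b i ∈ Submodule.span ℤ (Set.range b) := fun i => Submodule.subset_span ⟨i, rfl⟩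
  have h0 := matrix_eq_zero_of_mem_vertices hQ hη hspan
    !![0, 0, α, γ; 0, 0, 0, β; α, 0, 0, 0; γ, β, 0, 0]
    (by ext i j; fin_cases i <;> fin_cases j <;> rfl) ?_
  · have e1 := congrFun (congrFun h0 0) 2
    have e2 := congrFun (congrFun h0 1) 3
    have e3 := congrFun (congrFun h0 0) 3
    simp at e1 e2 e3
    exact ⟨e1, e2, e3⟩
  intro F hF hFb ρ s hs z hz h
  have f00 : F (b 0) (b 0) = 0 := hFb 0 0
  have f11 : F (b 1) (b 1) = 0 := hFb 1 1
  have f22 : F (b 2) (b 2) = 0 := hFb 2 2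
  have f33 : F (b 3) (b 3) = 0 := hFb 3 3
  have f01 : F (b 0) (b 1) = 0 := hFb 0 1
  have f10 : F (b 1) (b 0) = 0 := hFb 1 0
  have f12 : F (b 1) (b 2) = 0 := hFb 1 2
  have f21 : F (b 2) (b 1) = 0 := hFb 2 1
  have f23 : F (b 2) (b 3) = 0 := hFb 2 3
  have f32 : F (b 3) (b 2) = 0 := hFb 3 2
  have f02 : F (b 0) (b 2) = α := hFb 0 2
  have f13 : F (b 1) (b 3) = β := hFb 1 3
  have f03 : F (b 0) (b 3) = γ := hFb 0 3
  have n01 := norm_add_eq_one (hb1 0) (hb1 1) h01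
  have n12 := norm_add_eq_one (hb1 1) (hb1 2) h12
  have n23 := norm_add_eq_one (hb1 2) (hb1 3) h23
  have f01' : F (b 0 + b 1) (b 0 + b 1) = 0 := by simp [f00, f11, f01, f10]
  have f12' : F (b 1 + b 2) (b 1 + b 2) = 0 := by simp [f11, f22, f12, f21]
  have f23' : F (b 2 + b 3) (b 2 + b 3) = 0 := by simp [f22, f33, f23, f32]
  have hb01 := Submodule.add_mem _ (hb 0) (hb 1)
  have hb12 := Submodule.add_mem _ (hb 1) (hb 2)
  have hb23 := Submodule.add_mem _ (hb 2) (hb 3)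
  rw [Fin.sum_univ_four] at h
  rcases h0 : ρ 0 <;> rcases h1 : ρ 1 <;> rcases h2 : ρ 2 <;> rcases h3 : ρ 3 <;>
    simp only [h0, h1, h2, h3, Bool.false_eq_true, if_true, if_false, zero_add, add_zero] at h
  · exact absurd (h ▸ hs) (two_smul_ne_unit hL hz)
  · exact form_self_eq_zero_of_congr hL hs (hb 3) (hb1 3) hz h f33
  · exact form_self_eq_zero_of_congr hL hs (hb 2) (hb1 2) hz h f22
  · exact form_self_eq_zero_of_congr_add hL hF hs (hb 2) (hb1 2) (hb 3) (hb1 3) hz h f22 f33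
      fun _ => f23
  · exact form_self_eq_zero_of_congr hL hs (hb 1) (hb1 1) hz h f11
  · refine form_self_eq_zero_of_congr_add hL hF hs (hb 1) (hb1 1) (hb 3) (hb1 3) hz h f11 f33
      fun h => ?_
    rw [hq] at h
    rw [f13, hβ (Or.inl h)]
  · exact form_self_eq_zero_of_congr_add hL hF hs (hb 1) (hb1 1) (hb 2) (hb1 2) hz h f11 f22
      fun _ => f12
  · refine form_self_eq_zero_of_congr_add hL hF hs hb12 n12 (hb 3) (hb1 3) hz h f12' f33
      fun h => ?_
    rw [inner_add_left, hq, h23, neg_div, ← sub_eq_add_neg] at h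
    rw [map_add, LinearMap.add_apply, f13, f23, add_zero, hβ (Or.inr h)]
  · exact form_self_eq_zero_of_congr hL hs (hb 0) (hb1 0) hz h f00
  · refine form_self_eq_zero_of_congr_add hL hF hs (hb 0) (hb1 0) (hb 3) (hb1 3) hz h f00 f33
      fun h => ?_
    rw [hr] at h
    rw [f03, hγ h]
  · refine form_self_eq_zero_of_congr_add hL hF hs (hb 0) (hb1 0) (hb 2) (hb1 2) hz h f00 f22
      fun h => ?_
    rw [hp] at h
    rw [f02, hα (Or.inl h)]
  · rw [add_assoc (b 0)] at h
    refine form_self_eq_zero_of_congr_add hL hF hs (hb 0) (hb1 0) hb23 n23 hz h f00 f23'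
      fun h => ?_
    rw [inner_add_right, hp, hr] at h
    rw [map_add, f02, f03, hαγ h]
  · exact form_self_eq_zero_of_congr_add hL hF hs (hb 0) (hb1 0) (hb 1) (hb1 1) hz h f00 f11
      fun _ => f01
  · refine form_self_eq_zero_of_congr_add hL hF hs hb01 n01 (hb 3) (hb1 3) hz h f01' f33
      fun h => ?_
    rw [inner_add_left, hr, hq, add_comm] at h
    rw [map_add, LinearMap.add_apply, f03, f13, add_comm, hβγ h]
  · refine form_self_eq_zero_of_congr_add hL hF hs hb01 n01 (hb 2) (hb1 2) hz h f01' f22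
      fun h => ?_
    rw [inner_add_left, hp, h12, neg_div, ← sub_eq_add_neg] at h
    rw [map_add, LinearMap.add_apply, f02, f12, add_zero, hα (Or.inr h)]
  · rw [add_assoc (b 0 + b 1)] at h
    refine form_self_eq_zero_of_congr_add hL hF hs hb01 n01 hb23 n23 hz h f01' f23'
      fun h => ?_
    simp only [inner_add_left, inner_add_right, hp, hr, h12, hq] at h
    simp only [map_add, LinearMap.add_apply, f02, f03, f12, f13]
    have e : p + q + r - 1 / 2 = p + -1 / 2 + (r + q) := by ring
    have := hαβγ (by rw [e]; exact h)
    linarith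

end Pinned

end FlatTori

/-! ### Half-integral Gram matrices and the polytope of path bases. -/

namespace FlatTori

section HalfIntegral

variable {n : ℕ} {η : Fin n → E n}

/-- The real matrix `Z / 2`. -/
noncomputable def halfMatrix (Z : Matrix (Fin n) (Fin n) ℤ) : Matrix (Fin n) (Fin n) ℝ :=
  Matrix.of fun i j => (Z i j : ℝ) / 2

lemma halfMatrix_apply (Z : Matrix (Fin n) (Fin n) ℤ) (i j : Fin n) :
    halfMatrix Z i j = (Z i j : ℝ) / 2 := rfl

lemma inner_comb_comb_of_gram_eq {Z : Matrix (Fin n) (Fin n) ℤ}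
    (h : Matrix.gram ℝ η = halfMatrix Z) (k l : Fin n → ℤ) :
    ⟪comb η k, comb η l⟫_ℝ = ((k ⬝ᵥ Z.mulVec l : ℤ) : ℝ) / 2 := by
  have hij : ∀ i j, ⟪η i, η j⟫_ℝ = (Z i j : ℝ) / 2 := fun i j => by
    rw [← halfMatrix_apply, ← h, Matrix.gram_apply]
  simp only [comb, sum_inner, inner_sum, inner_smul_smul_int, hij, dotProduct, Matrix.mulVec,
    Int.cast_sum, Int.cast_mul, Finset.mul_sum, Finset.sum_div]
  rw [Finset.sum_comm]
  refine Finset.sum_congr rfl fun i _ => Finset.sum_congr rfl fun j _ => ?_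
  ring

lemma gram_comb {Z : Matrix (Fin n) (Fin n) ℤ} (h : Matrix.gram ℝ η = halfMatrix Z)
    (U : Matrix (Fin n) (Fin n) ℤ) :
    Matrix.gram ℝ (fun i => comb η (U i)) = halfMatrix (U * Z * U.transpose) := by
  ext i j
  rw [Matrix.gram_apply, inner_comb_comb_of_gram_eq h, halfMatrix_apply]
  congr 2
  rw [Matrix.mul_assoc, Matrix.mul_apply]
  rfl

lemma exists_of_gram_eq {Z Z' : Matrix (Fin n) (Fin n) ℤ} {b : Fin n → E n}
    (hb : Submodule.span ℤ (Set.range b) = Submodule.span ℤ (Set.range η))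
    (h : Matrix.gram ℝ b = halfMatrix Z) (U U' : Matrix (Fin n) (Fin n) ℤ) (hU : U' * U = 1)
    (hZ : U * Z * U.transpose = Z') :
    ∃ b' : Fin n → E n, Submodule.span ℤ (Set.range b') = Submodule.span ℤ (Set.range η) ∧
      Matrix.gram ℝ b' = halfMatrix Z' :=
  ⟨fun i => comb b (U i), (span_comb_eq b hU).trans hb, by rw [gram_comb h, hZ]⟩

end HalfIntegral

section Cases

/-- For `0 < p < 1/2` a direction with `α = 1` tangent to every active constraint exists: `(1, 1,
-1)`, `(1, 0, -1)`, `(1, -1, 0)` or `(1, 0, 0)`, according to which of `p + r = 1/2`, `q + r = 1/2`,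
`p + q + r = 0`, `r = -1/2` hold. -/
lemma eq_or_eq_of_pinned {p q r : ℝ} (hp0 : 0 ≤ p) (hp1 : p ≤ 1 / 2) (hq0 : 0 ≤ q)
    (hq1 : q ≤ 1 / 2) (hr0 : -1 / 2 ≤ r) (hpqr : 0 ≤ p + q + r)
    (hqr : q + r ≤ 1 / 2) (hpr : p + r ≤ 1 / 2)
    (h : ∀ α β γ : ℝ, (|p| = 1 / 2 ∨ |p - 1 / 2| = 1 / 2 → α = 0) →
      (|q| = 1 / 2 ∨ |q - 1 / 2| = 1 / 2 → β = 0) → (|r| = 1 / 2 → γ = 0) →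
      (|q + r| = 1 / 2 → β + γ = 0) → (|p + r| = 1 / 2 → α + γ = 0) →
      (|p + q + r - 1 / 2| = 1 / 2 → α + β + γ = 0) → α = 0 ∧ β = 0 ∧ γ = 0) :
    p = 0 ∨ p = 1 / 2 := by
  by_contra! hp
  have hp0' : 0 < p := lt_of_le_of_ne hp0 (Ne.symm hp.1)
  have hp1' : p < 1 / 2 := lt_of_le_of_ne hp1 hp.2
  have abs_half : ∀ {x : ℝ}, |x| = 1 / 2 → x = 1 / 2 ∨ x = -(1 / 2) := fun h =>
    (abs_eq (by norm_num)).1 h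
  have nA : ¬(|p| = 1 / 2 ∨ |p - 1 / 2| = 1 / 2) := by
    rintro (h | h) <;> rcases abs_half h with h | h <;> linarith
  have hABG : |p + q + r - 1 / 2| = 1 / 2 → p + q + r = 0 := by
    intro h
    rcases abs_half h with h | h <;> linarith
  have hAG : |p + r| = 1 / 2 → p + r = 1 / 2 := by
    intro h
    rcases abs_half h with h | h <;> linarith
  by_cases h1 : p + r = 1 / 2
  · have nABG : |p + q + r - 1 / 2| ≠ 1 / 2 := fun h => by linarith [hABG h]
    have nG : |r| ≠ 1 / 2 := fun h => by rcases abs_half h with h | h <;> linarith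
    by_cases h2 : |q + r| = 1 / 2
    · have h3 : q + r = 1 / 2 := by rcases abs_half h2 with h | h <;> linarith
      have nB : ¬(|q| = 1 / 2 ∨ |q - 1 / 2| = 1 / 2) := by
        rintro (h | h) <;> rcases abs_half h with h | h <;> linarith
      have := (h 1 1 (-1) (fun h => absurd h nA) (fun h => absurd h nB) (fun h => absurd h nG)
        (by norm_num) (by norm_num) (fun h => absurd h nABG)).1
      norm_num at this
    · have := (h 1 0 (-1) (fun h => absurd h nA) (by simp) (fun h => absurd h nG)
        (fun h => absurd h h2) (by norm_num) (fun h => absurd h nABG)).1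
      norm_num at this
  · have nAG : |p + r| ≠ 1 / 2 := fun h => h1 (hAG h)
    by_cases h2 : p + q + r = 0
    · by_cases h3 : |r| = 1 / 2
      · have h4 : r = -(1 / 2) := by rcases abs_half h3 with h | h <;> linarith
        have nB : ¬(|q| = 1 / 2 ∨ |q - 1 / 2| = 1 / 2) := by
          rintro (h | h) <;> rcases abs_half h with h | h <;> linarith
        have nBG : |q + r| ≠ 1 / 2 := fun h => by rcases abs_half h with h | h <;> linarith
        have := (h 1 (-1) 0 (fun h => absurd h nA) (fun h => absurd h nB) (by simp)
          (fun h => absurd h nBG) (fun h => absurd h nAG) (by norm_num)).1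
        norm_num at this
      · have nBG : |q + r| ≠ 1 / 2 := fun h => by rcases abs_half h with h | h <;> linarith
        have := (h 1 0 (-1) (fun h => absurd h nA) (by simp) (fun h => absurd h h3)
          (fun h => absurd h nBG) (fun h => absurd h nAG) (by norm_num)).1
        norm_num at this
    · have := (h 1 0 0 (fun h => absurd h nA) (by simp) (by simp) (by simp)
        (fun h => absurd h nAG) (fun h => absurd (hABG h) h2)).1
      norm_num at this

/-- The vertices of the polytope of Gram matrices of path bases. -/
lemma cases_of_pinned {p q r : ℝ} (hp0 : 0 ≤ p) (hp1 : p ≤ 1 / 2) (hq0 : 0 ≤ q)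
    (hq1 : q ≤ 1 / 2) (hr0 : -1 / 2 ≤ r) (hr1 : r ≤ 1 / 2) (hpqr : 0 ≤ p + q + r)
    (hqr : q + r ≤ 1 / 2) (hpr : p + r ≤ 1 / 2)
    (h : ∀ α β γ : ℝ, (|p| = 1 / 2 ∨ |p - 1 / 2| = 1 / 2 → α = 0) →
      (|q| = 1 / 2 ∨ |q - 1 / 2| = 1 / 2 → β = 0) → (|r| = 1 / 2 → γ = 0) →
      (|q + r| = 1 / 2 → β + γ = 0) → (|p + r| = 1 / 2 → α + γ = 0) →
      (|p + q + r - 1 / 2| = 1 / 2 → α + β + γ = 0) → α = 0 ∧ β = 0 ∧ γ = 0) :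
    ∃ a b c : ℤ, p = a / 2 ∧ q = b / 2 ∧ r = c / 2 ∧
      (a, b, c) ∈ ({(0, 0, 0), (0, 0, 1), (1, 0, -1), (1, 0, 0), (0, 1, -1), (0, 1, 0),
        (1, 1, -1), (1, 1, 0)} : Finset (ℤ × ℤ × ℤ)) := by
  have hp := eq_or_eq_of_pinned hp0 hp1 hq0 hq1 hr0 hpqr hqr hpr h
  -- Reversing the path exchanges `p` and `q`.
  have hq := eq_or_eq_of_pinned hq0 hq1 hp0 hp1 hr0 (by linarith) hpr hqr
    fun α β γ h1 h2 h3 h4 h5 h6 => by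
      obtain ⟨e1, e2, e3⟩ := h β α γ h2 h1 h3 h5 h4 fun h => by
        rw [add_comm β α]
        exact h6 (by rw [add_comm q p]; exact h)
      exact ⟨e2, e1, e3⟩
  have abs_half : ∀ {x : ℝ}, |x| = 1 / 2 → x = 1 / 2 ∨ x = -(1 / 2) := fun h =>
    (abs_eq (by norm_num)).1 h
  have hr : r = 0 ∨ r = 1 / 2 ∨ r = -(1 / 2) := by
    by_contra! hr
    have n1 : |r| ≠ 1 / 2 := fun h => by rcases abs_half h with h | h <;> tauto
    have n2 : |q + r| ≠ 1 / 2 := fun h => by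
      rcases hq with hq | hq <;> rcases abs_half h with h | h
      · exact hr.2.1 (by linarith)
      · exact hr.2.2 (by linarith)
      · exact hr.1 (by linarith)
      · linarith
    have n3 : |p + r| ≠ 1 / 2 := fun h => by
      rcases hp with hp | hp <;> rcases abs_half h with h | h
      · exact hr.2.1 (by linarith)
      · exact hr.2.2 (by linarith)
      · exact hr.1 (by linarith)
      · linarith
    have n4 : |p + q + r - 1 / 2| ≠ 1 / 2 := fun h => by
      rcases abs_half h with h | h
      · exact hr.1 (by linarith)
      · rcases hp with hp | hp <;> rcases hq with hq | hq
        · exact hr.1 (by linarith)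
        · exact hr.2.2 (by linarith)
        · exact hr.2.2 (by linarith)
        · linarith
    have := (h 0 0 1 (by simp) (by simp) (fun h => absurd h n1) (fun h => absurd h n2)
      (fun h => absurd h n3) (fun h => absurd h n4)).2.2
    norm_num at this
  have half : (1 / 2 : ℝ) = ((1 : ℤ) : ℝ) / 2 := by norm_num
  have nhalf : (-(1 / 2) : ℝ) = ((-1 : ℤ) : ℝ) / 2 := by norm_num
  have zero : (0 : ℝ) = ((0 : ℤ) : ℝ) / 2 := by norm_num
  rcases hr with hr | hr | hr <;> rcases hp with hp | hp <;> rcases hq with hq | hq <;>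
    first
    | exfalso; linarith
    | refine ⟨_, _, _, hp.trans half, hq.trans half, hr.trans zero, ?_⟩; decide
    | refine ⟨_, _, _, hp.trans half, hq.trans half, hr.trans nhalf, ?_⟩; decide
    | refine ⟨_, _, _, hp.trans half, hq.trans zero, hr.trans zero, ?_⟩; decide
    | refine ⟨_, _, _, hp.trans half, hq.trans zero, hr.trans nhalf, ?_⟩; decide
    | refine ⟨_, _, _, hp.trans zero, hq.trans half, hr.trans zero, ?_⟩; decide
    | refine ⟨_, _, _, hp.trans zero, hq.trans half, hr.trans nhalf, ?_⟩; decide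
    | refine ⟨_, _, _, hp.trans zero, hq.trans zero, hr.trans zero, ?_⟩; decide
    | refine ⟨_, _, _, hp.trans zero, hq.trans zero, hr.trans half, ?_⟩; decide

end Cases

/-! ### Reduction of the vertices to the root lattices. -/

section Classification

/-- Twice the Gram matrices of the bases to which the vertices are reduced. -/
def A2 : Matrix (Fin 2) (Fin 2) ℤ :=
  !![2, -1; -1, 2]

def A3 : Matrix (Fin 3) (Fin 3) ℤ :=
  !![2, -1, 0; -1, 2, -1; 0, -1, 2]

def A4 : Matrix (Fin 4) (Fin 4) ℤ :=
  !![2, -1, 0, 0; -1, 2, -1, 0; 0, -1, 2, -1; 0, 0, -1, 2]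

/-- The signs are those of `familyBasis`: half the all-ones vector together with three standard
basis vectors. -/
def D4 : Matrix (Fin 4) (Fin 4) ℤ :=
  !![2, 1, 1, 1; 1, 2, 0, 0; 1, 0, 2, 0; 1, 0, 0, 2]

lemma halfMatrix_A2 : halfMatrix A2 = Q2 := by
  ext i j
  fin_cases i <;> fin_cases j <;> norm_num [halfMatrix_apply, A2, Q2]

lemma halfMatrix_A3 : halfMatrix A3 = Q3 := by
  ext i j
  fin_cases i <;> fin_cases j <;> norm_num [halfMatrix_apply, A3, Q3]

lemma halfMatrix_A4 : halfMatrix A4 = Q4 := by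
  ext i j
  fin_cases i <;> fin_cases j <;> norm_num [halfMatrix_apply, A4, Q4]

lemma one_le_norm_of_span_eq {n : ℕ} {η b : Fin n → E n} {Q : Matrix (Fin n) (Fin n) ℝ}
    (hQ : Q ∈ Omega2 n) (hη : Matrix.gram ℝ η = Q)
    (hb : Submodule.span ℤ (Set.range b) = Submodule.span ℤ (Set.range η)) {k : Fin n → ℤ}
    (hk : k ≠ 0) : 1 ≤ ∑ i, ∑ j, (k i * k j : ℝ) * ⟪b i, b j⟫_ℝ := by
  rw [← hη, gram_mem_Omega2_iff] at hQ
  have hli := linearIndependent_of_span_eq hQ.1 hb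
  have h0 : comb b k ≠ 0 := fun h => hk (comb_injective b hli (h.trans (comb_zero b).symm))
  have h1 := min_of_forall_comb hQ.2.2 _ (hb ▸ comb_mem_span b k) h0
  have h2 : ⟪comb b k, comb b k⟫_ℝ = ∑ i, ∑ j, (k i * k j : ℝ) * ⟪b i, b j⟫_ℝ := by
    simp only [comb, sum_inner, inner_sum, inner_smul_smul_int]
    exact Finset.sum_comm
  rw [← h2, real_inner_self_eq_norm_sq]
  exact one_le_pow₀ h1

theorem exists_gram_eq_of_mem_vertices_one {η : Fin 1 → E 1} {Q : Matrix (Fin 1) (Fin 1) ℝ}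
    (hQ : Q ∈ vertices 1) (hη : Matrix.gram ℝ η = Q) : Matrix.gram ℝ η = halfMatrix !![2] := by
  ext i j
  rw [hη, Subsingleton.elim i j, (extremePoints_subset hQ).2.1, halfMatrix_apply,
    Subsingleton.elim j 0]
  norm_num

theorem exists_gram_eq_of_mem_vertices_two {η : Fin 2 → E 2} {Q : Matrix (Fin 2) (Fin 2) ℝ}
    (hQ : Q ∈ vertices 2) (hη : Matrix.gram ℝ η = Q) :
    ∃ b : Fin 2 → E 2, Submodule.span ℤ (Set.range b) = Submodule.span ℤ (Set.range η) ∧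
      Matrix.gram ℝ b = halfMatrix A2 := by
  have h := abs_inner_eq_of_mem_vertices_two hQ hη
  have hΩ := extremePoints_subset hQ
  rw [← hη, gram_mem_Omega2_iff] at hΩ
  have h1 := hΩ.2.1
  have h' := real_inner_comm (η 0) (η 1)
  rcases (abs_eq (by norm_num)).1 h with h | h
  · refine exists_of_gram_eq (Z := !![2, 1; 1, 2]) rfl ?_ !![1, 0; 0, -1] !![1, 0; 0, -1]
      (by decide) (by decide)
    ext i j
    fin_cases i <;> fin_cases j <;> (try simp only [Fin.reduceFinMk]) <;>
      simp [halfMatrix_apply, Matrix.gram_apply, h1, h, h']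
  · refine ⟨η, rfl, ?_⟩
    ext i j
    fin_cases i <;> fin_cases j <;> (try simp only [Fin.reduceFinMk]) <;>
      simp [halfMatrix_apply, Matrix.gram_apply, h1, h, h', A2] <;>
      norm_num

theorem exists_gram_eq_of_mem_vertices_three {η : Fin 3 → E 3} {Q : Matrix (Fin 3) (Fin 3) ℝ}
    (hQ : Q ∈ vertices 3) (hη : Matrix.gram ℝ η = Q) :
    ∃ b : Fin 3 → E 3, Submodule.span ℤ (Set.range b) = Submodule.span ℤ (Set.range η) ∧
      Matrix.gram ℝ b = halfMatrix A3 := by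
  obtain ⟨b, hb, hb1, h01, h12⟩ := exists_path_basis_three hQ hη
  have hpin := pinned_three hQ hη hb hb1 h01 h12
  have hΩ := extremePoints_subset hQ
  have h10 := real_inner_comm (b 0) (b 1) ▸ h01
  have h21 := real_inner_comm (b 1) (b 2) ▸ h12
  have h20 := real_inner_comm (b 0) (b 2)
  set p := ⟪b 0, b 2⟫_ℝ with hp
  have i1 := one_le_norm_of_span_eq hΩ hη hb (k := ![1, 0, -1]) (by decide)
  have i2 := one_le_norm_of_span_eq hΩ hη hb (k := ![1, 1, 1]) (by decide)
  simp [Fin.sum_univ_three, hb1, h01, h12, h10, h21, h20, ← hp] at i1 i2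
  have hp' : p = 0 ∨ p = 1 / 2 := by
    rcases hpin with h | h <;> rcases (abs_eq (by norm_num)).1 h with h | h
    · exact Or.inr h
    · linarith
    · linarith
    · exact Or.inl (by linarith)
  rcases hp' with h | h
  · refine ⟨b, hb, ?_⟩
    ext i j
    fin_cases i <;> fin_cases j <;> (try simp only [Fin.reduceFinMk]) <;>
      simp [halfMatrix_apply, Matrix.gram_apply, hb1, h01, h12, h10, h21, h20, ← hp, h, A3]
  -- The basis `b 0`, `b 1`, `-(b 1 + b 2)` has the Gram matrix of `A3`.
  · refine exists_of_gram_eq hb (Z := !![2, -1, 1; -1, 2, -1; 1, -1, 2]) ?_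
      !![1, 0, 0; 0, 1, 0; 0, -1, -1] !![1, 0, 0; 0, 1, 0; 0, -1, -1] (by decide) (by decide)
    ext i j
    fin_cases i <;> fin_cases j <;> (try simp only [Fin.reduceFinMk]) <;>
      simp [halfMatrix_apply, Matrix.gram_apply, hb1, h01, h12, h10, h21, h20, ← hp, h]

/-- Twice the Gram matrix of a path basis in dimension four. -/
def pathMatrix (a b c : ℤ) : Matrix (Fin 4) (Fin 4) ℤ :=
  !![2, -1, a, c; -1, 2, -1, b; a, -1, 2, -1; c, b, -1, 2]

lemma exists_gram_eq_pathMatrix {η : Fin 4 → E 4} {Q : Matrix (Fin 4) (Fin 4) ℝ}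
    (hQ : Q ∈ vertices 4) (hη : Matrix.gram ℝ η = Q) :
    ∃ e : Fin 4 → E 4, Submodule.span ℤ (Set.range e) = Submodule.span ℤ (Set.range η) ∧
      ∃ a b c : ℤ, Matrix.gram ℝ e = halfMatrix (pathMatrix a b c) ∧
      (a, b, c) ∈ ({(0, 0, 0), (0, 0, 1), (1, 0, -1), (1, 0, 0), (0, 1, -1), (0, 1, 0),
        (1, 1, -1), (1, 1, 0)} : Finset (ℤ × ℤ × ℤ)) := by
  obtain ⟨b, hb, hb1, h01, h12, h23⟩ := exists_path_basis_four hQ hη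
  have hΩ := extremePoints_subset hQ
  have hii : ∀ i, ⟪b i, b i⟫_ℝ = 1 := fun i => by rw [real_inner_self_eq_norm_sq, hb1, one_pow]
  have h10 := real_inner_comm (b 0) (b 1) ▸ h01
  have h21 := real_inner_comm (b 1) (b 2) ▸ h12
  have h32 := real_inner_comm (b 2) (b 3) ▸ h23
  have h20 := real_inner_comm (b 0) (b 2)
  have h31 := real_inner_comm (b 1) (b 3)
  have h30 := real_inner_comm (b 0) (b 3)
  have hpin := pinned_four hQ hη hb hb1 h01 h12 h23 rfl rfl rfl
  set p := ⟪b 0, b 2⟫_ℝ with hp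
  set q := ⟪b 1, b 3⟫_ℝ with hq
  set r := ⟪b 0, b 3⟫_ℝ with hr
  have key : ∀ k : Fin 4 → ℤ, k ≠ 0 → 1 ≤ (k 0 : ℝ) ^ 2 + (k 1 : ℝ) ^ 2 + (k 2 : ℝ) ^ 2 +
      (k 3 : ℝ) ^ 2 - k 0 * k 1 - k 1 * k 2 - k 2 * k 3 + 2 * (k 0 * k 2 * p) +
      2 * (k 1 * k 3 * q) + 2 * (k 0 * k 3 * r) := by
    intro k hk
    refine (one_le_norm_of_span_eq hΩ hη hb hk).trans_eq ?_
    simp only [Fin.sum_univ_four, hii, h01, h12, h10, h21, h23, h32, h20, h31, h30, ← hp, ← hq,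
      ← hr]
    ring
  -- Each short vector gives one facet, in order: `p ≤ 1/2`, `0 ≤ p`, `q ≤ 1/2`, `0 ≤ q`, `-1/2 ≤
  -- r`, `r ≤ 1/2`, `0 ≤ p + q + r`, `q + r ≤ 1/2`, `p + r ≤ 1/2`.
  have i1 := key ![1, 0, -1, 0] (by decide)
  have i2 := key ![1, 1, 1, 0] (by decide)
  have i3 := key ![0, 1, 0, -1] (by decide)
  have i4 := key ![0, 1, 1, 1] (by decide)
  have i5 := key ![1, 0, 0, 1] (by decide)
  have i6 := key ![1, 0, 0, -1] (by decide)
  have i7 := key ![1, 1, 1, 1] (by decide)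
  have i8 := key ![1, 1, 0, -1] (by decide)
  have i9 := key ![1, 0, -1, -1] (by decide)
  simp at i1 i2 i3 i4 i5 i6 i7 i8 i9
  obtain ⟨x, y, z, hx, hy, hz, hxyz⟩ := cases_of_pinned (p := p) (q := q) (r := r)
    (by linarith) (by linarith) (by linarith) (by linarith) (by linarith) (by linarith)
    (by linarith) (by linarith) (by linarith) hpin
  refine ⟨b, hb, x, y, z, ?_, hxyz⟩
  ext i j
  fin_cases i <;> fin_cases j <;> (try simp only [Fin.reduceFinMk]) <;>
    simp [halfMatrix_apply, Matrix.gram_apply, hb1, h01, h12, h10, h21, h23, h32, h20, h31,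
      h30, ← hp, ← hq, ← hr, hx, hy, hz, pathMatrix]

theorem exists_gram_eq_of_mem_vertices_four {η : Fin 4 → E 4} {Q : Matrix (Fin 4) (Fin 4) ℝ}
    (hQ : Q ∈ vertices 4) (hη : Matrix.gram ℝ η = Q) :
    ∃ b : Fin 4 → E 4, Submodule.span ℤ (Set.range b) = Submodule.span ℤ (Set.range η) ∧
      (Matrix.gram ℝ b = halfMatrix A4 ∨ Matrix.gram ℝ b = halfMatrix D4) := by
  obtain ⟨e, he, a, b, c, hZ, habc⟩ := exists_gram_eq_pathMatrix hQ hη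
  have hA : ∀ U U' : Matrix (Fin 4) (Fin 4) ℤ, U' * U = 1 →
      U * pathMatrix a b c * U.transpose = A4 →
      ∃ b : Fin 4 → E 4, Submodule.span ℤ (Set.range b) = Submodule.span ℤ (Set.range η) ∧
        (Matrix.gram ℝ b = halfMatrix A4 ∨ Matrix.gram ℝ b = halfMatrix D4) := by
    intro U U' h h'
    obtain ⟨b', h1, h2⟩ := exists_of_gram_eq he hZ U U' h h'
    exact ⟨b', h1, Or.inl h2⟩
  have hD : ∀ U U' : Matrix (Fin 4) (Fin 4) ℤ, U' * U = 1 →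
      U * pathMatrix a b c * U.transpose = D4 →
      ∃ b : Fin 4 → E 4, Submodule.span ℤ (Set.range b) = Submodule.span ℤ (Set.range η) ∧
        (Matrix.gram ℝ b = halfMatrix A4 ∨ Matrix.gram ℝ b = halfMatrix D4) := by
    intro U U' h h'
    obtain ⟨b', h1, h2⟩ := exists_of_gram_eq he hZ U U' h h'
    exact ⟨b', h1, Or.inr h2⟩
  simp only [Finset.mem_insert, Finset.mem_singleton, Prod.mk.injEq] at habc
  -- Four vertices of the polytope give `A4` and four give `D4`; each case exhibits a change of
  -- basis and its integral inverse.
  rcases habc with ⟨rfl, rfl, rfl⟩ | ⟨rfl, rfl, rfl⟩ | ⟨rfl, rfl, rfl⟩ | ⟨rfl, rfl, rfl⟩ |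
    ⟨rfl, rfl, rfl⟩ | ⟨rfl, rfl, rfl⟩ | ⟨rfl, rfl, rfl⟩ | ⟨rfl, rfl, rfl⟩
  · exact hA 1 1 (by decide) (by decide)
  · exact hD !![1, 0, 0, 0; 0, 0, 0, 1; 0, -1, 0, 0; 1, 1, 1, 0]
      !![1, 0, 0, 0; 0, 0, -1, 0; -1, 0, 1, 1; 0, 1, 0, 0] (by decide) (by decide)
  · exact hD !![1, 0, 0, 0; 0, 0, 1, 0; 1, 1, 0, 0; 1, 0, 0, 1]
      !![1, 0, 0, 0; -1, 0, 1, 0; 0, 1, 0, 0; -1, 0, 0, 1] (by decide) (by decide)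
  · exact hA !![1, 0, 0, 0; 0, 1, 0, 0; 0, -1, -1, 0; 0, 0, 0, -1]
      !![1, 0, 0, 0; 0, 1, 0, 0; 0, -1, -1, 0; 0, 0, 0, -1] (by decide) (by decide)
  · exact hD !![1, 0, 0, 0; 0, 0, 0, -1; 1, 1, 0, 0; 0, -1, -1, 0]
      !![1, 0, 0, 0; -1, 0, 1, 0; 1, 0, -1, -1; 0, -1, 0, 0] (by decide) (by decide)
  · exact hA !![1, 0, 0, 0; 0, 1, 0, 0; 0, 0, 1, 0; 0, 0, -1, -1]
      !![1, 0, 0, 0; 0, 1, 0, 0; 0, 0, 1, 0; 0, 0, -1, -1] (by decide) (by decide)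
  · exact hA !![1, 0, 0, 0; 0, 1, 0, 0; 0, -1, 0, 1; 0, 0, -1, -1]
      !![1, 0, 0, 0; 0, 1, 0, 0; 0, -1, -1, -1; 0, 1, 1, 0] (by decide) (by decide)
  · exact hD !![1, 0, 0, 0; 0, 0, 1, 0; 1, 1, 0, 0; 0, -1, 0, 1]
      !![1, 0, 0, 0; -1, 0, 1, 0; 0, 1, 0, 0; -1, 0, 1, 1] (by decide) (by decide)

end Classification

end FlatTori

/-! ### Lattices presented with a full list of minimal vectors. -/

namespace FlatTori

section UnitSystem

variable {n m N : ℕ} {Z : Matrix (Fin n) (Fin n) ℤ} {B : Matrix (Fin m) (Fin n) ℤ}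
  {C : Matrix (Fin n) (Fin m) ℤ} {d : ℤ} {Y : Matrix (Fin N) (Fin n) ℤ}

lemma dotProduct_mulVec_eq_sum_sq (hZ : B.transpose * B = Z) (k : Fin n → ℤ) :
    k ⬝ᵥ Z.mulVec k = ∑ i, B.mulVec k i ^ 2 := by
  rw [← hZ, ← Matrix.mulVec_mulVec, Matrix.dotProduct_mulVec, Matrix.vecMul_transpose, dotProduct]
  simp only [sq]

lemma mulVec_mulVec_eq_smul (hC : C * B = d • 1) (k : Fin n → ℤ) :
    C.mulVec (B.mulVec k) = d • k := by
  rw [Matrix.mulVec_mulVec, hC, Matrix.smul_mulVec, Matrix.one_mulVec]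

lemma mulVec_ne_zero (hC : C * B = d • 1) (hd : d ≠ 0) {k : Fin n → ℤ} (hk : k ≠ 0) :
    B.mulVec k ≠ 0 := by
  intro h
  have h1 := mulVec_mulVec_eq_smul hC k
  rw [h, Matrix.mulVec_zero] at h1
  exact (smul_ne_zero hd hk) h1.symm

lemma posDef_halfMatrix (hZ : B.transpose * B = Z) (hC : C * B = d • 1) (hd : d ≠ 0) :
    (halfMatrix Z).PosDef := by
  set B' : Matrix (Fin m) (Fin n) ℝ := B.map Int.cast with hB'
  have hinj : Function.Injective B'.mulVec := by
    intro x y hxy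
    have h1 : (C.map Int.cast : Matrix (Fin n) (Fin m) ℝ) * B' = (d : ℝ) • 1 := by
      ext i j
      have := congrArg (Int.cast : ℤ → ℝ) (congrFun (congrFun hC i) j)
      simp only [Matrix.mul_apply, Int.cast_sum, Int.cast_mul, Matrix.smul_apply,
        smul_eq_mul] at this
      simp only [Matrix.mul_apply, hB', Matrix.map_apply, this, Matrix.smul_apply, smul_eq_mul,
        Matrix.one_apply, Int.cast_ite, Int.cast_one, Int.cast_zero]
    have h2 := congrArg (C.map Int.cast : Matrix (Fin n) (Fin m) ℝ).mulVec hxy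
    simp only [Matrix.mulVec_mulVec, h1, Matrix.smul_mulVec, Matrix.one_mulVec] at h2
    exact smul_right_injective _ (Int.cast_ne_zero.2 hd) h2
  have h := (Matrix.PosDef.conjTranspose_mul_self B' hinj).smul (show (0 : ℝ) < 1 / 2 by norm_num)
  convert h using 1
  ext i j
  simp only [halfMatrix_apply, ← hZ, Matrix.mul_apply, Matrix.smul_apply, smul_eq_mul, hB',
    Matrix.conjTranspose_apply, Matrix.transpose_apply, Matrix.map_apply, star_trivial,
    Int.cast_sum, Int.cast_mul]
  ring

lemma dotProduct_halfMatrix_mulVec (k : Fin n → ℤ) :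
    (fun i => (k i : ℝ)) ⬝ᵥ (halfMatrix Z).mulVec (fun i => (k i : ℝ)) =
      ((k ⬝ᵥ Z.mulVec k : ℤ) : ℝ) / 2 := by
  simp only [dotProduct, Matrix.mulVec, Int.cast_sum, Int.cast_mul, Finset.mul_sum,
    Finset.sum_div, halfMatrix_apply]
  refine Finset.sum_congr rfl fun i _ => Finset.sum_congr rfl fun j _ => ?_
  ring

/-- `B` embeds the lattice in `ℤᵐ`. Its columns have even coordinate sums, and a square has the
parity of its root, so the form `Z` takes even values; being positive off zero, it is at least `2`
there. -/
theorem halfMatrix_mem_Omega2 (hZ : B.transpose * B = Z) (hC : C * B = d • 1) (hd : d ≠ 0)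
    (hdiag : ∀ i, Z i i = 2) (heven : ∀ j, (2 : ℤ) ∣ ∑ i, B i j) : halfMatrix Z ∈ Omega2 n := by
  refine ⟨posDef_halfMatrix hZ hC hd, fun i => ?_, fun k hk => ?_⟩
  · rw [halfMatrix_apply, hdiag]
    norm_num
  · rw [dotProduct_halfMatrix_mulVec, dotProduct_mulVec_eq_sum_sq hZ]
    have hpos : 0 < ∑ i, B.mulVec k i ^ 2 := by
      obtain ⟨i, hi⟩ := Function.ne_iff.1 (mulVec_ne_zero hC hd hk)
      exact Finset.sum_pos' (fun i _ => sq_nonneg _) 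
        ⟨i, Finset.mem_univ i, (sq_nonneg _).lt_of_ne' (pow_ne_zero 2 hi)⟩
    have h2 : (2 : ℤ) ∣ ∑ i, B.mulVec k i ^ 2 := by
      have e1 : (2 : ℤ) ∣ ∑ i, B.mulVec k i := by
        simp only [Matrix.mulVec, dotProduct]
        rw [Finset.sum_comm]
        refine Finset.dvd_sum fun j _ => ?_
        rw [← Finset.sum_mul]
        exact (heven j).mul_right _
      have e2 : (2 : ℤ) ∣ ∑ i, (B.mulVec k i ^ 2 - B.mulVec k i) :=
        Finset.dvd_sum fun i _ => by
          rw [sq, ← mul_sub_one]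
          exact even_iff_two_dvd.1 (Int.even_mul_pred_self _)
      rw [Finset.sum_sub_distrib] at e2
      exact (dvd_sub_left e1).1 e2
    have h3 : (2 : ℤ) ≤ ∑ i, B.mulVec k i ^ 2 := Int.le_of_dvd hpos h2
    have h4 : (2 : ℝ) ≤ ((∑ i, B.mulVec k i ^ 2 : ℤ) : ℝ) := by exact_mod_cast h3
    linarith

/-- The image under `B` of a minimal vector has coordinates in `{-1, 0, 1}`, which leaves a finite
check. The condition `B (C t) = d t` discards the `t` that are not in the rational image of `B`. -/
lemma exists_eq_of_dotProduct_mulVec_eq_two (hZ : B.transpose * B = Z) (hC : C * B = d • 1)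
    (hd : d ≠ 0)
    (h : ∀ t ∈ Fintype.piFinset (fun _ : Fin m => Finset.Icc (-1 : ℤ) 1), ∑ i, t i ^ 2 = 2 →
      B.mulVec (C.mulVec t) = d • t → ∃ j, C.mulVec t = d • Y j ∨ C.mulVec t = d • -Y j)
    {k : Fin n → ℤ} (hk : k ⬝ᵥ Z.mulVec k = 2) : ∃ j, k = Y j ∨ k = -Y j := by
  rw [dotProduct_mulVec_eq_sum_sq hZ] at hk
  have hCB := mulVec_mulVec_eq_smul hC k
  have hmem : B.mulVec k ∈ Fintype.piFinset (fun _ : Fin m => Finset.Icc (-1 : ℤ) 1) := by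
    rw [Fintype.mem_piFinset]
    intro i
    have h1 : B.mulVec k i ^ 2 ≤ 2 :=
      hk ▸ Finset.single_le_sum (f := fun i => B.mulVec k i ^ 2) (fun i _ => sq_nonneg _)
        (Finset.mem_univ i)
    rw [Finset.mem_Icc]
    constructor <;> nlinarith
  obtain ⟨j, hj⟩ := h (B.mulVec k) hmem hk (by rw [hCB, Matrix.mulVec_smul])
  rw [hCB] at hj
  exact ⟨j, hj.imp (fun h => smul_right_injective _ hd h) fun h => smul_right_injective _ hd h⟩

/-- The rows of `Y` represent the pairs of opposite minimal vectors of the lattice with Gram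
matrix `Z / 2`. -/
structure IsUnitSystem (Z : Matrix (Fin n) (Fin n) ℤ) (Y : Matrix (Fin N) (Fin n) ℤ) : Prop where
  mem : halfMatrix Z ∈ Omega2 n
  form_eq : ∀ j, Y j ⬝ᵥ Z.mulVec (Y j) = 2
  exists_eq : ∀ k, k ⬝ᵥ Z.mulVec k = 2 → ∃ j, k = Y j ∨ k = -Y j
  injective : Function.Injective (Sum.elim (fun j => Y j) fun j => -Y j)

namespace IsUnitSystem

variable {b : Fin n → E n}

lemma norm_comb_eq_one_iff (hb : Matrix.gram ℝ b = halfMatrix Z) (k : Fin n → ℤ) :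
    ‖comb b k‖ = 1 ↔ k ⬝ᵥ Z.mulVec k = 2 := by
  rw [← pow_eq_one_iff_of_nonneg (norm_nonneg _) two_ne_zero, ← real_inner_self_eq_norm_sq,
    inner_comb_comb_of_gram_eq hb, div_eq_one_iff_eq two_ne_zero]
  exact_mod_cast Iff.rfl

lemma inner_comb_row (hb : Matrix.gram ℝ b = halfMatrix Z) (j : Fin N) (i : Fin n) :
    ⟪comb b (Y j), b i⟫_ℝ = ((Y * Z) j i : ℝ) / 2 := by
  have h : b i = comb b (Pi.single i 1) := by
    simp [comb, Pi.single_apply]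
  rw [h, inner_comb_comb_of_gram_eq hb, Matrix.mulVec_single_one, Matrix.mul_apply]
  rfl

/-- Both `Y * Z` and `Z` hold doubled inner products, which turns the frame constant `1/n` into
`2/n`. -/
theorem isLambdaOneMinimal_dataMap (h : IsUnitSystem Z Y) (hn : 0 < n)
    (hb : Matrix.gram ℝ b = halfMatrix Z) {w : Fin N → ℝ} (hw : ∀ j, 0 ≤ w j)
    (hw1 : ∑ j, w j = 1)
    (hframe : ∀ i l, ∑ j, w j * ((Y * Z) j i * (Y * Z) j l : ℤ) = 2 / n * Z i l) :
    IsLambdaOneMinimal (torusLattice b) (dataMap b Y w) := by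
  have hΩ := h.mem
  rw [← hb, gram_mem_Omega2_iff] at hΩ
  refine isLambdaOneMinimal_waveMap hn hΩ.1 hΩ.2.2 hw hw1 Y
    (fun j => (norm_comb_eq_one_iff hb _).2 (h.form_eq j)) fun i l => ?_
  have e : ⟪b i, b l⟫_ℝ = (Z i l : ℝ) / 2 := by
    rw [← Matrix.gram_apply (𝕜 := ℝ), hb, halfMatrix_apply]
  have := hframe i l
  simp only [inner_comb_row hb, e]
  rw [show (n : ℝ)⁻¹ * (Z i l / 2) = (2 / n * Z i l) / 4 by ring, ← this, Finset.sum_div]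
  refine Finset.sum_congr rfl fun j _ => ?_
  push_cast
  ring

theorem exists_weights (h : IsUnitSystem Z Y) (hn : 0 < n)
    (hb : Matrix.gram ℝ b = halfMatrix Z) {m : ℕ} {x : E n → E m}
    (hx : IsLambdaOneMinimal (torusLattice b) x) :
    ∃ w : Fin N → ℝ, (∀ j, 0 ≤ w j) ∧ ∑ j, w j = 1 ∧
      (∀ i l, ∑ j, w j * ((Y * Z) j i * (Y * Z) j l : ℤ) = 2 / n * Z i l) ∧
      ∀ u v, ⟪x u, x v⟫_ℝ = ∑ j, w j * (wave (comb b (Y j)) (u - v)).re := by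
  classical
  have hΩ := h.mem
  rw [← hb, gram_mem_Omega2_iff] at hΩ
  set f : Fin N ⊕ Fin N → Fin n → ℤ := Sum.elim (fun j => Y j) fun j => -Y j with hf
  have hS : ∀ k, k ∈ Finset.univ.image f ↔ ‖comb b k‖ = 1 := by
    intro k
    rw [norm_comb_eq_one_iff hb, Finset.mem_image]
    constructor
    · rintro ⟨j | j, -, rfl⟩
      · exact h.form_eq j
      · simpa [hf, Matrix.mulVec_neg] using h.form_eq j
    · intro hk
      obtain ⟨j, hj | hj⟩ := h.exists_eq k hk
      · exact ⟨Sum.inl j, Finset.mem_univ _, hj.symm⟩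
      · exact ⟨Sum.inr j, Finset.mem_univ _, hj.symm⟩
  have hk₀ : ‖comb b (Pi.single ⟨0, hn⟩ 1)‖ = 1 := by
    have : comb b (Pi.single ⟨0, hn⟩ 1) = b ⟨0, hn⟩ := by simp [comb, Pi.single_apply]
    rw [this, hΩ.2.1]
  obtain ⟨W, hW0, hWneg, hW1, hWframe, hK⟩ := exists_weights_of_isLambdaOneMinimal hn hΩ.1 hΩ.2.2
    hk₀ (fun k l => ⟨k ⬝ᵥ Z.mulVec l, by rw [inner_comb_comb_of_gram_eq hb]; ring⟩) hS hx
  have hsum : ∀ F : (Fin n → ℤ) → ℝ, (∀ k, F (-k) = F k) →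
      ∑ k ∈ Finset.univ.image f, F k = ∑ j, 2 * F (Y j) := by
    intro F hF
    rw [Finset.sum_image fun i _ j _ hij => h.injective hij, Fintype.sum_sum_type,
      ← Finset.sum_add_distrib]
    refine Finset.sum_congr rfl fun j _ => ?_
    simp only [Sum.elim_inl, Sum.elim_inr, hF]
    ring
  -- Opposite frequencies carry the same weight and the same cosine, and are merged.
  refine ⟨fun j => 2 * W (Y j), fun j => mul_nonneg two_pos.le (hW0 _), ?_, fun i l => ?_,
    fun u v => ?_⟩
  · rw [← hsum W hWneg, hW1]
  · have e : ⟪b i, b l⟫_ℝ = (Z i l : ℝ) / 2 := by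
      rw [← Matrix.gram_apply (𝕜 := ℝ), hb, halfMatrix_apply]
    have := hWframe (b i) (b l)
    rw [hsum _ fun k => by rw [hWneg, comb_neg, inner_neg_left, inner_neg_left]; ring, e] at this
    simp only [inner_comb_row hb] at this
    rw [show 2 / n * Z i l = 4 * ((n : ℝ)⁻¹ * (Z i l / 2)) by ring, ← this, Finset.mul_sum]
    refine Finset.sum_congr rfl fun j _ => ?_
    push_cast
    ring
  · rw [hK, hsum _ fun k => by
      rw [hWneg, comb_neg, re_wave, re_wave, inner_neg_left, mul_neg, Real.cos_neg]]
    exact Finset.sum_congr rfl fun j _ => by ring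

end IsUnitSystem

/-- A change of lattice basis alters the matrix data but not the torus. -/
lemma torusLattice_congr {b η : Fin n → E n}
    (h : Submodule.span ℤ (Set.range b) = Submodule.span ℤ (Set.range η)) :
    torusLattice b = torusLattice η := by
  rw [torusLattice, torusLattice, h]

lemma IsLambdaOneMinimal.exists_euclidean {V : Type*} [NormedAddCommGroup V]
    [InnerProductSpace ℝ V] [FiniteDimensional ℝ V] [Nontrivial V] {Λ : Submodule ℤ (E n)}
    {x : E n → V} (hx : IsLambdaOneMinimal Λ x) :
    ∃ (m : ℕ) (y : E n → E (m + 1)), IsLambdaOneMinimal Λ y := by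
  obtain ⟨m, hm⟩ := Nat.exists_eq_succ_of_ne_zero (Module.finrank_pos (R := ℝ) (M := V)).ne'
  exact ⟨m, _, hx.comp_isometry
    ((stdOrthonormalBasis ℝ V).reindex (finCongr hm)).repr⟩

lemma congruentToData_of_inner_eq {Λ : Submodule ℤ (E n)} {b : Fin n → E n} {w : Fin N → ℝ}
    {Q : Matrix (Fin n) (Fin n) ℝ} (hb : Matrix.gram ℝ b = Q) (hΛ : Λ = torusLattice b)
    (hw : ∀ j, 0 ≤ w j) {m : ℕ} {x : E n → E m}
    (h : ∀ u v, ⟪x u, x v⟫_ℝ = ∑ j, w j * (wave (comb b (Y j)) (u - v)).re) :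
    CongruentToData Λ x Q Y w := by
  refine ⟨b, hb, congruent_of_inner_eq (LinearIsometryEquiv.refl ℝ (E n)) ?_ fun u v => ?_⟩
  · intro u
    rw [hΛ]
    rfl
  · rw [h, dataMap_eq_waveMap, inner_waveMap hw]
    rfl

/-- The extremality criterion. -/
theorem IsUnitSystem.mem_vertices (h : IsUnitSystem Z Y)
    (hM : ∀ M : Matrix (Fin n) (Fin n) ℝ, M.IsSymm →
      (∀ j, (fun i => (Y j i : ℝ)) ⬝ᵥ M.mulVec (fun i => (Y j i : ℝ)) = 0) → M = 0) :
    halfMatrix Z ∈ vertices n := by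
  refine ⟨h.mem, fun P hP R hR hPR => ?_⟩
  obtain ⟨s, t, hs, ht, hst, e⟩ := hPR
  have hne : ∀ j, Y j ≠ 0 := by
    intro j h0
    have := h.form_eq j
    rw [h0] at this
    simp at this
  have hsub := hM (P - halfMatrix Z) ?_ fun j => ?_
  · exact sub_eq_zero.1 hsub
  · have h1 := hP.1.isHermitian.sub h.mem.1.isHermitian
    exact Matrix.IsSymm.ext fun i j => by simpa using h1.apply i j
  · have e1 : (fun i => (Y j i : ℝ)) ⬝ᵥ (halfMatrix Z).mulVec (fun i => (Y j i : ℝ)) = 1 := by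
      rw [dotProduct_halfMatrix_mulVec (Y j), h.form_eq]
      norm_num
    have e2 := hP.2.2 (Y j) (hne j)
    have e3 := hR.2.2 (Y j) (hne j)
    have e4 := e1
    rw [← e] at e4
    simp only [Matrix.add_mulVec, Matrix.smul_mulVec, dotProduct_add, dotProduct_smul,
      smul_eq_mul] at e4
    rw [Matrix.sub_mulVec, dotProduct_sub, e1, sub_eq_zero]
    -- On a row of `Y` both `P` and `R` are at least `1` with weighted mean `1`, so both equal `1`.
    nlinarith

end UnitSystem

end FlatTori

/-! ### The root systems and the vertices they define. -/

namespace FlatTori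

section Systems

/-- For the lattices of type `A` the columns of `B` are the simple roots `eᵢ - eᵢ₊₁` in one
dimension more, and `C` recovers coordinates as partial sums. -/
lemma isUnitSystem_A1 : IsUnitSystem !![2] !![1] where
  mem := halfMatrix_mem_Omega2 (B := !![1; -1]) (C := !![1, 0]) (d := 1) (by decide) (by decide)
    (by decide) (by decide) (by decide)
  form_eq := by decide
  exists_eq k hk := exists_eq_of_dotProduct_mulVec_eq_two (B := !![1; -1]) (C := !![1, 0]) (d := 1)
    (by decide) (by decide) (by decide) (by decide) hk
  injective := by decide

lemma isUnitSystem_A2 : IsUnitSystem A2 Y2 where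
  mem := halfMatrix_mem_Omega2 (B := !![1, 0; -1, 1; 0, -1]) (C := !![1, 0, 0; 1, 1, 0]) (d := 1)
    (by decide) (by decide) (by decide) (by decide) (by decide)
  form_eq := by decide
  exists_eq k hk := exists_eq_of_dotProduct_mulVec_eq_two (B := !![1, 0; -1, 1; 0, -1])
    (C := !![1, 0, 0; 1, 1, 0]) (d := 1) (by decide) (by decide) (by decide) (by decide) hk
  injective := by decide

lemma isUnitSystem_A3 : IsUnitSystem A3 Y3 where
  mem := halfMatrix_mem_Omega2 (B := !![1, 0, 0; -1, 1, 0; 0, -1, 1; 0, 0, -1])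
    (C := !![1, 0, 0, 0; 1, 1, 0, 0; 1, 1, 1, 0]) (d := 1)
    (by decide) (by decide) (by decide) (by decide) (by decide)
  form_eq := by decide
  exists_eq k hk := exists_eq_of_dotProduct_mulVec_eq_two
    (B := !![1, 0, 0; -1, 1, 0; 0, -1, 1; 0, 0, -1])
    (C := !![1, 0, 0, 0; 1, 1, 0, 0; 1, 1, 1, 0]) (d := 1)
    (by decide) (by decide) (by decide) (by decide +kernel) hk
  injective := by decide +kernel

lemma isUnitSystem_A4 : IsUnitSystem A4 Y4 where
  mem := halfMatrix_mem_Omega2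
    (B := !![1, 0, 0, 0; -1, 1, 0, 0; 0, -1, 1, 0; 0, 0, -1, 1; 0, 0, 0, -1])
    (C := !![1, 0, 0, 0, 0; 1, 1, 0, 0, 0; 1, 1, 1, 0, 0; 1, 1, 1, 1, 0]) (d := 1)
    (by decide) (by decide) (by decide) (by decide) (by decide)
  form_eq := by decide
  exists_eq k hk := exists_eq_of_dotProduct_mulVec_eq_two
    (B := !![1, 0, 0, 0; -1, 1, 0, 0; 0, -1, 1, 0; 0, 0, -1, 1; 0, 0, 0, -1])
    (C := !![1, 0, 0, 0, 0; 1, 1, 0, 0, 0; 1, 1, 1, 0, 0; 1, 1, 1, 1, 0]) (d := 1)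
    (by decide) (by decide) (by decide) (by decide +kernel) hk
  injective := by decide +kernel

/-- The minimal vectors of `D4`, arranged in three orthogonal frames. -/
def frames : Matrix (Fin 12) (Fin 4) ℤ :=
  !![1, 0, 0, 0; 1, 0, -1, -1; 1, -1, 0, -1; -1, 1, 1, 0;
     1, 0, 0, -1; 1, 0, -1, 0; 1, -1, 0, 0; 1, -1, -1, -1;
     2, -1, -1, -1; 0, 1, 0, 0; 0, 0, 1, 0; 0, 0, 0, 1]

/-- Here `B` identifies the lattice with the vectors of even coordinate sum in `ℤ⁴`. This sublattice
has index two, hence `d = 2`. -/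
lemma isUnitSystem_D4 : IsUnitSystem D4 frames where
  mem := halfMatrix_mem_Omega2
    (B := !![1, 1, 1, 0; 0, 1, -1, 0; 1, 0, 0, 1; 0, 0, 0, 1])
    (C := !![0, 0, 2, -2; 1, 1, -1, 1; 1, -1, -1, 1; 0, 0, 0, 2]) (d := 2)
    (by decide) (by decide) (by decide) (by decide) (by decide)
  form_eq := by decide
  exists_eq k hk := exists_eq_of_dotProduct_mulVec_eq_two
    (B := !![1, 1, 1, 0; 0, 1, -1, 0; 1, 0, 0, 1; 0, 0, 0, 1])
    (C := !![0, 0, 2, -2; 1, 1, -1, 1; 1, -1, -1, 1; 0, 0, 0, 2]) (d := 2)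
    (by decide) (by decide) (by decide) (by decide +kernel) hk
  injective := by decide +kernel

end Systems

section Products

lemma Y2_mul_A2 : Y2 * A2 = !![2, -1; -1, 2; 1, 1] := by decide

lemma Y3_mul_A3 : Y3 * A3 =
    !![2, -1, 0; -1, 2, -1; 1, 1, -1; 0, -1, 2; -1, 1, 1; 1, 0, 1] := by decide

lemma Y4_mul_A4 : Y4 * A4 =
    !![2, -1, 0, 0; -1, 2, -1, 0; 1, 1, -1, 0; 0, -1, 2, -1; -1, 1, 1, -1; 1, 0, 1, -1;
       0, 0, -1, 2; 0, -1, 1, 1; -1, 1, 0, 1; 1, 0, 0, 1] := by decide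

lemma frames_mul_D4 : frames * D4 =
    !![2, 1, 1, 1; 0, 1, -1, -1; 0, -1, 1, -1; 0, 1, 1, -1; 1, 1, 1, -1; 1, 1, -1, 1;
       1, -1, 1, 1; -1, -1, -1, -1; 1, 0, 0, 0; 1, 2, 0, 0; 1, 0, 2, 0; 1, 0, 0, 2] := by decide

end Products

section Vertices

/-- Perfection by polarisation: the values of a quadratic form on the rows determine all its
coefficients. The other vertices are treated in the same way. -/
theorem Q2_mem_vertices : Q2 ∈ vertices 2 := by
  rw [← halfMatrix_A2]
  refine isUnitSystem_A2.mem_vertices fun M hM h => ?_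
  have s10 := hM.apply 0 1
  have h0 := h 0
  have h1 := h 1
  have h2 := h 2
  simp [dotProduct, Matrix.mulVec, Fin.sum_univ_succ, Y2, s10] at h0 h1 h2
  ext i j
  fin_cases i <;> fin_cases j <;> simp <;> linarith

theorem Q3_mem_vertices : Q3 ∈ vertices 3 := by
  rw [← halfMatrix_A3]
  refine isUnitSystem_A3.mem_vertices fun M hM h => ?_
  have s10 := hM.apply 0 1
  have s20 := hM.apply 0 2
  have s21 := hM.apply 1 2
  simp only [Fin.forall_fin_succ] at h
  simp [dotProduct, Matrix.mulVec, Fin.sum_univ_succ, Y3, s10, s20, s21] at h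
  obtain ⟨h0, h1, h2, h3, h4, h5⟩ := h
  ext i j
  fin_cases i <;> fin_cases j <;> simp <;> linarith

theorem Q4_mem_vertices : Q4 ∈ vertices 4 := by
  rw [← halfMatrix_A4]
  refine isUnitSystem_A4.mem_vertices fun M hM h => ?_
  have s10 := hM.apply 0 1
  have s20 := hM.apply 0 2
  have s30 := hM.apply 0 3
  have s21 := hM.apply 1 2
  have s31 := hM.apply 1 3
  have s32 := hM.apply 2 3
  simp only [Fin.forall_fin_succ] at h
  simp [dotProduct, Matrix.mulVec, Fin.sum_univ_succ, Y4, s10, s20, s30, s21, s31, s32] at h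
  obtain ⟨h0, h1, h2, h3, h4, h5, h6, h7, h8, h9⟩ := h
  ext i j
  fin_cases i <;> fin_cases j <;> simp <;> linarith

theorem halfMatrix_D4_mem_vertices : halfMatrix D4 ∈ vertices 4 := by
  refine isUnitSystem_D4.mem_vertices fun M hM h => ?_
  have s10 := hM.apply 0 1
  have s20 := hM.apply 0 2
  have s30 := hM.apply 0 3
  have s21 := hM.apply 1 2
  have s31 := hM.apply 1 3
  have s32 := hM.apply 2 3
  simp only [Fin.forall_fin_succ] at h
  simp [dotProduct, Matrix.mulVec, Fin.sum_univ_succ, frames, s10, s20, s30, s21, s31, s32] at h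
  obtain ⟨h0, h1, h2, h3, h4, h5, h6, h7, h8, h9, h10, h11⟩ := h
  ext i j
  fin_cases i <;> fin_cases j <;> simp <;> linarith

end Vertices

end FlatTori

/-! ### Solutions of the weight equations. -/

namespace FlatTori

section UniformWeights

variable {n N : ℕ} {Z : Matrix (Fin n) (Fin n) ℤ} {Y : Matrix (Fin N) (Fin n) ℤ}

/-- Uniform weights satisfy the frame condition as soon as the Gram form of the rows is a multiple
of the quadratic form. -/
lemma IsUnitSystem.isLambdaOneMinimal_uniform (h : IsUnitSystem Z Y) (hn : 0 < n) (hN : 0 < N)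
    {c : ℤ} (hc : (Y * Z).transpose * (Y * Z) = c • Z) (hcn : c * n = 2 * N)
    {b : Fin n → E n} (hb : Matrix.gram ℝ b = halfMatrix Z) :
    IsLambdaOneMinimal (torusLattice b) (dataMap b Y fun _ => 1 / (N : ℝ)) := by
  have hN' : (N : ℝ) ≠ 0 := by positivity
  have hn' : (n : ℝ) ≠ 0 := by positivity
  refine h.isLambdaOneMinimal_dataMap hn hb (fun _ => by positivity) ?_ fun i l => ?_
  · simp [hN']
  · have e := congrArg (Int.cast : ℤ → ℝ) (congrFun (congrFun hc i) l)
    rw [Matrix.mul_apply] at e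
    simp only [Matrix.transpose_apply, Matrix.smul_apply, smul_eq_mul, Int.cast_sum] at e
    rw [← Finset.mul_sum, e]
    have hcn' : (c : ℝ) * n = 2 * N := by exact_mod_cast hcn
    push_cast
    field_simp
    linear_combination (Z i l : ℝ) * hcn'

lemma IsUnitSystem.dataIsLambdaOneMinimal (h : IsUnitSystem Z Y) (hn : 0 < n) (hN : 0 < N)
    {c : ℤ} (hc : (Y * Z).transpose * (Y * Z) = c • Z) (hcn : c * n = 2 * N) :
    DataIsLambdaOneMinimal (halfMatrix Z) Y fun _ => 1 / (N : ℝ) :=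
  ⟨exists_gram_eq_of_posDef h.mem.1, fun _ hη => h.isLambdaOneMinimal_uniform hn hN hc hcn hη⟩

end UniformWeights

/-- The constant `c` is the Coxeter number of the root system, and `c * n = 2 * N` counts its roots.
-/
theorem dataIsLambdaOneMinimal_two : DataIsLambdaOneMinimal Q2 Y2 fun _ => 1 / 3 := by
  have := isUnitSystem_A2.dataIsLambdaOneMinimal (by norm_num) (by norm_num) (c := 3) (by decide)
    (by norm_num)
  rw [halfMatrix_A2] at this
  exact_mod_cast this

theorem dataIsLambdaOneMinimal_three : DataIsLambdaOneMinimal Q3 Y3 fun _ => 1 / 6 := by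
  have := isUnitSystem_A3.dataIsLambdaOneMinimal (by norm_num) (by norm_num) (c := 4) (by decide)
    (by norm_num)
  rw [halfMatrix_A3] at this
  exact_mod_cast this

theorem dataIsLambdaOneMinimal_four : DataIsLambdaOneMinimal Q4 Y4 fun _ => 1 / 10 := by
  have := isUnitSystem_A4.dataIsLambdaOneMinimal (by norm_num) (by norm_num) (c := 5)
    (by decide +kernel) (by norm_num)
  rw [halfMatrix_A4] at this
  exact_mod_cast this

section Uniqueness

/-- In type `A` there are as many weights as independent entries of a symmetric matrix, namely
`n(n+1)/2`, and the system is nonsingular. -/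
lemma weights_eq_two {w : Fin 3 → ℝ}
    (h : ∀ i l, ∑ j, w j * ((Y2 * A2) j i * (Y2 * A2) j l : ℤ) = 2 / (2 : ℕ) * A2 i l) :
    w = fun _ => 1 / 3 := by
  rw [Y2_mul_A2] at h
  simp only [Fin.forall_fin_succ] at h
  simp [Fin.sum_univ_succ, A2] at h
  obtain ⟨⟨h00, h01⟩, -, h11⟩ := h
  ext j
  fin_cases j <;> simp <;> linarith

lemma weights_eq_three {w : Fin 6 → ℝ}
    (h : ∀ i l, ∑ j, w j * ((Y3 * A3) j i * (Y3 * A3) j l : ℤ) = 2 / (3 : ℕ) * A3 i l) :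
    w = fun _ => 1 / 6 := by
  rw [Y3_mul_A3] at h
  simp only [Fin.forall_fin_succ] at h
  simp [Fin.sum_univ_succ, A3] at h
  obtain ⟨⟨h00, h01, h02⟩, ⟨-, h11, h12⟩, -, -, h22⟩ := h
  ext j
  fin_cases j <;> simp <;> linarith

lemma weights_eq_four {w : Fin 10 → ℝ}
    (h : ∀ i l, ∑ j, w j * ((Y4 * A4) j i * (Y4 * A4) j l : ℤ) = 2 / (4 : ℕ) * A4 i l) :
    w = fun _ => 1 / 10 := by
  rw [Y4_mul_A4] at h
  simp only [Fin.forall_fin_succ] at h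
  simp [Fin.sum_univ_succ, A4] at h
  obtain ⟨⟨h00, h01, h02, h03⟩, ⟨-, h11, h12, h13⟩, ⟨-, -, h22, h23⟩, -, -, -, h33⟩ := h
  ext j
  fin_cases j <;> simp <;> linarith

/-- The weights that are constant on the three frames of minimal vectors of `D4`. -/
def frameWeights (a b c : ℝ) : Fin 12 → ℝ := ![a, a, a, a, b, b, b, b, c, c, c, c]

/-- Twelve unknowns and ten independent equations: the solutions form a plane, that of weights
constant on each orthogonal frame with `a + b + c = 1/4`. -/
lemma weights_eq_frameWeights {w : Fin 12 → ℝ}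
    (h : ∀ i l, ∑ j, w j * ((frames * D4) j i * (frames * D4) j l : ℤ) = 2 / (4 : ℕ) * D4 i l) :
    w = frameWeights (w 0) (w 4) (w 8) := by
  rw [frames_mul_D4] at h
  simp only [Fin.forall_fin_succ] at h
  simp [Fin.sum_univ_succ, D4] at h
  obtain ⟨⟨h00, h01, h02, h03⟩, ⟨-, h11, h12, h13⟩, ⟨-, -, h22, h23⟩, -, -, -, h33⟩ := h
  ext j
  fin_cases j <;> simp [frameWeights] <;> linarith

lemma frame_condition {a b c : ℝ} (h : a + b + c = 1 / 4) (i l : Fin 4) :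
    ∑ j, frameWeights a b c j * ((frames * D4) j i * (frames * D4) j l : ℤ) =
      2 / (4 : ℕ) * D4 i l := by
  rw [frames_mul_D4]
  fin_cases i <;> fin_cases l <;> simp [Fin.sum_univ_succ, D4, frameWeights] <;> linarith

lemma frameWeights_nonneg {a b c : ℝ} (ha : 0 ≤ a) (hb : 0 ≤ b) (hc : 0 ≤ c) (j : Fin 12) :
    0 ≤ frameWeights a b c j := by
  fin_cases j <;> assumption

lemma sum_frameWeights (a b c : ℝ) : ∑ j, frameWeights a b c j = 4 * (a + b + c) := by
  simp [Fin.sum_univ_succ, frameWeights]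
  ring

end Uniqueness

section Congruence

variable {n N : ℕ} {Z : Matrix (Fin n) (Fin n) ℤ} {Y : Matrix (Fin N) (Fin n) ℤ}

lemma IsUnitSystem.congruentToData (h : IsUnitSystem Z Y) (hn : 0 < n) {w₀ : Fin N → ℝ}
    (huniq : ∀ w : Fin N → ℝ,
      (∀ i l, ∑ j, w j * ((Y * Z) j i * (Y * Z) j l : ℤ) = 2 / n * Z i l) → w = w₀)
    {η b : Fin n → E n} (hb : Matrix.gram ℝ b = halfMatrix Z)
    (hspan : Submodule.span ℤ (Set.range b) = Submodule.span ℤ (Set.range η)) {m : ℕ}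
    {x : E n → E m} (hx : IsLambdaOneMinimal (torusLattice η) x) :
    CongruentToData (torusLattice η) x (halfMatrix Z) Y w₀ := by
  rw [← torusLattice_congr hspan] at hx ⊢
  obtain ⟨w, hw, -, hframe, hK⟩ := h.exists_weights hn hb hx
  obtain rfl := huniq w hframe
  exact congruentToData_of_inner_eq hb rfl hw hK

end Congruence

theorem congruentToData_two {Q : Matrix (Fin 2) (Fin 2) ℝ} (hQ : Q ∈ vertices 2)
    {η : Fin 2 → E 2} (hη : Matrix.gram ℝ η = Q) {m : ℕ} {x : E 2 → E m}
    (hx : IsLambdaOneMinimal (torusLattice η) x) :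
    CongruentToData (torusLattice η) x Q2 Y2 fun _ => 1 / 3 := by
  obtain ⟨b, hspan, hb⟩ := exists_gram_eq_of_mem_vertices_two hQ hη
  rw [← halfMatrix_A2]
  exact isUnitSystem_A2.congruentToData (by norm_num) (fun _ => weights_eq_two) hb hspan hx

theorem congruentToData_three {Q : Matrix (Fin 3) (Fin 3) ℝ} (hQ : Q ∈ vertices 3)
    {η : Fin 3 → E 3} (hη : Matrix.gram ℝ η = Q) {m : ℕ} {x : E 3 → E m}
    (hx : IsLambdaOneMinimal (torusLattice η) x) :
    CongruentToData (torusLattice η) x Q3 Y3 fun _ => 1 / 6 := by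
  obtain ⟨b, hspan, hb⟩ := exists_gram_eq_of_mem_vertices_three hQ hη
  rw [← halfMatrix_A3]
  exact isUnitSystem_A3.congruentToData (by norm_num) (fun _ => weights_eq_three) hb hspan hx

section Existence

lemma isLambdaOneMinimal_dataMap_D4 {b : Fin 4 → E 4} (hb : Matrix.gram ℝ b = halfMatrix D4)
    {α β γ : ℝ} (hα : 0 ≤ α) (hβ : 0 ≤ β) (hγ : 0 ≤ γ) (h : α + β + γ = 1 / 4) :
    IsLambdaOneMinimal (torusLattice b) (dataMap b frames (frameWeights α β γ)) :=
  isUnitSystem_D4.isLambdaOneMinimal_dataMap (by norm_num) hb (frameWeights_nonneg hα hβ hγ)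
    (by rw [sum_frameWeights, h]; norm_num) (frame_condition h)

lemma exists_isLambdaOneMinimal_of_gram_eq {n N : ℕ} (hn : 0 < n) (hN : 0 < N)
    {Z : Matrix (Fin n) (Fin n) ℤ} {Y : Matrix (Fin N) (Fin n) ℤ} (h : IsUnitSystem Z Y) {c : ℤ}
    (hc : (Y * Z).transpose * (Y * Z) = c • Z) (hcn : c * n = 2 * N) {η b : Fin n → E n}
    (hb : Matrix.gram ℝ b = halfMatrix Z)
    (hspan : Submodule.span ℤ (Set.range b) = Submodule.span ℤ (Set.range η)) :
    ∃ (m : ℕ) (x : E n → E (m + 1)), IsLambdaOneMinimal (torusLattice η) x := by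
  have : Nonempty (Fin N) := ⟨⟨0, hN⟩⟩
  rw [← torusLattice_congr hspan]
  exact (h.isLambdaOneMinimal_uniform hn hN hc hcn hb).exists_euclidean

theorem exists_isLambdaOneMinimal_of_mem_vertices {n : ℕ} (hn : 1 ≤ n) (hn4 : n ≤ 4)
    {Q : Matrix (Fin n) (Fin n) ℝ} (hQ : Q ∈ vertices n) {η : Fin n → E n}
    (hη : Matrix.gram ℝ η = Q) :
    ∃ (m : ℕ) (x : E n → E (m + 1)), IsLambdaOneMinimal (torusLattice η) x := by
  interval_cases n
  · exact exists_isLambdaOneMinimal_of_gram_eq (by norm_num) (by norm_num) isUnitSystem_A1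
      (c := 2) (by decide) (by norm_num) (exists_gram_eq_of_mem_vertices_one hQ hη) rfl
  · obtain ⟨b, hspan, hb⟩ := exists_gram_eq_of_mem_vertices_two hQ hη
    exact exists_isLambdaOneMinimal_of_gram_eq (by norm_num) (by norm_num) isUnitSystem_A2
      (c := 3) (by decide) (by norm_num) hb hspan
  · obtain ⟨b, hspan, hb⟩ := exists_gram_eq_of_mem_vertices_three hQ hη
    exact exists_isLambdaOneMinimal_of_gram_eq (by norm_num) (by norm_num) isUnitSystem_A3
      (c := 4) (by decide) (by norm_num) hb hspan
  · obtain ⟨b, hspan, hb | hb⟩ := exists_gram_eq_of_mem_vertices_four hQ hη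
    · exact exists_isLambdaOneMinimal_of_gram_eq (by norm_num) (by norm_num) isUnitSystem_A4
        (c := 5) (by decide +kernel) (by norm_num) hb hspan
    · exact exists_isLambdaOneMinimal_of_gram_eq (by norm_num) (by norm_num) isUnitSystem_D4
        (c := 6) (by decide +kernel) (by norm_num) hb hspan

end Existence

end FlatTori

/-! ### The family of immersions of the torus of type `D4`. -/

namespace FlatTori

section Isometry

variable {n : ℕ} {b b' : Fin n → E n}

lemma exists_isometry_of_gram_eq (hb : LinearIndependent ℝ b)
    (h : Matrix.gram ℝ b = Matrix.gram ℝ b') : ∃ g : E n ≃ₗᵢ[ℝ] E n, ∀ i, g (b i) = b' i := by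
  have hb' : LinearIndependent ℝ b' := by
    rwa [← Matrix.posDef_gram_iff_linearIndependent, ← h,
      Matrix.posDef_gram_iff_linearIndependent]
  let L := (basisOf hb).equiv (basisOf hb') (Equiv.refl _)
  have hL : ∀ i, L (b i) = b' i := fun i => by
    have := (basisOf hb).equiv_apply (b' := basisOf hb') i (Equiv.refl _)
    rwa [coe_basisOf, coe_basisOf] at this
  have hinner : ∀ x y, ⟪L x, L y⟫_ℝ = ⟪x, y⟫_ℝ := by
    have : (innerₗ (E n)).compl₁₂ L.toLinearMap L.toLinearMap = innerₗ (E n) := by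
      refine (basisOf hb).ext fun i => (basisOf hb).ext fun j => ?_
      rw [coe_basisOf]
      change ⟪L (b i), L (b j)⟫_ℝ = ⟪b i, b j⟫_ℝ
      rw [hL, hL]
      exact (congrFun (congrFun h i) j).symm
    intro x y
    exact LinearMap.congr_fun (LinearMap.congr_fun this x) y
  exact ⟨L.isometryOfInner hinner, hL⟩

lemma inner_comb_map {g : E n ≃ₗᵢ[ℝ] E n} (hg : ∀ i, g (b i) = b' i) (k : Fin n → ℤ) (u : E n) :
    ⟪comb b' k, g u⟫_ℝ = ⟪comb b k, u⟫_ℝ := by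
  have : comb b' k = g (comb b k) := by
    simp [comb, hg]
  rw [this, g.inner_map_map]

lemma mem_torusLattice_map {g : E n ≃ₗᵢ[ℝ] E n} (hg : ∀ i, g (b i) = b' i) (u : E n) :
    u ∈ torusLattice b ↔ g u ∈ torusLattice b' := by
  simp only [mem_torusLattice, ← hg, g.inner_map_map]

end Isometry

section Family

/-- A basis of the dual of `familyLattice`. -/
noncomputable def familyBasis : Fin 4 → E 4 :=
  ![!₂[1 / 2, 1 / 2, 1 / 2, 1 / 2], !₂[0, 1, 0, 0], !₂[0, 0, 1, 0], !₂[0, 0, 0, 1]]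

lemma inner_comb_familyBasis (k : Fin 4 → ℤ) (u : E 4) :
    ⟪comb familyBasis k, u⟫_ℝ =
      k 0 * ((u 0 + u 1 + u 2 + u 3) / 2) + k 1 * u 1 + k 2 * u 2 + k 3 * u 3 := by
  simp [comb, familyBasis, PiLp.inner_apply, Fin.sum_univ_four]
  ring

lemma gram_familyBasis : Matrix.gram ℝ familyBasis = halfMatrix D4 := by
  ext i j
  fin_cases i <;> fin_cases j <;>
    simp [Matrix.gram_apply, halfMatrix_apply, familyBasis, D4, EuclideanSpace.norm_sq_eq,
      PiLp.inner_apply, Fin.sum_univ_four]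
  all_goals norm_num

lemma torusLattice_familyBasis : torusLattice familyBasis = familyLattice := by
  refine le_antisymm (fun u hu => ?_) (Submodule.span_le.2 ?_)
  · rw [mem_torusLattice] at hu
    obtain ⟨m, hm⟩ := hu 0
    obtain ⟨p, hp⟩ := hu 1
    obtain ⟨q, hq⟩ := hu 2
    obtain ⟨r, hr⟩ := hu 3
    simp [familyBasis, PiLp.inner_apply, Fin.sum_univ_four] at hm hp hq hr
    -- Here `m` is half the sum of the coordinates and `p, q, r` are the last three, so the first
    -- coordinate is `2m - p - q - r`.
    have e : u = (2 * m - p - q - r) • !₂[1, 0, 0, -1] + p • !₂[0, 1, 0, -1] +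
        q • !₂[0, 0, 1, -1] + m • !₂[0, 0, 0, 2] := by
      ext i
      fin_cases i <;> simp <;> linarith
    rw [e]
    refine Submodule.add_mem _ (Submodule.add_mem _ (Submodule.add_mem _ ?_ ?_) ?_) ?_ <;>
      exact Submodule.smul_mem _ _ (Submodule.subset_span (by simp))
  · rintro _ (rfl | rfl | rfl | rfl) <;> rw [SetLike.mem_coe, mem_torusLattice] <;> intro i
    · refine ⟨(![0, 0, 0, -1] : Fin 4 → ℤ) i, ?_⟩
      fin_cases i <;> simp [familyBasis, PiLp.inner_apply, Fin.sum_univ_four]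
    · refine ⟨(![0, 1, 0, -1] : Fin 4 → ℤ) i, ?_⟩
      fin_cases i <;> simp [familyBasis, PiLp.inner_apply, Fin.sum_univ_four]
    · refine ⟨(![0, 0, 1, -1] : Fin 4 → ℤ) i, ?_⟩
      fin_cases i <;> simp [familyBasis, PiLp.inner_apply, Fin.sum_univ_four]
    · refine ⟨(![1, 0, 0, 2] : Fin 4 → ℤ) i, ?_⟩
      fin_cases i <;> simp [familyBasis, PiLp.inner_apply, Fin.sum_univ_four]

lemma familyMap_eq_dataMap {α β γ : ℝ} (hα : 0 ≤ α) (hβ : 0 ≤ β) (hγ : 0 ≤ γ) :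
    familyMap α β γ = dataMap familyBasis frames (frameWeights (α ^ 2) (β ^ 2) (γ ^ 2)) := by
  funext u
  have h : ∀ j, dataMap familyBasis frames (frameWeights (α ^ 2) (β ^ 2) (γ ^ 2)) u j =
      (Real.sqrt (frameWeights (α ^ 2) (β ^ 2) (γ ^ 2) j) : ℂ) *
        Complex.exp (2 * Real.pi * Complex.I * (⟪comb familyBasis (frames j), u⟫_ℝ : ℝ)) :=
    fun j => rfl
  ext j
  rw [h, inner_comb_familyBasis]
  fin_cases j <;>
    simp [familyMap, frameWeights, frames, Real.sqrt_sq, hα, hβ, hγ] <;> left <;> congr 1 <;> ring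

theorem isLambdaOneMinimal_familyMap {α β γ : ℝ} (h : FamilyParams α β γ) :
    IsLambdaOneMinimal familyLattice (familyMap α β γ) := by
  obtain ⟨hα, hαβ, hβγ, hsum⟩ := h
  rw [familyMap_eq_dataMap hα (hα.trans hαβ) ((hα.trans hαβ).trans hβγ),
    ← torusLattice_familyBasis]
  exact isLambdaOneMinimal_dataMap_D4 gram_familyBasis (sq_nonneg _) (sq_nonneg _) (sq_nonneg _)
    hsum

end Family

/-! ### Ordering the three weights by lattice automorphisms. -/

section Sorting

lemma comb_comb {n : ℕ} (b : Fin n → E n) (U : Matrix (Fin n) (Fin n) ℤ) (k : Fin n → ℤ) :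
    comb (fun i => comb b (U i)) k = comb b (Matrix.vecMul k U) := by
  simp only [comb, Finset.smul_sum, smul_smul, Matrix.vecMul, dotProduct, Finset.sum_smul]
  rw [Finset.sum_comm]

/-- A change of basis that permutes the frequencies up to sign. -/
lemma exists_basis_of_perm {η : Fin 4 → E 4} {K : E 4 → E 4 → ℝ} {w : Fin 12 → ℝ}
    (U : Matrix (Fin 4) (Fin 4) ℤ) (hU : U * U = 1) (hUD : U * D4 * U.transpose = D4)
    {σ : Fin 12 → Fin 12} (hσ : ∀ j, σ (σ j) = j)
    (hUσ : ∀ j, Matrix.vecMul (frames j) U = frames (σ j) ∨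
      Matrix.vecMul (frames j) U = -frames (σ j))
    (h : ∃ b : Fin 4 → E 4, Matrix.gram ℝ b = halfMatrix D4 ∧
      Submodule.span ℤ (Set.range b) = Submodule.span ℤ (Set.range η) ∧
      ∀ u v, K u v = ∑ j, w j * (wave (comb b (frames j)) (u - v)).re) :
    ∃ b : Fin 4 → E 4, Matrix.gram ℝ b = halfMatrix D4 ∧
      Submodule.span ℤ (Set.range b) = Submodule.span ℤ (Set.range η) ∧
      ∀ u v, K u v = ∑ j, w (σ j) * (wave (comb b (frames j)) (u - v)).re := by
  obtain ⟨b, hb, hspan, hK⟩ := h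
  refine ⟨fun i => comb b (U i), by rw [gram_comb hb, hUD], (span_comb_eq b hU).trans hspan,
    fun u v => ?_⟩
  rw [hK, ← Equiv.sum_comp ⟨σ, σ, hσ, hσ⟩]
  refine Finset.sum_congr rfl fun j _ => ?_
  rw [comb_comb, Equiv.coe_fn_mk]
  rcases hUσ j with h | h <;> rw [h]
  rw [comb_neg, re_wave, re_wave, inner_neg_left, mul_neg, Real.cos_neg]

lemma frameWeights_swap_left (α β γ : ℝ) (j : Fin 12) :
    frameWeights α β γ ((![7, 6, 5, 4, 3, 2, 1, 0, 8, 9, 10, 11] : Fin 12 → Fin 12) j) =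
      frameWeights β α γ j := by
  fin_cases j <;> simp [frameWeights]

lemma frameWeights_swap_right (α β γ : ℝ) (j : Fin 12) :
    frameWeights α β γ ((![0, 1, 2, 3, 11, 10, 9, 8, 7, 6, 5, 4] : Fin 12 → Fin 12) j) =
      frameWeights α γ β j := by
  fin_cases j <;> simp [frameWeights]

lemma exists_sorted {P : ℝ → ℝ → ℝ → Prop} (h₁ : ∀ a b c, P a b c → P b a c)
    (h₂ : ∀ a b c, P a b c → P a c b) {a b c : ℝ} (h : P a b c) :
    ∃ a' b' c', P a' b' c' ∧ a' ≤ b' ∧ b' ≤ c' := by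
  rcases le_total a b with h1 | h1 <;> rcases le_total b c with h2 | h2 <;>
    rcases le_total a c with h3 | h3
  · exact ⟨_, _, _, h, h1, h2⟩
  · exact ⟨_, _, _, h, h1, h2⟩
  · exact ⟨_, _, _, h₂ _ _ _ h, h3, h2⟩
  · exact ⟨_, _, _, h₁ _ _ _ (h₂ _ _ _ h), h3, h1⟩
  · exact ⟨_, _, _, h₁ _ _ _ h, h1, h3⟩
  · exact ⟨_, _, _, h₂ _ _ _ (h₁ _ _ _ h), h2, h3⟩
  · exact ⟨_, _, _, h₁ _ _ _ h, h1, h3⟩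
  · exact ⟨_, _, _, h₁ _ _ _ (h₂ _ _ _ (h₁ _ _ _ h)), h2, h1⟩

theorem exists_congruent_familyMap {η b : Fin 4 → E 4} (hb : Matrix.gram ℝ b = halfMatrix D4)
    (hspan : Submodule.span ℤ (Set.range b) = Submodule.span ℤ (Set.range η)) {m : ℕ}
    {x : E 4 → E m} (hx : IsLambdaOneMinimal (torusLattice η) x) :
    ∃ a₁ a₂ a₃ : ℝ, FamilyParams a₁ a₂ a₃ ∧
      Congruent (torusLattice η) familyLattice x (familyMap a₁ a₂ a₃) := by
  rw [← torusLattice_congr hspan] at hx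
  obtain ⟨w, hw, hw1, hframe, hK⟩ := isUnitSystem_D4.exists_weights (by norm_num) hb hx
  rw [weights_eq_frameWeights hframe] at hK hw1
  -- The two changes of basis are the reflections in the minimal vectors `2 b₀ - b₁ - b₂ - b₃`, of
  -- the third frame, and `b₀`, of the first. Each preserves the frame of its vector and exchanges
  -- the other two.
  obtain ⟨α, β, γ, ⟨⟨hα, hβ, hγ, hsum⟩, b', hb', hspan', hK'⟩, hαβ, hβγ⟩ := exists_sorted
    (P := fun α β γ => (0 ≤ α ∧ 0 ≤ β ∧ 0 ≤ γ ∧ α + β + γ = 1 / 4) ∧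
      ∃ b : Fin 4 → E 4, Matrix.gram ℝ b = halfMatrix D4 ∧
      Submodule.span ℤ (Set.range b) = Submodule.span ℤ (Set.range η) ∧
      ∀ u v, ⟪x u, x v⟫_ℝ =
        ∑ j, frameWeights α β γ j * (wave (comb b (frames j)) (u - v)).re)
    (fun α β γ h => ⟨⟨h.1.2.1, h.1.1, h.1.2.2.1, by linarith [h.1.2.2.2]⟩, by
      have := exists_basis_of_perm !![-1, 1, 1, 1; 0, 1, 0, 0; 0, 0, 1, 0; 0, 0, 0, 1]
        (by decide) (by decide) (σ := ![7, 6, 5, 4, 3, 2, 1, 0, 8, 9, 10, 11]) (by decide)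
        (by decide) h.2
      simpa only [frameWeights_swap_left] using this⟩)
    (fun α β γ h => ⟨⟨h.1.1, h.1.2.2.1, h.1.2.1, by linarith [h.1.2.2.2]⟩, by
      have := exists_basis_of_perm !![-1, 0, 0, 0; -1, 1, 0, 0; -1, 0, 1, 0; -1, 0, 0, 1]
        (by decide) (by decide) (σ := ![0, 1, 2, 3, 11, 10, 9, 8, 7, 6, 5, 4]) (by decide)
        (by decide) h.2
      simpa only [frameWeights_swap_right] using this⟩)
    ⟨⟨hw 0, hw 4, hw 8, by rw [sum_frameWeights] at hw1; linarith⟩, b, hb, hspan, hK⟩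
  have hΩ := isUnitSystem_D4.mem
  rw [← hb', gram_mem_Omega2_iff] at hΩ
  obtain ⟨g, hg⟩ := exists_isometry_of_gram_eq hΩ.1 (hb'.trans gram_familyBasis.symm)
  refine ⟨√α, √β, √γ, ⟨Real.sqrt_nonneg _, Real.sqrt_le_sqrt hαβ, Real.sqrt_le_sqrt hβγ, ?_⟩, ?_⟩
  · rw [Real.sq_sqrt hα, Real.sq_sqrt hβ, Real.sq_sqrt hγ, hsum]
  · rw [familyMap_eq_dataMap (Real.sqrt_nonneg _) (Real.sqrt_nonneg _) (Real.sqrt_nonneg _),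
      Real.sq_sqrt hα, Real.sq_sqrt hβ, Real.sq_sqrt hγ, ← torusLattice_familyBasis,
      ← torusLattice_congr hspan']
    refine congruent_of_inner_eq g (mem_torusLattice_map hg) fun u v => ?_
    rw [hK', dataMap_eq_waveMap, inner_waveMap (frameWeights_nonneg hα hβ hγ)]
    refine Finset.sum_congr rfl fun j _ => ?_
    rw [re_wave, re_wave, ← map_sub, inner_comb_map hg]

end Sorting

theorem congruent_of_mem_vertices_four {Q : Matrix (Fin 4) (Fin 4) ℝ} (hQ : Q ∈ vertices 4)
    {η : Fin 4 → E 4} (hη : Matrix.gram ℝ η = Q) :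
    (∀ (m : ℕ) (x : E 4 → E (m + 1)), IsLambdaOneMinimal (torusLattice η) x →
      CongruentToData (torusLattice η) x Q4 Y4 fun _ => 1 / 10) ∨
    (∀ (m : ℕ) (x : E 4 → E (m + 1)), IsLambdaOneMinimal (torusLattice η) x →
      ∃ a₁ a₂ a₃ : ℝ, FamilyParams a₁ a₂ a₃ ∧
        Congruent (torusLattice η) familyLattice x (familyMap a₁ a₂ a₃)) := by
  obtain ⟨b, hspan, hb | hb⟩ := exists_gram_eq_of_mem_vertices_four hQ hη
  · left
    intro m x hx
    rw [← halfMatrix_A4]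
    exact isUnitSystem_A4.congruentToData (by norm_num) (fun _ => weights_eq_four) hb hspan hx
  · exact Or.inr fun m x hx => exists_congruent_familyMap hb hspan hx

end FlatTori

theorem mainTheorem7 :
    -- every vertex determines a λ₁-minimal flat torus in some sphere
    (∀ n : ℕ, 1 ≤ n → n ≤ 4 → ∀ Q ∈ FlatTori.vertices n,
      (∃ η : Fin n → FlatTori.E n, Matrix.gram ℝ η = Q) ∧
      ∀ η : Fin n → FlatTori.E n, Matrix.gram ℝ η = Q →
        ∃ (m : ℕ) (x : FlatTori.E n → FlatTori.E (m + 1)),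
          FlatTori.IsLambdaOneMinimal (FlatTori.torusLattice η) x) ∧
    -- n = 2
    ((∀ Q ∈ FlatTori.vertices 2, ∀ η : Fin 2 → FlatTori.E 2, Matrix.gram ℝ η = Q →
        ∀ (m : ℕ) (x : FlatTori.E 2 → FlatTori.E (m + 1)),
          FlatTori.IsLambdaOneMinimal (FlatTori.torusLattice η) x →
          FlatTori.CongruentToData (FlatTori.torusLattice η) x
            FlatTori.Q2 FlatTori.Y2 (fun _ => 1 / 3)) ∧
      FlatTori.Q2 ∈ FlatTori.vertices 2 ∧
      FlatTori.DataIsLambdaOneMinimal FlatTori.Q2 FlatTori.Y2 (fun _ => 1 / 3)) ∧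
    -- n = 3
    ((∀ Q ∈ FlatTori.vertices 3, ∀ η : Fin 3 → FlatTori.E 3, Matrix.gram ℝ η = Q →
        ∀ (m : ℕ) (x : FlatTori.E 3 → FlatTori.E (m + 1)),
          FlatTori.IsLambdaOneMinimal (FlatTori.torusLattice η) x →
          FlatTori.CongruentToData (FlatTori.torusLattice η) x
            FlatTori.Q3 FlatTori.Y3 (fun _ => 1 / 6)) ∧
      FlatTori.Q3 ∈ FlatTori.vertices 3 ∧
      FlatTori.DataIsLambdaOneMinimal FlatTori.Q3 FlatTori.Y3 (fun _ => 1 / 6)) ∧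
    -- n = 4
    ((∀ Q ∈ FlatTori.vertices 4, ∀ η : Fin 4 → FlatTori.E 4, Matrix.gram ℝ η = Q →
        (∀ (m : ℕ) (x : FlatTori.E 4 → FlatTori.E (m + 1)),
          FlatTori.IsLambdaOneMinimal (FlatTori.torusLattice η) x →
          FlatTori.CongruentToData (FlatTori.torusLattice η) x
            FlatTori.Q4 FlatTori.Y4 (fun _ => 1 / 10)) ∨
        (∀ (m : ℕ) (x : FlatTori.E 4 → FlatTori.E (m + 1)),
          FlatTori.IsLambdaOneMinimal (FlatTori.torusLattice η) x →
          ∃ a₁ a₂ a₃ : ℝ, FlatTori.FamilyParams a₁ a₂ a₃ ∧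
            FlatTori.Congruent (FlatTori.torusLattice η) FlatTori.familyLattice
              x (FlatTori.familyMap a₁ a₂ a₃))) ∧
      FlatTori.Q4 ∈ FlatTori.vertices 4 ∧
      FlatTori.DataIsLambdaOneMinimal FlatTori.Q4 FlatTori.Y4 (fun _ => 1 / 10) ∧
      (∃ Q ∈ FlatTori.vertices 4, ∃ η : Fin 4 → FlatTori.E 4,
        Matrix.gram ℝ η = Q ∧ FlatTori.torusLattice η = FlatTori.familyLattice) ∧
      ∀ a₁ a₂ a₃ : ℝ, FlatTori.FamilyParams a₁ a₂ a₃ →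
        FlatTori.IsLambdaOneMinimal FlatTori.familyLattice (FlatTori.familyMap a₁ a₂ a₃)) := by
  refine ⟨fun n hn hn4 Q hQ => ⟨FlatTori.exists_gram_eq_of_mem_vertices hQ, fun η hη =>
      FlatTori.exists_isLambdaOneMinimal_of_mem_vertices hn hn4 hQ hη⟩,
    ⟨fun Q hQ η hη m x hx => FlatTori.congruentToData_two hQ hη hx,
      FlatTori.Q2_mem_vertices, FlatTori.dataIsLambdaOneMinimal_two⟩,
    ⟨fun Q hQ η hη m x hx => FlatTori.congruentToData_three hQ hη hx,
      FlatTori.Q3_mem_vertices, FlatTori.dataIsLambdaOneMinimal_three⟩,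
    fun Q hQ η hη => FlatTori.congruent_of_mem_vertices_four hQ hη,
    FlatTori.Q4_mem_vertices, FlatTori.dataIsLambdaOneMinimal_four,
    ⟨_, FlatTori.halfMatrix_D4_mem_vertices, FlatTori.familyBasis, FlatTori.gram_familyBasis,
      FlatTori.torusLattice_familyBasis⟩,
    fun a₁ a₂ a₃ h => FlatTori.isLambdaOneMinimal_familyMap h⟩
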